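/- Let $M$ be a closed (compact, without boundary) smooth $n$-manifold and $m\ge 0$ an integer. For a bundle $E$ of $2$-tensors let $W^{m,2}(E)$ be the space of tensor fields (modulo equality almost everywhere) whose weak derivatives up to order $m$ are square integrable; if $2m\le n$, let all tensor fields below moreover be essentially bounded (if $2m>n$ this is automatic by the Sobolev embedding). Write $T^0_2M=T^*M\otimes T^*M$ and $T^2_0M=TM\otimes TM$. Let $W^{m,2}(M,g)$ be the set of symmetric nondegenerate tensor fields $g_{ij}\in W^{m,2}(T^0_2M)$ whose inverse satisfies $g^{ij}\in W^{m,2}(T^2_0M)$, and let $F:W^{m,2}(M,g)\to\mathbb R$ be a functional, which may be regarded as a function of $g_{ij}$ or of $g^{ij}$. Fix $g_{ij}\in W^{m,2}(M,g)$ and assume that $F$ has Euler–Lagrange operators at $g_{ij}$: for all symmetric $X_{ij}\in W^{m,2}(T^0_2M)$ and $X^{ij}\in W^{m,2}(T^2_0M)$ the tensors $g_{ij}+\lambda X_{ij}$ (respectively $g^{ij}+\lambda X^{ij}$) are metrics (respectively inverses of metrics) in $W^{m,2}(M,g)$ for small $|\lambda|$, and there are linear functionals $\delta_*F$ on $W^{m,2}(T^0_2M)$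 and $\delta^*F$ on $W^{m,2}(T^2_0M)$, continuous for the $W^{m,2}$-norm, with $$(\delta_*F,X)=\frac{d}{d\lambda}F(g_{ij}+\lambda X_{ij})\Big|_{\lambda=0},\qquad (\delta^*F,X)=\frac{d}{d\lambda}F(g^{ij}+\lambda X^{ij})\Big|_{\lambda=0}$$ for all symmetric $X_{ij}$, respectively $X^{ij}$. Then: (1) $\delta_*F$ and $\delta^*F$ are symmetric (distributional) tensor fields: among the functionals with these properties there is exactly one symmetric $\delta_*F$ and exactly one symmetric $\delta^*F$. These are meant in (2) and (3). (2) $g_{ij}$ is an extremum point of $F$ if and only if $g^{ij}$ is: $\delta_*F=0$ if and only if $\delta^*F=0$. (3) With indices lowered and raised by $g$, that is $((\delta_*F)_{rs},Y^{rs})=(\delta_*F,\,g_{rk}g_{sl}Y^{rs})$ for $Y\in W^{m,2}(T^2_0M)$, and $((\delta^*F)^{kl},X_{kl})=(\delta^*F,\,g^{kr}g^{ls}X_{kl})$ for $X\in W^{m,2}(T^0_2M)$ (these products belong to the indicated Sobolev spaces, and the functionals so defined are continuous for the $W^{m,2}$-norm), $$(\delta^*F)^{kl}=-g^{kr}g^{ls}(\delta_*F)_{rs}.$$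 -/

import Mathlib

open scoped Manifold ContDiff Topology
open MeasureTheory Filter

noncomputable section

/-! ### Local Sobolev functions on open subsets of Euclidean space -/

/-- `u` is square integrable on every compact subset of `Ω`. -/
def LocL2 {n : ℕ} (Ω : Set (EuclideanSpace ℝ (Fin n))) (u : EuclideanSpace ℝ (Fin n) → ℝ) : Prop :=
  ∀ K : Set (EuclideanSpace ℝ (Fin n)), IsCompact K → K ⊆ Ω → MemLp u 2 (volume.restrict K)

/-- `u` is essentially bounded on every compact subset of `Ω`. -/
def LocBounded {n : ℕ} (Ω : Set (EuclideanSpace ℝ (Fin n)))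
    (u : EuclideanSpace ℝ (Fin n) → ℝ) : Prop :=
  ∀ K : Set (EuclideanSpace ℝ (Fin n)), IsCompact K → K ⊆ Ω →
    ∃ C : ℝ, ∀ᵐ y ∂(volume.restrict K), |u y| ≤ C

/-- Test functions on `Ω`: smooth with compact support contained in `Ω`. -/
def IsTestFunction {n : ℕ} (Ω : Set (EuclideanSpace ℝ (Fin n)))
    (φ : EuclideanSpace ℝ (Fin n) → ℝ) : Prop :=
  ContDiff ℝ ∞ φ ∧ HasCompactSupport φ ∧ tsupport φ ⊆ Ω

/-- The classical partial derivative `∂_{ι 0} ⋯ ∂_{ι (k-1)} φ`. -/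
def partialDeriv {n k : ℕ} (ι : Fin k → Fin n) (φ : EuclideanSpace ℝ (Fin n) → ℝ)
    (y : EuclideanSpace ℝ (Fin n)) : ℝ :=
  iteratedFDeriv ℝ k φ y (fun j => EuclideanSpace.single (ι j) 1)

/-- `v` is a weak derivative `∂_{ι 0} ⋯ ∂_{ι (k-1)} u` in `Ω` and lies in `L²_loc(Ω)`. -/
def IsWeakDeriv {n k : ℕ} (Ω : Set (EuclideanSpace ℝ (Fin n))) (ι : Fin k → Fin n)
    (u v : EuclideanSpace ℝ (Fin n) → ℝ) : Prop :=
  LocL2 Ω v ∧ ∀ φ, IsTestFunction Ω φ →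
    ∫ y in Ω, u y * partialDeriv ι φ y = (-1) ^ k * ∫ y in Ω, v y * φ y

/-- `u ∈ W^{m,2}_loc(Ω)`. -/
def MemSobolevLoc {n : ℕ} (m : ℕ) (Ω : Set (EuclideanSpace ℝ (Fin n)))
    (u : EuclideanSpace ℝ (Fin n) → ℝ) : Prop :=
  LocL2 Ω u ∧ ∀ k ≤ m, ∀ ι : Fin k → Fin n, ∃ v, IsWeakDeriv Ω ι u v

open Classical in
/-- The weak derivative (determined almost everywhere in `Ω` when it exists). -/
def weakDeriv {n k : ℕ} (Ω : Set (EuclideanSpace ℝ (Fin n))) (ι : Fin k → Fin n)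
    (u : EuclideanSpace ℝ (Fin n) → ℝ) : EuclideanSpace ℝ (Fin n) → ℝ :=
  if h : ∃ v, IsWeakDeriv Ω ι u v then h.choose else 0

/-- The seminorm `∑_{|ι| ≤ m} ‖∂_ι u‖_{L²(K)}` of `W^{m,2}_loc(Ω)`, for `K ⊆ Ω` compact. -/
def sobolevSeminorm {n : ℕ} (m : ℕ) (Ω K : Set (EuclideanSpace ℝ (Fin n)))
    (u : EuclideanSpace ℝ (Fin n) → ℝ) : ℝ :=
  ∑ k ∈ Finset.range (m + 1), ∑ ι : Fin k → Fin n,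
    (eLpNorm (weakDeriv Ω ι u) 2 (volume.restrict K)).toReal

theorem LocL2.add {n : ℕ} {Ω : Set (EuclideanSpace ℝ (Fin n))}
    {u v : EuclideanSpace ℝ (Fin n) → ℝ} (hu : LocL2 Ω u) (hv : LocL2 Ω v) :
    LocL2 Ω (u + v) := fun K hK hKΩ => (hu K hK hKΩ).add (hv K hK hKΩ)

theorem LocL2.smul {n : ℕ} {Ω : Set (EuclideanSpace ℝ (Fin n))}
    {u : EuclideanSpace ℝ (Fin n) → ℝ} (hu : LocL2 Ω u) (c : ℝ) :
    LocL2 Ω (c • u) := fun K hK hKΩ => (hu K hK hKΩ).const_smul c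

theorem LocL2.zero {n : ℕ} (Ω : Set (EuclideanSpace ℝ (Fin n))) : LocL2 Ω 0 :=
  fun _ _ _ => MemLp.zero

theorem LocBounded.add {n : ℕ} {Ω : Set (EuclideanSpace ℝ (Fin n))}
    {u v : EuclideanSpace ℝ (Fin n) → ℝ} (hu : LocBounded Ω u) (hv : LocBounded Ω v) :
    LocBounded Ω (u + v) := by
  intro K hK hKΩ
  obtain ⟨C, hC⟩ := hu K hK hKΩ
  obtain ⟨D, hD⟩ := hv K hK hKΩ
  refine ⟨C + D, ?_⟩
  filter_upwards [hC, hD] with y h1 h2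
  exact (abs_add_le _ _).trans (add_le_add h1 h2)

theorem LocBounded.smul {n : ℕ} {Ω : Set (EuclideanSpace ℝ (Fin n))}
    {u : EuclideanSpace ℝ (Fin n) → ℝ} (hu : LocBounded Ω u) (c : ℝ) :
    LocBounded Ω (c • u) := by
  intro K hK hKΩ
  obtain ⟨C, hC⟩ := hu K hK hKΩ
  refine ⟨|c| * C, ?_⟩
  filter_upwards [hC] with y h1
  simpa [abs_mul] using mul_le_mul_of_nonneg_left h1 (abs_nonneg c)

theorem LocL2.integrable_mul {n : ℕ} {Ω : Set (EuclideanSpace ℝ (Fin n))}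
    {u φ : EuclideanSpace ℝ (Fin n) → ℝ} (hu : LocL2 Ω u) (hφ : Continuous φ)
    (hc : HasCompactSupport φ) (hs : tsupport φ ⊆ Ω) :
    Integrable (fun y => u y * φ y) (volume.restrict Ω) := by
  have h1 : MemLp u 2 (volume.restrict (tsupport φ)) := hu _ hc hs
  have h2 : MemLp φ 2 (volume.restrict (tsupport φ)) :=
    (hφ.memLp_of_hasCompactSupport hc).restrict _
  have h3 : IntegrableOn (fun y => u y * φ y) (tsupport φ) := h1.integrable_mul h2
  have h4 : Integrable (fun y => u y * φ y) := by
    refine (integrableOn_iff_integrable_of_support_subset ?_).1 h3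
    intro y hy
    exact subset_tsupport φ (right_ne_zero_of_mul hy)
  exact h4.restrict

theorem IsTestFunction.continuous_partialDeriv {n k : ℕ} {Ω : Set (EuclideanSpace ℝ (Fin n))}
    {φ : EuclideanSpace ℝ (Fin n) → ℝ} (hφ : IsTestFunction Ω φ) (ι : Fin k → Fin n) :
    Continuous (partialDeriv ι φ) := by
  have h : Continuous (iteratedFDeriv ℝ k φ) :=
    hφ.1.continuous_iteratedFDeriv (by exact_mod_cast le_top)
  unfold partialDeriv
  fun_prop

theorem IsTestFunction.tsupport_partialDeriv {n k : ℕ} {Ω : Set (EuclideanSpace ℝ (Fin n))}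
    {φ : EuclideanSpace ℝ (Fin n) → ℝ} (_hφ : IsTestFunction Ω φ) (ι : Fin k → Fin n) :
    tsupport (partialDeriv ι φ) ⊆ tsupport φ := by
  refine closure_minimal (fun y hy => ?_) (isClosed_tsupport φ)
  refine support_iteratedFDeriv_subset (𝕜 := ℝ) k (fun h => hy ?_)
  simp [partialDeriv, h]

theorem IsWeakDeriv.add {n k : ℕ} {Ω : Set (EuclideanSpace ℝ (Fin n))} {ι : Fin k → Fin n}
    {u u' v v' : EuclideanSpace ℝ (Fin n) → ℝ} (hu : LocL2 Ω u) (hu' : LocL2 Ω u')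
    (h : IsWeakDeriv Ω ι u v) (h' : IsWeakDeriv Ω ι u' v') :
    IsWeakDeriv Ω ι (u + u') (v + v') := by
  refine ⟨h.1.add h'.1, fun φ hφ => ?_⟩
  have hs := hφ.tsupport_partialDeriv ι
  have hcs : HasCompactSupport (partialDeriv ι φ) :=
    hφ.2.1.of_isClosed_subset (isClosed_tsupport _) hs
  have hcont := hφ.continuous_partialDeriv ι
  simp only [Pi.add_apply, add_mul]
  rw [integral_add (hu.integrable_mul hcont hcs (hs.trans hφ.2.2))
      (hu'.integrable_mul hcont hcs (hs.trans hφ.2.2)),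
    integral_add (h.1.integrable_mul hφ.1.continuous hφ.2.1 hφ.2.2)
      (h'.1.integrable_mul hφ.1.continuous hφ.2.1 hφ.2.2), h.2 φ hφ, h'.2 φ hφ, mul_add]

theorem IsWeakDeriv.smul {n k : ℕ} {Ω : Set (EuclideanSpace ℝ (Fin n))} {ι : Fin k → Fin n}
    {u v : EuclideanSpace ℝ (Fin n) → ℝ} (h : IsWeakDeriv Ω ι u v) (c : ℝ) :
    IsWeakDeriv Ω ι (c • u) (c • v) := by
  refine ⟨h.1.smul c, fun φ hφ => ?_⟩
  simp only [Pi.smul_apply, smul_eq_mul, mul_assoc, integral_const_mul]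
  rw [h.2 φ hφ]
  ring

theorem MemSobolevLoc.add {n m : ℕ} {Ω : Set (EuclideanSpace ℝ (Fin n))}
    {u v : EuclideanSpace ℝ (Fin n) → ℝ} (hu : MemSobolevLoc m Ω u) (hv : MemSobolevLoc m Ω v) :
    MemSobolevLoc m Ω (u + v) := by
  refine ⟨hu.1.add hv.1, fun k hk ι => ?_⟩
  obtain ⟨a, ha⟩ := hu.2 k hk ι
  obtain ⟨b, hb⟩ := hv.2 k hk ι
  exact ⟨a + b, ha.add hu.1 hv.1 hb⟩

theorem MemSobolevLoc.smul {n m : ℕ} {Ω : Set (EuclideanSpace ℝ (Fin n))}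
    {u : EuclideanSpace ℝ (Fin n) → ℝ} (hu : MemSobolevLoc m Ω u) (c : ℝ) :
    MemSobolevLoc m Ω (c • u) := by
  refine ⟨hu.1.smul c, fun k hk ι => ?_⟩
  obtain ⟨a, ha⟩ := hu.2 k hk ι
  exact ⟨c • a, ha.smul c⟩

theorem MemSobolevLoc.zero {n : ℕ} (m : ℕ) (Ω : Set (EuclideanSpace ℝ (Fin n))) :
    MemSobolevLoc m Ω 0 :=
  ⟨LocL2.zero Ω, fun _ _ _ => ⟨0, LocL2.zero Ω, fun φ _ => by simp⟩⟩

/-- The regularity class of the components: `W^{m,2}_loc`; if `2m ≤ n`, local essential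
boundedness is required too. For `2m > n` boundedness is automatic by the Sobolev embedding; for
`2m ≤ n` it is needed in order that small perturbations of a metric be metrics. -/
def MemSobolevClass {n : ℕ} (m : ℕ) (Ω : Set (EuclideanSpace ℝ (Fin n)))
    (u : EuclideanSpace ℝ (Fin n) → ℝ) : Prop :=
  MemSobolevLoc m Ω u ∧ (2 * m ≤ n → LocBounded Ω u)

theorem MemSobolevClass.add {n m : ℕ} {Ω : Set (EuclideanSpace ℝ (Fin n))}
    {u v : EuclideanSpace ℝ (Fin n) → ℝ} (hu : MemSobolevClass m Ω u)
    (hv : MemSobolevClass m Ω v) : MemSobolevClass m Ω (u + v) :=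
  ⟨hu.1.add hv.1, fun h => (hu.2 h).add (hv.2 h)⟩

theorem MemSobolevClass.smul {n m : ℕ} {Ω : Set (EuclideanSpace ℝ (Fin n))}
    {u : EuclideanSpace ℝ (Fin n) → ℝ} (hu : MemSobolevClass m Ω u) (c : ℝ) :
    MemSobolevClass m Ω (c • u) :=
  ⟨hu.1.smul c, fun h => (hu.2 h).smul c⟩

theorem MemSobolevClass.zero {n : ℕ} (m : ℕ) (Ω : Set (EuclideanSpace ℝ (Fin n))) :
    MemSobolevClass m Ω 0 :=
  ⟨MemSobolevLoc.zero m Ω, fun _ _ _ _ => ⟨0, by simp⟩⟩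

/-! ### Tensor fields of order two on a manifold -/

/-- Sections of `T⁰₂M = T*M ⊗ T*M`: a bilinear form on each tangent space. -/
abbrev CovField (n : ℕ) (M : Type*) [TopologicalSpace M]
    [ChartedSpace (EuclideanSpace ℝ (Fin n)) M] : Type _ :=
  ∀ x : M, LinearMap.BilinForm ℝ (TangentSpace (𝓡 n) x)

/-- Sections of `T²₀M = TM ⊗ TM`: a bilinear form on each cotangent space. -/
abbrev ContraField (n : ℕ) (M : Type*) [TopologicalSpace M]
    [ChartedSpace (EuclideanSpace ℝ (Fin n)) M] : Type _ :=
  ∀ x : M, LinearMap.BilinForm ℝ (Module.Dual ℝ (TangentSpace (𝓡 n) x))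

section Tensors

variable {n : ℕ} {M : Type*} [TopologicalSpace M] [ChartedSpace (EuclideanSpace ℝ (Fin n)) M]

/-- The coordinate vector `∂/∂xⁱ` of the chart `e` at the point with coordinates `y`. -/
def coordVec (e : OpenPartialHomeomorph M (EuclideanSpace ℝ (Fin n)))
    (y : EuclideanSpace ℝ (Fin n)) (i : Fin n) : TangentSpace (𝓡 n) (e.symm y) :=
  mfderiv (𝓡 n) (𝓡 n) e.symm y
    ((EuclideanSpace.single i 1 : EuclideanSpace ℝ (Fin n)) : TangentSpace (𝓡 n) y)

/-- The coordinate covector `dxⁱ` of the chart `e` at the point with coordinates `y`. -/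
def coordCovec (e : OpenPartialHomeomorph M (EuclideanSpace ℝ (Fin n)))
    (y : EuclideanSpace ℝ (Fin n)) (i : Fin n) :
    Module.Dual ℝ (TangentSpace (𝓡 n) (e.symm y)) :=
  (mfderiv (𝓡 n) 𝓘(ℝ, ℝ) (fun x : M => e x i) (e.symm y)).toLinearMap

/-- The component `X_{ij}` in the chart `e`, as a function of the coordinates. -/
def CovField.comp (X : CovField n M) (e : OpenPartialHomeomorph M (EuclideanSpace ℝ (Fin n)))
    (i j : Fin n) (y : EuclideanSpace ℝ (Fin n)) : ℝ :=
  X (e.symm y) (coordVec e y i) (coordVec e y j)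

/-- The component `Y^{ij}` in the chart `e`, as a function of the coordinates. -/
def ContraField.comp (Y : ContraField n M)
    (e : OpenPartialHomeomorph M (EuclideanSpace ℝ (Fin n)))
    (i j : Fin n) (y : EuclideanSpace ℝ (Fin n)) : ℝ :=
  Y (e.symm y) (coordCovec e y i) (coordCovec e y j)

/-- `p` holds almost everywhere on `M`, i.e. almost everywhere in the coordinates of each chart. -/
def AEOnManifold (n : ℕ) {M : Type*} [TopologicalSpace M]
    [ChartedSpace (EuclideanSpace ℝ (Fin n)) M] (p : M → Prop) : Prop :=
  ∀ e ∈ atlas (EuclideanSpace ℝ (Fin n)) M,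
    ∀ᵐ y ∂(volume.restrict e.target), p (e.symm y)

/-- The space `W^{m,2}(T⁰₂M)` (intersected with `L^∞` if `2m ≤ n`). -/
def SobolevCov (m n : ℕ) (M : Type*) [TopologicalSpace M]
    [ChartedSpace (EuclideanSpace ℝ (Fin n)) M] : Submodule ℝ (CovField n M) where
  carrier := {X | ∀ e ∈ atlas (EuclideanSpace ℝ (Fin n)) M, ∀ i j,
    MemSobolevClass m e.target (CovField.comp X e i j)}
  add_mem' := fun hX hY e he i j => (hX e he i j).add (hY e he i j)
  zero_mem' := fun e _ _ _ => MemSobolevClass.zero m e.target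
  smul_mem' := fun c _ hX e he i j => (hX e he i j).smul c

/-- The space `W^{m,2}(T²₀M)` (intersected with `L^∞` if `2m ≤ n`). -/
def SobolevContra (m n : ℕ) (M : Type*) [TopologicalSpace M]
    [ChartedSpace (EuclideanSpace ℝ (Fin n)) M] : Submodule ℝ (ContraField n M) where
  carrier := {Y | ∀ e ∈ atlas (EuclideanSpace ℝ (Fin n)) M, ∀ i j,
    MemSobolevClass m e.target (ContraField.comp Y e i j)}
  add_mem' := fun hX hY e he i j => (hX e he i j).add (hY e he i j)
  zero_mem' := fun e _ _ _ => MemSobolevClass.zero m e.target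
  smul_mem' := fun c _ hX e he i j => (hX e he i j).smul c

/-! ### Dual spaces -/

/-- A finite family of pairs (chart, compact set of coordinates in it). On a compact manifold the
`W^{m,2}`-norm is equivalent to a finite sum of the seminorms given by such pairs. -/
def IsPatchFamily
    (s : Finset (OpenPartialHomeomorph M (EuclideanSpace ℝ (Fin n)) ×
      Set (EuclideanSpace ℝ (Fin n)))) : Prop :=
  ∀ p ∈ s, p.1 ∈ atlas (EuclideanSpace ℝ (Fin n)) M ∧ IsCompact p.2 ∧ p.2 ⊆ p.1.target

/-- Continuity for the `W^{m,2}`-norm of a linear functional on `W^{m,2}(T⁰₂M)`, that is, the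
functional belongs to the dual space `W^{-m,2}`. -/
def IsBoundedCov {m : ℕ} (A : Module.Dual ℝ (SobolevCov m n M)) : Prop :=
  ∃ s : Finset (OpenPartialHomeomorph M (EuclideanSpace ℝ (Fin n)) ×
      Set (EuclideanSpace ℝ (Fin n))), IsPatchFamily s ∧ ∃ C : ℝ, ∀ X : SobolevCov m n M,
    |A X| ≤ C * ∑ p ∈ s, ∑ i, ∑ j, sobolevSeminorm m p.1.target p.2 (CovField.comp X.1 p.1 i j)

/-- Continuity for the `W^{m,2}`-norm of a linear functional on `W^{m,2}(T²₀M)`. -/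
def IsBoundedContra {m : ℕ} (B : Module.Dual ℝ (SobolevContra m n M)) : Prop :=
  ∃ s : Finset (OpenPartialHomeomorph M (EuclideanSpace ℝ (Fin n)) ×
      Set (EuclideanSpace ℝ (Fin n))), IsPatchFamily s ∧ ∃ C : ℝ, ∀ Y : SobolevContra m n M,
    |B Y| ≤ C * ∑ p ∈ s, ∑ i, ∑ j, sobolevSeminorm m p.1.target p.2 (ContraField.comp Y.1 p.1 i j)

/-- The (distributional, contravariant) tensor field `A` is symmetric, `A^{ij} = A^{ji}`. -/
def IsSymmCovDual {m : ℕ} (A : Module.Dual ℝ (SobolevCov m n M)) : Prop :=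
  ∀ X X' : SobolevCov m n M, (∀ x v w, X'.1 x v w = X.1 x w v) → A X' = A X

/-- The (distributional, covariant) tensor field `B` is symmetric, `B_{ij} = B_{ji}`. -/
def IsSymmContraDual {m : ℕ} (B : Module.Dual ℝ (SobolevContra m n M)) : Prop :=
  ∀ Y Y' : SobolevContra m n M, (∀ x α β, Y'.1 x α β = Y.1 x β α) → B Y' = B Y

/-! ### The space of metrics -/

/-- The space `W^{m,2}(M,g)`: a symmetric nondegenerate `g_{ij}` in `W^{m,2}(T⁰₂M)` together
with its inverse `g^{ij}` in `W^{m,2}(T²₀M)`. The condition `inverse` says `g_{ik} g^{kj} = δ_i^j`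
without coordinates; it makes both forms nondegenerate. -/
structure SobolevMetric (m n : ℕ) (M : Type*) [TopologicalSpace M]
    [ChartedSpace (EuclideanSpace ℝ (Fin n)) M] where
  lower : SobolevCov m n M
  upper : SobolevContra m n M
  symm : AEOnManifold n fun x : M => ∀ v w, lower.1 x v w = lower.1 x w v
  inverse : AEOnManifold n fun x : M =>
    ∀ (v : TangentSpace (𝓡 n) x) (β : Module.Dual ℝ (TangentSpace (𝓡 n) x)),
      upper.1 x (lower.1 x v) β = β v

/-- `F` does not distinguish metrics that agree almost everywhere, i.e. it is a function of the
element of the Sobolev space. -/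
def RespectsAE {m : ℕ} (F : SobolevMetric m n M → ℝ) : Prop :=
  ∀ g g' : SobolevMetric m n M, AEOnManifold n (fun x : M => g.lower.1 x = g'.lower.1 x) →
    F g = F g'

/-! ### Euler–Lagrange operators -/

/-- For small `λ` the tensor `g_{ij} + λ X_{ij}` is a metric in `W^{m,2}(M,g)`, and
`d/dλ F(g_{ij} + λ X_{ij})` at `λ = 0` is `a`. -/
def HasLowerVariation {m : ℕ} (F : SobolevMetric m n M → ℝ) (g : SobolevMetric m n M)
    (X : SobolevCov m n M) (a : ℝ) : Prop :=
  ∃ γ : ℝ → SobolevMetric m n M, (∀ᶠ t in 𝓝 (0 : ℝ), (γ t).lower = g.lower + t • X) ∧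
    HasDerivAt (fun t => F (γ t)) a 0

/-- For small `λ` the tensor `g^{ij} + λ Y^{ij}` is the inverse of a metric in `W^{m,2}(M,g)`, and
`d/dλ F(g^{ij} + λ Y^{ij})` at `λ = 0` is `a`. -/
def HasUpperVariation {m : ℕ} (F : SobolevMetric m n M → ℝ) (g : SobolevMetric m n M)
    (Y : SobolevContra m n M) (a : ℝ) : Prop :=
  ∃ γ : ℝ → SobolevMetric m n M, (∀ᶠ t in 𝓝 (0 : ℝ), (γ t).upper = g.upper + t • Y) ∧
    HasDerivAt (fun t => F (γ t)) a 0

/-- `A ∈ W^{-m,2}` satisfies `(A, X) = d/dλ F(g_{ij} + λ X_{ij})|_{λ=0}` for all symmetric `X`. -/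
def RepresentsLowerVariation {m : ℕ} (F : SobolevMetric m n M → ℝ) (g : SobolevMetric m n M)
    (A : Module.Dual ℝ (SobolevCov m n M)) : Prop :=
  IsBoundedCov A ∧ ∀ X : SobolevCov m n M, (∀ x v w, X.1 x v w = X.1 x w v) →
    HasLowerVariation F g X (A X)

/-- `B ∈ W^{-m,2}` satisfies `(B, Y) = d/dλ F(g^{ij} + λ Y^{ij})|_{λ=0}` for all symmetric `Y`. -/
def RepresentsUpperVariation {m : ℕ} (F : SobolevMetric m n M → ℝ) (g : SobolevMetric m n M)
    (B : Module.Dual ℝ (SobolevContra m n M)) : Prop :=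
  IsBoundedContra B ∧ ∀ Y : SobolevContra m n M, (∀ x α β, Y.1 x α β = Y.1 x β α) →
    HasUpperVariation F g Y (B Y)

/-! ### Raising and lowering indices -/

/-- The tensor field `g_{ik} g_{jl} Y^{kl}`. -/
def lowerIndices (g : CovField n M) (Y : ContraField n M) : CovField n M :=
  fun x => (Y x).compl₁₂ (g x) (g x)

/-- The map `T*ₓM → TₓM`, `α ↦ h^{kr} α_k ∂_r`, of a contravariant tensor field `h`. -/
def sharp (h : ContraField n M) (x : M) :
    Module.Dual ℝ (TangentSpace (𝓡 n) x) →ₗ[ℝ] TangentSpace (𝓡 n) x :=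
  haveI : FiniteDimensional ℝ (TangentSpace (𝓡 n) x) :=
    inferInstanceAs (FiniteDimensional ℝ (EuclideanSpace ℝ (Fin n)))
  (Module.evalEquiv ℝ (TangentSpace (𝓡 n) x)).symm.toLinearMap ∘ₗ h x

/-- The tensor field `h^{kr} h^{ls} X_{rs}`. -/
def raiseIndices (h : ContraField n M) (X : CovField n M) : ContraField n M :=
  fun x => (X x).compl₁₂ (sharp h x) (sharp h x)

/-- `A' = g_{rk} g_{sl} A^{kl}` in the sense of distributions: `A'` is the covariant tensor field
with `(A', Y) = (A, g_{rk} g_{sl} Y^{rs})` for all `Y ∈ W^{m,2}(T²₀M)`; the products on the right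
are required to be in `W^{m,2}(T⁰₂M)`. -/
def IsLowered {m : ℕ} (g : SobolevMetric m n M) (A : Module.Dual ℝ (SobolevCov m n M))
    (A' : Module.Dual ℝ (SobolevContra m n M)) : Prop :=
  IsBoundedContra A' ∧ ∀ Y : SobolevContra m n M,
    ∃ X : SobolevCov m n M, X.1 = lowerIndices g.lower.1 Y.1 ∧ A' Y = A X

/-- `B' = g^{kr} g^{ls} B_{rs}` in the sense of distributions: `B'` is the contravariant tensor
field with `(B', X) = (B, g^{kr} g^{ls} X_{kl})` for all `X ∈ W^{m,2}(T⁰₂M)`; the products on the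
right are required to be in `W^{m,2}(T²₀M)`. -/
def IsRaised {m : ℕ} (g : SobolevMetric m n M) (B : Module.Dual ℝ (SobolevContra m n M))
    (B' : Module.Dual ℝ (SobolevCov m n M)) : Prop :=
  IsBoundedCov B' ∧ ∀ X : SobolevCov m n M,
    ∃ Y : SobolevContra m n M, Y.1 = raiseIndices g.upper.1 X.1 ∧ B' X = B Y

end Tensors

end

/-! The formula is the chain rule for matrix inversion: if the inverse metric moves as `H + t Y`,
the metric `G` moves with velocity `-G Y G`, so `B Y = -A (G Y G)`. But `F` has only directional
derivatives at the one point `g`, linear in the direction but with no uniformity, and the inverse of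
a line is not a line. The usual chain rule is therefore unavailable.

The way out is a family of lines through `g` that cross. Let `L μ` be the inverse of `H + μ Y`. The
line of metrics `G + s (L μ) Y G` at `s = μ' - μ` is `(L μ) (H + μ' Y) G`. The line of inverse
metrics `H + s H ((L μ') Y G) H` at `s = μ - μ'` is the inverse of that same metric
(`eq_of_crossing` for matrices). So `F` along the lower line of index `μ` at `μ' - μ` agrees with
`F` along the upper line of index `μ'` at `μ - μ'`. Each line has a first-order expansion at `g`,
with an error bound valid on an interval depending on its index. An uncountable set of indices is a
countable union of sets on which the interval is uniform, so two distinct indices arbitrarily near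
zero lie within each other's intervals (`exists_pair_of_forall_eventually`). Subtracting the two
expansions and dividing by `μ' - μ` gives `A (G Y G) + B Y = 0`, provided that `A` and `B` are
continuous along the varying directions (`add_eq_zero_of_hasDerivAt_of_crossing`).

This continuity is the analytic part: `(L μ) Y G` must tend to `G Y G` in the Sobolev seminorms. It
solves `X = G Y G - μ X (Y G)`, so an a priori bound uniform in small `μ` suffices, and this follows
once multiplication is bounded (`IsSobBounded.mul`, `IsSobBoundedMat.of_eq_add_smul_mul`). The
algebra property comes from Gagliardo–Nirenberg: locally bounded functions with `m` derivatives in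
`L²` have derivatives of order `j` in `L^{2m/j}`, and these exponents fit Hölder's inequality in the
Leibniz formula. If `2m > n`, boundedness is obtained from the Sobolev embedding, proved by the
Fourier transform.

Symmetric representatives are obtained by composing with symmetrization. They are unique because a
symmetric functional is determined by its values on symmetric fields. The equivalence of the two
vanishing conditions follows from the formula and its inverse form. -/

noncomputable section

/-! ### Weak derivatives of first order and chains of them -/

/-- The classical partial derivative `∂ᵢ φ`. -/
def pd {n : ℕ} (i : Fin n) (φ : EuclideanSpace ℝ (Fin n) → ℝ) (y : EuclideanSpace ℝ (Fin n)) : ℝ :=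
  fderiv ℝ φ y (EuclideanSpace.single i 1)

/-- `v` is the weak partial derivative `∂ᵢ u` in `Ω`, both functions being in `L²_loc(Ω)`. -/
structure HasWeakPartial {n : ℕ} (Ω : Set (EuclideanSpace ℝ (Fin n))) (i : Fin n)
    (u v : EuclideanSpace ℝ (Fin n) → ℝ) : Prop where
  left : LocL2 Ω u
  right : LocL2 Ω v
  integral_eq : ∀ φ, IsTestFunction Ω φ → ∫ y, u y * pd i φ y = -∫ y, v y * φ y

section

variable {n : ℕ} {Ω Ω' : Set (EuclideanSpace ℝ (Fin n))} {u v u' v' φ ψ : EuclideanSpace ℝ (Fin n) → ℝ}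
  {i : Fin n}

theorem LocL2.mono (hu : LocL2 Ω u) (h : Ω' ⊆ Ω) : LocL2 Ω' u :=
  fun K hK hKΩ => hu K hK (hKΩ.trans h)

theorem LocL2.congr_ae (hu : LocL2 Ω u) (h : u =ᵐ[volume.restrict Ω] u') : LocL2 Ω u' :=
  fun K hK hKΩ => (memLp_congr_ae (ae_restrict_of_ae_restrict_of_subset hKΩ h)).1 (hu K hK hKΩ)

theorem LocL2.integrable_mul_test (hu : LocL2 Ω u) (hφ : Continuous φ)
    (hc : HasCompactSupport φ) (hs : tsupport φ ⊆ Ω) : Integrable (fun y => u y * φ y) := by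
  have h1 : MemLp u 2 (volume.restrict (tsupport φ)) := hu _ hc hs
  have h2 : MemLp φ 2 (volume.restrict (tsupport φ)) :=
    (hφ.memLp_of_hasCompactSupport hc).restrict _
  have h3 : IntegrableOn (fun y => u y * φ y) (tsupport φ) := h1.integrable_mul h2
  refine (integrableOn_iff_integrable_of_support_subset ?_).1 h3
  intro y hy
  exact subset_tsupport φ (right_ne_zero_of_mul hy)

theorem LocL2.locallyIntegrableOn (hu : LocL2 Ω u) (hΩ : IsOpen Ω) : LocallyIntegrableOn u Ω := by
  rw [locallyIntegrableOn_iff hΩ.isLocallyClosed]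
  intro K hKΩ hK
  have := hu K hK hKΩ
  have : IsFiniteMeasure (volume.restrict K) := ⟨by simpa using hK.measure_lt_top⟩
  exact (hu K hK hKΩ).integrable one_le_two

theorem contDiff_pd (hφ : ContDiff ℝ ∞ φ) (i : Fin n) : ContDiff ℝ ∞ (pd i φ) := by
  have h : ContDiff ℝ ∞ (fderiv ℝ φ) := hφ.fderiv_right (by simp)
  exact h.clm_apply contDiff_const

theorem tsupport_pd_subset (φ : EuclideanSpace ℝ (Fin n) → ℝ) (i : Fin n) :
    tsupport (pd i φ) ⊆ tsupport φ := by
  refine closure_minimal (fun y hy => ?_) (isClosed_tsupport φ)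
  refine support_fderiv_subset ℝ (fun h => hy ?_)
  simp [pd, h]

theorem HasCompactSupport.pd (h : HasCompactSupport φ) (i : Fin n) : HasCompactSupport (pd i φ) :=
  h.of_isClosed_subset (isClosed_tsupport _) (tsupport_pd_subset φ i)

theorem IsTestFunction.pd (hφ : IsTestFunction Ω φ) (i : Fin n) : IsTestFunction Ω (pd i φ) :=
  ⟨contDiff_pd hφ.1 i, hφ.2.1.pd i, (tsupport_pd_subset φ i).trans hφ.2.2⟩

theorem IsTestFunction.mono (hφ : IsTestFunction Ω' φ) (h : Ω' ⊆ Ω) : IsTestFunction Ω φ :=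
  ⟨hφ.1, hφ.2.1, hφ.2.2.trans h⟩

theorem IsTestFunction.mul_left (hφ : IsTestFunction Ω φ) (hψ : ContDiff ℝ ∞ ψ) :
    IsTestFunction Ω (fun y => ψ y * φ y) :=
  ⟨hψ.mul hφ.1, hφ.2.1.mul_left, (tsupport_mul_subset_right).trans hφ.2.2⟩

theorem pd_mul (hφ : ContDiff ℝ ∞ φ) (hψ : ContDiff ℝ ∞ ψ) (i : Fin n) (y) :
    pd i (fun y => φ y * ψ y) y = φ y * pd i ψ y + pd i φ y * ψ y := by
  have h1 := (hφ.differentiable (by simp)) y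
  have h2 := (hψ.differentiable (by simp)) y
  simp only [pd]
  rw [fderiv_fun_mul h1 h2]
  simp [mul_comm]

theorem HasWeakPartial.mono (h : HasWeakPartial Ω i u v) (hs : Ω' ⊆ Ω) : HasWeakPartial Ω' i u v :=
  ⟨h.left.mono hs, h.right.mono hs, fun φ hφ => h.integral_eq φ (hφ.mono hs)⟩

theorem integral_mul_congr_of_tsupport_subset (hφ : tsupport φ ⊆ Ω) (hΩ : MeasurableSet Ω)
    (h : u =ᵐ[volume.restrict Ω] u') : ∫ y, u y * φ y = ∫ y, u' y * φ y := by
  refine integral_congr_ae ?_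
  filter_upwards [(ae_restrict_iff' hΩ).1 h] with y hy
  by_cases hyΩ : y ∈ Ω
  · rw [hy hyΩ]
  · rw [image_eq_zero_of_notMem_tsupport (fun h => hyΩ (hφ h))]; simp

theorem HasWeakPartial.congr (h : HasWeakPartial Ω i u v) (hΩ : IsOpen Ω)
    (hu : u =ᵐ[volume.restrict Ω] u') (hv : v =ᵐ[volume.restrict Ω] v') :
    HasWeakPartial Ω i u' v' := by
  refine ⟨h.left.congr_ae hu, h.right.congr_ae hv, fun φ hφ => ?_⟩
  rw [← integral_mul_congr_of_tsupport_subset (hφ.pd i).2.2 hΩ.measurableSet hu,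
    ← integral_mul_congr_of_tsupport_subset hφ.2.2 hΩ.measurableSet hv]
  exact h.integral_eq φ hφ

theorem HasWeakPartial.add (h : HasWeakPartial Ω i u v) (h' : HasWeakPartial Ω i u' v') :
    HasWeakPartial Ω i (u + u') (v + v') := by
  refine ⟨h.left.add h'.left, h.right.add h'.right, fun φ hφ => ?_⟩
  have hd := hφ.pd i
  simp only [Pi.add_apply, add_mul]
  rw [integral_add (h.left.integrable_mul_test hd.1.continuous hd.2.1 hd.2.2)
      (h'.left.integrable_mul_test hd.1.continuous hd.2.1 hd.2.2),
    integral_add (h.right.integrable_mul_test hφ.1.continuous hφ.2.1 hφ.2.2)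
      (h'.right.integrable_mul_test hφ.1.continuous hφ.2.1 hφ.2.2),
    h.integral_eq φ hφ, h'.integral_eq φ hφ]
  ring

theorem HasWeakPartial.smul (h : HasWeakPartial Ω i u v) (c : ℝ) :
    HasWeakPartial Ω i (c • u) (c • v) := by
  refine ⟨h.left.smul c, h.right.smul c, fun φ hφ => ?_⟩
  simp only [Pi.smul_apply, smul_eq_mul, mul_assoc, integral_const_mul]
  rw [h.integral_eq φ hφ]
  ring

/-- The fundamental lemma of the calculus of variations, which makes weak derivatives unique up to
null sets. -/
theorem ae_eq_of_forall_test (hΩ : IsOpen Ω) (hv : LocL2 Ω v) (hv' : LocL2 Ω v')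
    (h : ∀ φ, IsTestFunction Ω φ → ∫ y, v y * φ y = ∫ y, v' y * φ y) :
    v =ᵐ[volume.restrict Ω] v' := by
  have key := IsOpen.ae_eq_zero_of_integral_contDiff_smul_eq_zero (μ := volume) hΩ (f := v - v')
    ((hv.locallyIntegrableOn hΩ).sub (hv'.locallyIntegrableOn hΩ)) (fun φ h1 h2 h3 => by
      have e := h φ ⟨h1, h2, h3⟩
      have : (fun x => φ x • (v - v') x) = fun x => v x * φ x - v' x * φ x := by
        funext x; simp; ring
      rw [this, integral_sub (hv.integrable_mul_test h1.continuous h2 h3)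
        (hv'.integrable_mul_test h1.continuous h2 h3), e, sub_self])
  refine (ae_restrict_iff' hΩ.measurableSet).2 ?_
  filter_upwards [key] with y hy hyΩ
  exact sub_eq_zero.1 (hy hyΩ)

theorem HasWeakPartial.unique (hΩ : IsOpen Ω) (h : HasWeakPartial Ω i u v)
    (h' : HasWeakPartial Ω i u v') : v =ᵐ[volume.restrict Ω] v' :=
  ae_eq_of_forall_test hΩ h.right h'.right fun φ hφ =>
    neg_injective ((h.integral_eq φ hφ).symm.trans (h'.integral_eq φ hφ))

/-- A function has `l` orders of weak derivatives, the derivative of order `j` satisfying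
`P (k + j)`. -/
def IterReg (Ω : Set (EuclideanSpace ℝ (Fin n))) (P : ℕ → (EuclideanSpace ℝ (Fin n) → ℝ) → Prop) :
    ℕ → ℕ → (EuclideanSpace ℝ (Fin n) → ℝ) → Prop
  | k, 0, u => P k u
  | k, l + 1, u => P k u ∧ ∀ i, ∃ v, HasWeakPartial Ω i u v ∧ IterReg Ω P (k + 1) l v

variable {P Q R : ℕ → (EuclideanSpace ℝ (Fin n) → ℝ) → Prop} {k l : ℕ}

theorem IterReg.self (h : IterReg Ω P k l u) : P k u := by
  cases l with
  | zero => exact h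
  | succ l => exact h.1

theorem IterReg.pred (h : IterReg Ω P k (l + 1) u) : IterReg Ω P k l u := by
  induction l generalizing k u with
  | zero => exact h.1
  | succ l ih =>
    refine ⟨h.1, fun i => ?_⟩
    obtain ⟨v, hv, hv'⟩ := h.2 i
    exact ⟨v, hv, ih hv'⟩

theorem IterReg.imp (h : IterReg Ω P k l u) (hPQ : ∀ j u, k ≤ j → j ≤ k + l → P j u → Q j u) :
    IterReg Ω Q k l u := by
  induction l generalizing k u with
  | zero => exact hPQ k u le_rfl le_rfl h
  | succ l ih =>
    refine ⟨hPQ _ _ le_rfl (by omega) h.1, fun i => ?_⟩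
    obtain ⟨v, hv, hv'⟩ := h.2 i
    exact ⟨v, hv, ih hv' fun j u h1 h2 => hPQ j u (by omega) (by omega)⟩

theorem IterReg.mono (h : IterReg Ω P k l u) (hs : Ω' ⊆ Ω) : IterReg Ω' P k l u := by
  induction l generalizing k u with
  | zero => exact h
  | succ l ih =>
    refine ⟨h.1, fun i => ?_⟩
    obtain ⟨v, hv, hv'⟩ := h.2 i
    exact ⟨v, hv.mono hs, ih hv'⟩

theorem IterReg.add (hP : IterReg Ω P k l u) (hQ : IterReg Ω Q k l v)
    (hR : ∀ j u v, P j u → Q j v → R j (u + v)) : IterReg Ω R k l (u + v) := by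
  induction l generalizing k u v with
  | zero => exact hR _ _ _ hP hQ
  | succ l ih =>
    refine ⟨hR _ _ _ hP.1 hQ.1, fun i => ?_⟩
    obtain ⟨a, ha, ha'⟩ := hP.2 i
    obtain ⟨b, hb, hb'⟩ := hQ.2 i
    exact ⟨a + b, ha.add hb, ih ha' hb'⟩

theorem IterReg.smul (hP : IterReg Ω P k l u) (c : ℝ) (hQ : ∀ j u, P j u → Q j (c • u)) :
    IterReg Ω Q k l (c • u) := by
  induction l generalizing k u with
  | zero => exact hQ _ _ hP
  | succ l ih =>
    refine ⟨hQ _ _ hP.1, fun i => ?_⟩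
    obtain ⟨a, ha, ha'⟩ := hP.2 i
    exact ⟨c • a, ha.smul c, ih ha'⟩

/-- The chain of derivatives of `u` also serves `u'`, so only the property of order zero has to be
supplied anew. -/
theorem IterReg.congr (hΩ : IsOpen Ω) (hP : IterReg Ω P k l u) (h : u =ᵐ[volume.restrict Ω] u')
    (hu' : P k u') : IterReg Ω P k l u' := by
  cases l with
  | zero => exact hu'
  | succ l =>
    refine ⟨hu', fun i => ?_⟩
    obtain ⟨a, ha, ha'⟩ := hP.2 i
    exact ⟨a, ha.congr hΩ h (ae_eq_refl _), ha'⟩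

/-- The local form of regularity: if near each compact set `u` agrees with a function having
weak derivatives with the property `P`, then the weak derivatives of `u` have the property `Q`. -/
theorem IterReg.of_local (hu : IterReg Ω (fun _ => LocL2 Ω) k l u)
    (hloc : ∀ K : Set (EuclideanSpace ℝ (Fin n)), IsCompact K → K ⊆ Ω → ∃ O, IsOpen O ∧ K ⊆ O ∧ O ⊆ Ω ∧
      ∃ u', u =ᵐ[volume.restrict O] u' ∧ IterReg O P k l u')
    (hQ : ∀ j u, LocL2 Ω u → (∀ K : Set (EuclideanSpace ℝ (Fin n)), IsCompact K → K ⊆ Ω → ∃ u',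
      u =ᵐ[volume.restrict K] u' ∧ P j u') → Q j u) : IterReg Ω Q k l u := by
  induction l generalizing k u with
  | zero =>
    refine hQ _ _ hu fun K hK hKΩ => ?_
    obtain ⟨O, -, hKO, -, u', h1, h2⟩ := hloc K hK hKΩ
    exact ⟨u', ae_restrict_of_ae_restrict_of_subset hKO h1, h2.self⟩
  | succ l ih =>
    refine ⟨hQ _ _ hu.1 fun K hK hKΩ => ?_, fun i => ?_⟩
    · obtain ⟨O, -, hKO, -, u', h1, h2⟩ := hloc K hK hKΩ
      exact ⟨u', ae_restrict_of_ae_restrict_of_subset hKO h1, h2.self⟩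
    · obtain ⟨v, hv, hv'⟩ := hu.2 i
      refine ⟨v, hv, ih hv' fun K hK hKΩ => ?_⟩
      obtain ⟨O, hO, hKO, hOΩ, u', h1, h2⟩ := hloc K hK hKΩ
      obtain ⟨w, hw, hw'⟩ := h2.2 i
      refine ⟨O, hO, hKO, hOΩ, w, ?_, hw'⟩
      exact ((hv.mono hOΩ).congr hO h1 (ae_eq_refl _)).unique hO hw

/-! ### Comparison with iterated weak derivatives -/

theorem partialDeriv_zero (ι : Fin 0 → Fin n) (φ : EuclideanSpace ℝ (Fin n) → ℝ) :
    partialDeriv ι φ = φ := by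
  funext y; simp [partialDeriv]

theorem partialDeriv_cons {k : ℕ} (ι : Fin k → Fin n) (i : Fin n) (hφ : ContDiff ℝ ∞ φ) :
    partialDeriv (Fin.cons i ι : Fin (k + 1) → Fin n) φ = pd i (partialDeriv ι φ) := by
  funext y
  unfold partialDeriv pd
  rw [iteratedFDeriv_succ_apply_left]
  have h : DifferentiableAt ℝ (iteratedFDeriv ℝ k φ) y :=
    (hφ.differentiable_iteratedFDeriv (m := k) (by exact_mod_cast WithTop.coe_lt_top _)) y
  rw [fderiv_continuousMultilinear_apply_const_apply h]
  simp only [Fin.cons_zero]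
  rfl

theorem partialDeriv_snoc {k : ℕ} (ι : Fin k → Fin n) (i : Fin n) (hφ : ContDiff ℝ ∞ φ) :
    partialDeriv (Fin.snoc ι i : Fin (k + 1) → Fin n) φ = partialDeriv ι (pd i φ) := by
  funext y
  unfold partialDeriv
  rw [iteratedFDeriv_succ_apply_right]
  have h : ContDiff ℝ ∞ (fderiv ℝ φ) := hφ.fderiv_right (by simp)
  have e : pd i φ = (ContinuousLinearMap.apply ℝ ℝ (EuclideanSpace.single i (1 : ℝ))) ∘ fderiv ℝ φ := by
    funext y; simp [pd]
  rw [e, ContinuousLinearMap.iteratedFDeriv_comp_left _ (h.contDiffAt) (i := k) (by exact_mod_cast le_top)]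
  simp [Fin.init_def]

theorem IsTestFunction.partialDeriv {k : ℕ} (hφ : IsTestFunction Ω φ) (ι : Fin k → Fin n) :
    IsTestFunction Ω (partialDeriv ι φ) := by
  induction k with
  | zero => rwa [partialDeriv_zero]
  | succ k ih =>
    rw [← Fin.cons_self_tail ι, partialDeriv_cons _ _ hφ.1]
    exact (ih (Fin.tail ι)).pd _

theorem setIntegral_mul_test (hφ : tsupport φ ⊆ Ω) (u : EuclideanSpace ℝ (Fin n) → ℝ) :
    ∫ y in Ω, u y * φ y = ∫ y, u y * φ y :=
  setIntegral_eq_integral_of_forall_compl_eq_zero fun y hy => by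
    rw [image_eq_zero_of_notMem_tsupport (fun h => hy (hφ h)), mul_zero]

theorem isWeakDeriv_iff {k : ℕ} {ι : Fin k → Fin n} :
    IsWeakDeriv Ω ι u v ↔ LocL2 Ω v ∧ ∀ φ, IsTestFunction Ω φ →
      ∫ y, u y * partialDeriv ι φ y = (-1) ^ k * ∫ y, v y * φ y := by
  refine and_congr_right fun _ => forall₂_congr fun φ hφ => ?_
  rw [setIntegral_mul_test hφ.2.2, setIntegral_mul_test (hφ.partialDeriv ι).2.2]

/-- Test the equation for `v` against `∂ᵢ φ`: with `Fin.snoc` the new derivative is innermost and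
falls on `φ` first. -/
theorem IsWeakDeriv.hasWeakPartial {k : ℕ} {ι : Fin k → Fin n} {w : EuclideanSpace ℝ (Fin n) → ℝ}
    (h : IsWeakDeriv Ω ι u v) (h' : IsWeakDeriv Ω (Fin.snoc ι i : Fin (k + 1) → Fin n) u w) :
    HasWeakPartial Ω i v w := by
  rw [isWeakDeriv_iff] at h h'
  refine ⟨h.1, h'.1, fun φ hφ => ?_⟩
  have h1 := h.2 _ (hφ.pd i)
  have h2 := h'.2 _ hφ
  rw [partialDeriv_snoc _ _ hφ.1, h1, pow_succ, mul_assoc] at h2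
  have := mul_left_cancel₀ (pow_ne_zero k (by norm_num : (-1 : ℝ) ≠ 0)) h2
  rw [this]; ring

theorem HasWeakPartial.isWeakDeriv_cons {k : ℕ} {ι : Fin k → Fin n} {w : EuclideanSpace ℝ (Fin n) → ℝ}
    (h : HasWeakPartial Ω i u v) (h' : IsWeakDeriv Ω ι v w) :
    IsWeakDeriv Ω (Fin.cons i ι : Fin (k + 1) → Fin n) u w := by
  rw [isWeakDeriv_iff] at h' ⊢
  refine ⟨h'.1, fun φ hφ => ?_⟩
  rw [partialDeriv_cons _ _ hφ.1, h.integral_eq _ (hφ.partialDeriv ι), h'.2 φ hφ]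
  ring

theorem IsWeakDeriv.unique {k : ℕ} {ι : Fin k → Fin n} (hΩ : IsOpen Ω)
    (h : IsWeakDeriv Ω ι u v) (h' : IsWeakDeriv Ω ι u v') : v =ᵐ[volume.restrict Ω] v' := by
  rw [isWeakDeriv_iff] at h h'
  refine ae_eq_of_forall_test hΩ h.1 h'.1 fun φ hφ => ?_
  exact mul_left_cancel₀ (pow_ne_zero k (by norm_num : (-1 : ℝ) ≠ 0))
    ((h.2 φ hφ).symm.trans (h'.2 φ hφ))

theorem isWeakDeriv_fin_zero (hu : LocL2 Ω u) (ι : Fin 0 → Fin n) : IsWeakDeriv Ω ι u u :=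
  ⟨hu, fun φ _ => by simp [partialDeriv_zero]⟩

theorem weakDeriv_spec {k : ℕ} {ι : Fin k → Fin n} (hΩ : IsOpen Ω) (h : IsWeakDeriv Ω ι u v) :
    weakDeriv Ω ι u =ᵐ[volume.restrict Ω] v := by
  have hex : ∃ v, IsWeakDeriv Ω ι u v := ⟨v, h⟩
  rw [weakDeriv, dif_pos hex]
  exact hex.choose_spec.unique hΩ h

/-- Multi-index derivatives of consecutive orders differ by one weak partial derivative, so the
non-recursive definition of the Sobolev space yields the recursive one. -/
theorem IterReg.of_isWeakDeriv {m : ℕ} (hu : MemSobolevLoc m Ω u) {ι : Fin k → Fin n}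
    (hv : IsWeakDeriv Ω ι u v) (hkl : k + l ≤ m) : IterReg Ω (fun _ => LocL2 Ω) k l v := by
  induction l generalizing k v with
  | zero => exact hv.1
  | succ l ih =>
    refine ⟨hv.1, fun i => ?_⟩
    obtain ⟨w, hw⟩ := hu.2 (k + 1) (by omega) (Fin.snoc ι i)
    exact ⟨w, hv.hasWeakPartial hw, ih hw (by omega)⟩

theorem MemSobolevLoc.iterReg {m : ℕ} (hu : MemSobolevLoc m Ω u) :
    IterReg Ω (fun _ => LocL2 Ω) 0 m u :=
  IterReg.of_isWeakDeriv hu (isWeakDeriv_fin_zero hu.1 Fin.elim0) (by simp)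

/-- The converse passage; it transports the property `P` to a derivative for each multi-index, which
later allows norms of `weakDeriv` to be estimated. -/
theorem IterReg.exists_isWeakDeriv (hP : ∀ j u, P j u → LocL2 Ω u) (hu : IterReg Ω P k l u) {j : ℕ}
    (hj : j ≤ l) (ι : Fin j → Fin n) : ∃ v, IsWeakDeriv Ω ι u v ∧ P (k + j) v := by
  induction l generalizing k j u with
  | zero =>
    obtain rfl : j = 0 := by omega
    exact ⟨u, isWeakDeriv_fin_zero (hP _ _ hu) ι, hu⟩
  | succ l ih =>
    cases j with
    | zero => exact ⟨u, isWeakDeriv_fin_zero (hP _ _ hu.1) ι, hu.1⟩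
    | succ j =>
      obtain ⟨w, hw, hw'⟩ := hu.2 (ι 0)
      obtain ⟨v, hv, hv'⟩ := ih hw' (by omega) (Fin.tail ι)
      refine ⟨v, ?_, by rwa [show k + (j + 1) = k + 1 + j by omega]⟩
      have := hw.isWeakDeriv_cons hv
      rwa [Fin.cons_self_tail] at this

theorem IterReg.memSobolevLoc (hP : ∀ j u, P j u → LocL2 Ω u) (hu : IterReg Ω P 0 l u) :
    MemSobolevLoc l Ω u :=
  ⟨hP _ _ hu.self, fun _ hk ι => (hu.exists_isWeakDeriv hP hk ι).imp fun _ h => h.1⟩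

end

end

/-! ### Mollification in `L²` -/

noncomputable section

open scoped Convolution

/-- A sequence of bump functions at the origin whose supports shrink to the origin. -/
def shrinkingBump (n k : ℕ) : ContDiffBump (0 : EuclideanSpace ℝ (Fin n)) where
  rIn := 1 / (k + 1)
  rOut := 2 / (k + 1)
  rIn_pos := by positivity
  rIn_lt_rOut := by gcongr; norm_num

theorem tendsto_shrinkingBump_rOut (n : ℕ) :
    Tendsto (fun k => (shrinkingBump n k).rOut) atTop (𝓝 0) := by
  have := tendsto_const_div_atTop_nhds_zero_nat (2 : ℝ)
  simpa [shrinkingBump] using (tendsto_add_atTop_iff_nat 1).2 this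

theorem shrinkingBump_rOut_le (n k : ℕ) : (shrinkingBump n k).rOut ≤ 2 := by
  simp only [shrinkingBump]
  rw [div_le_iff₀ (by positivity)]
  nlinarith [k.cast_nonneg (α := ℝ)]

/-- Mollification at scale `1 / (k + 1)`. -/
def mollify {n : ℕ} (k : ℕ) (u : EuclideanSpace ℝ (Fin n) → ℝ) : EuclideanSpace ℝ (Fin n) → ℝ :=
  (shrinkingBump n k).normed volume ⋆[ContinuousLinearMap.lsmul ℝ ℝ, volume] u

section

variable {n k : ℕ} {u v w f : EuclideanSpace ℝ (Fin n) → ℝ} {i : Fin n}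

theorem mollify_apply (k : ℕ) (u : EuclideanSpace ℝ (Fin n) → ℝ) (x : EuclideanSpace ℝ (Fin n)) :
    mollify k u x = ∫ t, (shrinkingBump n k).normed volume (x - t) * u t := by
  rw [mollify, convolution_eq_swap]
  simp

theorem contDiff_mollify (k : ℕ) (hu : LocallyIntegrable u) : ContDiff ℝ ∞ (mollify k u) :=
  (shrinkingBump n k).hasCompactSupport_normed.contDiff_convolution_left _
    (shrinkingBump n k).contDiff_normed hu

theorem hasCompactSupport_mollify (k : ℕ) (hu : HasCompactSupport u) :
    HasCompactSupport (mollify k u) :=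
  (shrinkingBump n k).hasCompactSupport_normed.convolution _ hu

theorem ae_tendsto_mollify (hu : LocallyIntegrable u) :
    ∀ᵐ x, Tendsto (fun k => mollify k u x) atTop (𝓝 (u x)) := by
  -- `K = 2` is the ratio `rOut / rIn`; its boundedness is what Lebesgue differentiation requires of
  -- the kernels.
  refine ContDiffBump.ae_convolution_tendsto_right_of_locallyIntegrable (K := 2)
    (tendsto_shrinkingBump_rOut n) (Eventually.of_forall fun k => ?_) hu
  simp only [shrinkingBump]
  apply le_of_eq; ring

theorem integrable_bump_mul (k : ℕ) (hu : LocallyIntegrable u) (x : EuclideanSpace ℝ (Fin n)) :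
    Integrable (fun t => (shrinkingBump n k).normed volume (x - t) * u t) := by
  have h := (shrinkingBump n k).hasCompactSupport_normed.convolutionExists_left
    (ContinuousLinearMap.lsmul ℝ ℝ) (μ := volume) (f := (shrinkingBump n k).normed volume) 
    (shrinkingBump n k).continuous_normed hu x
  have := h.integrable_swap
  simpa using this

theorem isTestFunction_bump_sub (k : ℕ) (x : EuclideanSpace ℝ (Fin n)) :
    IsTestFunction Set.univ (fun t => (shrinkingBump n k).normed volume (x - t)) := by
  refine ⟨(shrinkingBump n k).contDiff_normed.comp (contDiff_const.sub contDiff_id), ?_,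
    Set.subset_univ _⟩
  exact (shrinkingBump n k).hasCompactSupport_normed.comp_homeomorph (Homeomorph.subLeft x)

theorem LocL2.locallyIntegrable (hu : LocL2 Set.univ u) : LocallyIntegrable u :=
  locallyIntegrableOn_univ.1 (hu.locallyIntegrableOn isOpen_univ)

/-- The derivative falls on the kernel, whose translates `t ↦ ρ (x - t)` are test functions; the
sign from the reflection cancels the sign in the definition of the weak derivative. -/
theorem pd_mollify (k : ℕ) (h : HasWeakPartial Set.univ i u v) :
    pd i (mollify k u) = mollify k v := by
  funext x
  have hu := h.left.locallyIntegrable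
  have hd := (shrinkingBump n k).hasCompactSupport_normed.hasFDerivAt_convolution_left
    (ContinuousLinearMap.lsmul ℝ ℝ) (μ := volume) (𝕜 := ℝ)
    ((shrinkingBump n k).contDiff_normed (n := 1) (μ := volume)) hu x
  have hex := ((shrinkingBump n k).hasCompactSupport_normed (μ := volume)).fderiv ℝ
    |>.convolutionExists_left
    ((ContinuousLinearMap.lsmul ℝ ℝ).precompL (EuclideanSpace ℝ (Fin n))) (μ := volume)
    (((shrinkingBump n k).contDiff_normed (n := 1) (μ := volume)).continuous_fderiv one_ne_zero) hu x
  have key := h.integral_eq _ (isTestFunction_bump_sub k x)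
  have hpd : ∀ t, pd i (fun t => (shrinkingBump n k).normed volume (x - t)) t
      = - pd i ((shrinkingBump n k).normed volume) (x - t) := fun t => by
    have h1 : HasFDerivAt ((shrinkingBump n k).normed volume)
        (fderiv ℝ ((shrinkingBump n k).normed volume) (x - t)) (x - t) :=
      (((shrinkingBump n k).contDiff_normed (n := 1) (μ := volume)).differentiable one_ne_zero
        (x - t)).hasFDerivAt
    have h2 := h1.comp t ((hasFDerivAt_id t).const_sub x)
    have h3 : fderiv ℝ (fun t => (shrinkingBump n k).normed volume (x - t)) t = _ := h2.fderiv
    simp only [pd, h3]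
    simp
  rw [pd, mollify, hd.fderiv, convolution_eq_swap]
  rw [ContinuousLinearMap.integral_apply (by simpa using hex.integrable_swap), mollify_apply]
  simp only [hpd, mul_neg, integral_neg, neg_inj] at key
  simp only [ContinuousLinearMap.precompL_apply, ContinuousLinearMap.lsmul_apply, smul_eq_mul]
  simp only [pd, mul_comm] at key ⊢
  exact key

theorem lintegral_bump_sub (k : ℕ) (x : EuclideanSpace ℝ (Fin n)) :
    ∫⁻ t, ENNReal.ofReal ((shrinkingBump n k).normed volume (x - t)) = 1 := by
  rw [← ofReal_integral_eq_lintegral_ofReal, integral_sub_left_eq_self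
    (fun t => (shrinkingBump n k).normed volume t), ContDiffBump.integral_normed,
    ENNReal.ofReal_one]
  · exact (shrinkingBump n k).integrable_normed.comp_sub_left x
  · exact Eventually.of_forall fun t => (shrinkingBump n k).nonneg_normed _

theorem abs_mollify_le {C : ℝ} (k : ℕ) (hu : LocallyIntegrable u) (hC : ∀ᵐ x, |u x| ≤ C)
    (x : EuclideanSpace ℝ (Fin n)) : |mollify k u x| ≤ C := by
  have h1 : Integrable fun t => (shrinkingBump n k).normed volume (x - t) :=
    (shrinkingBump n k).integrable_normed.comp_sub_left x
  rw [mollify_apply]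
  calc |∫ t, (shrinkingBump n k).normed volume (x - t) * u t|
      ≤ ∫ t, |(shrinkingBump n k).normed volume (x - t) * u t| := abs_integral_le_integral_abs
    _ ≤ ∫ t, (shrinkingBump n k).normed volume (x - t) * C := by
      refine integral_mono_ae (integrable_bump_mul k hu x).abs (h1.mul_const C) ?_
      filter_upwards [hC] with t ht
      rw [abs_mul, abs_of_nonneg ((shrinkingBump n k).nonneg_normed _)]
      exact mul_le_mul_of_nonneg_left ht ((shrinkingBump n k).nonneg_normed _)
    _ = C := by
      rw [integral_mul_const, integral_sub_left_eq_self
        (fun t => (shrinkingBump n k).normed volume t), ContDiffBump.integral_normed, one_mul]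

/-- Jensen's inequality for the probability density `ρ`, obtained from Cauchy–Schwarz with the
factors `ρ ^ (1/2)` and `ρ ^ (1/2) * |u|`. -/
theorem enorm_mollify_sq_le (k : ℕ) (hu : LocallyIntegrable u) (x : EuclideanSpace ℝ (Fin n)) :
    ‖mollify k u x‖ₑ ^ (2 : ℝ) ≤
      ∫⁻ t, ENNReal.ofReal ((shrinkingBump n k).normed volume (x - t)) * ‖u t‖ₑ ^ (2 : ℝ) := by
  set ρ : EuclideanSpace ℝ (Fin n) → ENNReal :=
    fun t => ENNReal.ofReal ((shrinkingBump n k).normed volume (x - t)) with hρ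
  have hρm : AEMeasurable ρ := by
    have : Continuous fun t => (shrinkingBump n k).normed volume (x - t) :=
      (shrinkingBump n k).continuous_normed.comp (continuous_const.sub continuous_id)
    exact this.measurable.ennreal_ofReal.aemeasurable
  have hum : AEMeasurable (fun t => ‖u t‖ₑ) := hu.aestronglyMeasurable.enorm
  have h1 : ‖mollify k u x‖ₑ ≤ ∫⁻ t, ρ t * ‖u t‖ₑ := by
    rw [mollify_apply]
    refine (enorm_integral_le_lintegral_enorm _).trans (le_of_eq (lintegral_congr fun t => ?_))
    rw [enorm_mul, Real.enorm_of_nonneg ((shrinkingBump n k).nonneg_normed _)]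
  have h2 : ∫⁻ t, ρ t * ‖u t‖ₑ ≤ (∫⁻ t, ρ t * ‖u t‖ₑ ^ (2 : ℝ)) ^ (1 / 2 : ℝ) := by
    have hh := ENNReal.lintegral_mul_le_Lp_mul_Lq (volume : Measure (EuclideanSpace ℝ (Fin n)))
      Real.HolderConjugate.two_two (f := fun t => ρ t ^ (1 / 2 : ℝ))
      (g := fun t => ρ t ^ (1 / 2 : ℝ) * ‖u t‖ₑ) (hρm.pow_const _) ((hρm.pow_const _).mul hum)
    have e1 : ∀ t, ((fun t => ρ t ^ (1 / 2 : ℝ)) * fun t => ρ t ^ (1 / 2 : ℝ) * ‖u t‖ₑ) t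
        = ρ t * ‖u t‖ₑ := fun t => by
      simp only [Pi.mul_apply]
      rw [← mul_assoc, ← ENNReal.rpow_add_of_nonneg _ _ (by norm_num) (by norm_num)]
      norm_num
    have e2 : ∀ t, (ρ t ^ (1 / 2 : ℝ)) ^ (2 : ℝ) = ρ t := fun t => by
      rw [← ENNReal.rpow_mul]; norm_num
    have e3 : ∀ t, (ρ t ^ (1 / 2 : ℝ) * ‖u t‖ₑ) ^ (2 : ℝ) = ρ t * ‖u t‖ₑ ^ (2 : ℝ) := fun t => by
      rw [ENNReal.mul_rpow_of_nonneg _ _ (by norm_num), e2]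
    simp only [e1, e2, e3] at hh
    rwa [show ∫⁻ t, ρ t = 1 from lintegral_bump_sub k x, ENNReal.one_rpow, one_mul] at hh
  calc ‖mollify k u x‖ₑ ^ (2 : ℝ)
      ≤ ((∫⁻ t, ρ t * ‖u t‖ₑ ^ (2 : ℝ)) ^ (1 / 2 : ℝ)) ^ (2 : ℝ) :=
        ENNReal.rpow_le_rpow (h1.trans h2) (by norm_num)
    _ = _ := by rw [← ENNReal.rpow_mul, one_div_mul_cancel two_ne_zero, ENNReal.rpow_one]

/-- Integrate the pointwise bound and exchange the integrals: the kernel has mass one in either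
variable. -/
theorem eLpNorm_mollify_le (k : ℕ) (hu : LocallyIntegrable u) :
    eLpNorm (mollify k u) 2 volume ≤ eLpNorm u 2 volume := by
  rw [eLpNorm_eq_lintegral_rpow_enorm_toReal (by norm_num) (by norm_num),
    eLpNorm_eq_lintegral_rpow_enorm_toReal (by norm_num) (by norm_num)]
  refine ENNReal.rpow_le_rpow ?_ (by norm_num)
  simp only [ENNReal.toReal_ofNat]
  have hum : AEMeasurable (fun t => ‖u t‖ₑ) := hu.aestronglyMeasurable.enorm
  calc ∫⁻ x, ‖mollify k u x‖ₑ ^ (2 : ℝ)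
      ≤ ∫⁻ x, ∫⁻ t, ENNReal.ofReal ((shrinkingBump n k).normed volume (x - t)) * ‖u t‖ₑ ^ (2 : ℝ) :=
        lintegral_mono fun x => enorm_mollify_sq_le k hu x
    _ = ∫⁻ t, ∫⁻ x, ENNReal.ofReal ((shrinkingBump n k).normed volume (x - t)) * ‖u t‖ₑ ^ (2 : ℝ) := by
        refine lintegral_lintegral_swap ?_
        have h1 : Measurable fun p : EuclideanSpace ℝ (Fin n) × EuclideanSpace ℝ (Fin n) =>
            ENNReal.ofReal ((shrinkingBump n k).normed volume (p.1 - p.2)) := by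
          have : Continuous fun p : EuclideanSpace ℝ (Fin n) × EuclideanSpace ℝ (Fin n) =>
              (shrinkingBump n k).normed volume (p.1 - p.2) :=
            (shrinkingBump n k).continuous_normed.comp (continuous_fst.sub continuous_snd)
          exact this.measurable.ennreal_ofReal
        exact h1.aemeasurable.mul ((hum.pow_const _).comp_snd)
    _ = ∫⁻ t, ‖u t‖ₑ ^ (2 : ℝ) := by
        refine lintegral_congr fun t => ?_
        have hm : Measurable fun x => ENNReal.ofReal ((shrinkingBump n k).normed volume (x - t)) := by
          have : Continuous fun x => (shrinkingBump n k).normed volume (x - t) :=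
            (shrinkingBump n k).continuous_normed.comp (continuous_id.sub continuous_const)
          exact this.measurable.ennreal_ofReal
        rw [lintegral_mul_const _ hm]
        have : ∀ x, (shrinkingBump n k).normed volume (x - t) =
            (shrinkingBump n k).normed volume (t - x) := fun x => by
          rw [← neg_sub, ContDiffBump.normed_neg]
        simp only [this, lintegral_bump_sub, one_mul]

theorem mollify_sub (k : ℕ) (hu : LocallyIntegrable u) (hv : LocallyIntegrable v) :
    mollify k (u - v) = mollify k u - mollify k v := by
  funext x
  simp only [Pi.sub_apply, mollify_apply, mul_sub]
  exact integral_sub (integrable_bump_mul k hu x) (integrable_bump_mul k hv x)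

/-- Convergence is uniform by uniform continuity, and all supports lie in the compact set `S`
because the kernels have radius at most `2`. -/
theorem tendsto_eLpNorm_mollify_sub_of_continuous (hc : Continuous u) (hs : HasCompactSupport u) :
    Tendsto (fun k => eLpNorm (mollify k u - u) 2 volume) atTop (𝓝 0) := by
  set S := Metric.cthickening 2 (tsupport u) with hS
  have hScompact : IsCompact S := IsCompact.cthickening hs
  have hsub : ∀ k, Function.support (mollify k u) ⊆ S := fun k x hx => by
    have := support_convolution_subset _ hx
    obtain ⟨a, ha, b, hb, rfl⟩ := Set.mem_add.1 this
    refine Metric.mem_cthickening_of_dist_le _ b 2 _ (subset_tsupport _ hb) ?_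
    rw [ContDiffBump.support_normed_eq, mem_ball_zero_iff] at ha
    simpa using (ha.le.trans (shrinkingBump_rOut_le n k))
  have husub : Function.support u ⊆ S :=
    (subset_tsupport u).trans (Metric.self_subset_cthickening _)
  have huc := hc.uniformContinuous_of_tendsto_cocompact hs.is_zero_at_infty
  rw [ENNReal.tendsto_atTop_zero]
  intro ε hε
  obtain ⟨η, hη, hηε⟩ : ∃ η : ℝ, 0 < η ∧ ENNReal.ofReal η * volume S ^ (1 / (2 : ENNReal).toReal) ≤ ε := by
    have hfin : volume S ^ (1 / (2 : ENNReal).toReal) ≠ ⊤ :=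
      ENNReal.rpow_ne_top_of_nonneg (by simp) hScompact.measure_lt_top.ne
    have : Tendsto (fun η : ℝ => ENNReal.ofReal η * volume S ^ (1 / (2 : ENNReal).toReal)) (𝓝[>] 0) (𝓝 0) := by
      have h1 : Tendsto (fun η : ℝ => ENNReal.ofReal η) (𝓝[>] 0) (𝓝 0) := by
        have := (ENNReal.continuous_ofReal.tendsto 0).mono_left (nhdsWithin_le_nhds (s := Set.Ioi 0))
        simpa using this
      simpa using ENNReal.Tendsto.mul_const h1 (Or.inr hfin)
    obtain ⟨η, h1, h2⟩ := ((this.eventually (ge_mem_nhds hε)).and self_mem_nhdsWithin).exists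
    exact ⟨η, h2, h1⟩
  obtain ⟨δ, hδ, hδ'⟩ := Metric.uniformContinuous_iff.1 huc η hη
  obtain ⟨N, hN⟩ := (Metric.tendsto_atTop.1 (tendsto_shrinkingBump_rOut n)) δ hδ
  refine ⟨N, fun k hk => le_trans ?_ hηε⟩
  refine eLpNorm_sub_le_of_dist_bdd _ (by norm_num) hScompact.measurableSet hη.le (fun x => ?_)
    (hsub k) husub
  refine ContDiffBump.dist_normed_convolution_le hc.aestronglyMeasurable fun y hy => ?_
  refine (hδ' ?_).le
  have := hN k hk
  rw [Real.dist_0_eq_abs, abs_of_pos (shrinkingBump n k).rOut_pos] at this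
  exact (Metric.mem_ball.1 hy).trans this

/-- Compactly supported continuous functions are dense in `L²`, and mollification does not increase
the norm of the error. -/
theorem tendsto_eLpNorm_mollify_sub (hu : MemLp u 2 volume) :
    Tendsto (fun k => eLpNorm (mollify k u - u) 2 volume) atTop (𝓝 0) := by
  have hul : LocallyIntegrable u := hu.locallyIntegrable (by norm_num)
  rw [ENNReal.tendsto_atTop_zero]
  intro ε hε
  have h3 : ε / 3 ≠ 0 := (ENNReal.div_pos hε.ne' (by norm_num)).ne'
  obtain ⟨g, hg1, hg2, hg3, hg4⟩ := hu.exists_hasCompactSupport_eLpNorm_sub_le (by norm_num) h3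
  have hgl : LocallyIntegrable g := hg3.locallyIntegrable
  obtain ⟨N, hN⟩ := (ENNReal.tendsto_atTop_zero.1
    (tendsto_eLpNorm_mollify_sub_of_continuous hg3 hg1)) (ε / 3) (pos_iff_ne_zero.2 h3)
  refine ⟨N, fun k hk => ?_⟩
  have e : mollify k u - u = mollify k (u - g) + ((mollify k g - g) + (g - u)) := by
    rw [mollify_sub k hul hgl]; abel
  have m1 := (contDiff_mollify k (hul.sub hgl)).continuous.aestronglyMeasurable (μ := volume)
  have m2 := (contDiff_mollify k hgl).continuous.aestronglyMeasurable (μ := volume)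
  have m3 := hg3.aestronglyMeasurable (μ := volume)
  rw [e]
  calc _ ≤ eLpNorm (mollify k (u - g)) 2 volume + (eLpNorm (mollify k g - g) 2 volume +
        eLpNorm (g - u) 2 volume) :=
      (eLpNorm_add_le m1 ((m2.sub m3).add (m3.sub hu.1)) (by norm_num)).trans
        (add_le_add le_rfl (eLpNorm_add_le (m2.sub m3) (m3.sub hu.1) (by norm_num)))
    _ ≤ ε / 3 + (ε / 3 + ε / 3) := by
      refine add_le_add ((eLpNorm_mollify_le k (hul.sub hgl)).trans hg2) (add_le_add (hN k hk) ?_)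
      rwa [eLpNorm_sub_comm]
    _ = ε := by
      rw [← add_assoc, ENNReal.add_thirds]

theorem tendsto_integral_mul_mollify (hf : MemLp f 2 volume) (hu : MemLp u 2 volume) :
    Tendsto (fun k => ∫ y, f y * mollify k u y) atTop (𝓝 (∫ y, f y * u y)) := by
  have hul : LocallyIntegrable u := hu.locallyIntegrable (by norm_num)
  have hm : ∀ k, MemLp (mollify k u) 2 volume := fun k =>
    ⟨(contDiff_mollify k hul).continuous.aestronglyMeasurable,
      (eLpNorm_mollify_le k hul).trans_lt hu.2⟩
  rw [tendsto_iff_norm_sub_tendsto_zero]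
  have hlim : Tendsto (fun k => (eLpNorm f 2 volume * eLpNorm (mollify k u - u) 2 volume).toReal)
      atTop (𝓝 0) := by
    have := ENNReal.Tendsto.const_mul (a := eLpNorm f 2 volume) (tendsto_eLpNorm_mollify_sub hu)
      (Or.inr hf.2.ne)
    rw [mul_zero] at this
    exact (ENNReal.tendsto_toReal ENNReal.zero_ne_top).comp this
  refine squeeze_zero (fun _ => norm_nonneg _) (fun k => ?_) hlim
  have i1 : Integrable fun y => f y * mollify k u y := hf.integrable_mul (hm k)
  have i2 : Integrable fun y => f y * u y := hf.integrable_mul hu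
  rw [← integral_sub i1 i2]
  have : ∀ y, f y * mollify k u y - f y * u y = (f * (mollify k u - u)) y := fun y => by
    simp; ring
  simp only [this]
  refine (norm_integral_le_lintegral_norm _).trans ?_
  refine ENNReal.toReal_mono (ENNReal.mul_lt_top hf.2 ((hm k).sub hu).2).ne ?_
  have h2 := eLpNorm_smul_le_mul_eLpNorm (p := 2) (q := 2) (r := 1) ((hm k).sub hu).1 hf.1
  rw [eLpNorm_one_eq_lintegral_enorm] at h2
  simp only [ofReal_norm]
  exact h2

end

end

/-! ### Cutoffs and the weak Leibniz rule -/

noncomputable section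

section

variable {n : ℕ} {Ω : Set (EuclideanSpace ℝ (Fin n))} {u v u' v' φ χ : EuclideanSpace ℝ (Fin n) → ℝ}
  {i : Fin n} {k l : ℕ}

/-- The cutoff is one on an open neighbourhood of `K`, not only on `K`, so that its derivatives
vanish there. -/
theorem exists_cutoff {K : Set (EuclideanSpace ℝ (Fin n))} (hK : IsCompact K) (hΩ : IsOpen Ω)
    (hKΩ : K ⊆ Ω) : ∃ χ, IsTestFunction Ω χ ∧ (∀ y, |χ y| ≤ 1) ∧
      ∃ O, IsOpen O ∧ K ⊆ O ∧ O ⊆ Ω ∧ ∀ y ∈ O, χ y = 1 := by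
  obtain ⟨L, hL, hKL, hLΩ⟩ := exists_compact_between hK hΩ hKΩ
  obtain ⟨χ, h1, h2, h3⟩ := exists_contMDiffMap_one_nhds_of_subset_interior
    (𝓡 n) (n := ⊤) hK.isClosed hKL
  have hts : tsupport χ ⊆ L :=
    closure_minimal (fun y hy => by_contra fun h => hy (h2 y h)) hL.isClosed
  obtain ⟨O, hO, hKO, hO1⟩ := mem_nhdsSet_iff_exists.1 h1
  refine ⟨χ, ⟨χ.contMDiff.contDiff, hL.of_isClosed_subset (isClosed_tsupport _) hts,
    hts.trans hLΩ⟩, fun y => abs_le.2 ⟨by linarith [(h3 y).1], (h3 y).2⟩,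
    O ∩ interior L, hO.inter isOpen_interior, Set.subset_inter hKO hKL,
    (Set.inter_subset_right.trans interior_subset).trans hLΩ, fun y hy => hO1 hy.1⟩

theorem LocL2.memLp_mul_test (hu : LocL2 Ω u) (hφ : Continuous φ)
    (hc : HasCompactSupport φ) (hs : tsupport φ ⊆ Ω) : MemLp (fun y => φ y * u y) 2 volume := by
  have h1 : MemLp u 2 (volume.restrict (tsupport φ)) := hu _ hc hs
  have h2 : MemLp φ ⊤ (volume.restrict (tsupport φ)) :=
    (hφ.memLp_of_hasCompactSupport hc).restrict _
  have h3 : MemLp (fun y => φ y * u y) 2 (volume.restrict (tsupport φ)) := h1.mul h2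
  rw [← memLp_indicator_iff_restrict (isClosed_tsupport φ).measurableSet] at h3
  rwa [Set.indicator_eq_self.2] at h3
  intro y hy
  exact subset_tsupport φ (left_ne_zero_of_mul hy)

theorem locL2_of_memLp (hu : MemLp u 2 volume) : LocL2 Ω u := fun _ _ _ => hu.restrict _

/-- The product `φ * χ` is a test function in `Ω` for every `φ` on the whole space. The cut-off
function is thus weakly differentiable on the whole space and can be mollified. -/
theorem HasWeakPartial.mul_test (h : HasWeakPartial Ω i u v) (hχ : IsTestFunction Ω χ) :
    HasWeakPartial Set.univ i (fun y => χ y * u y) ((fun y => pd i χ y * u y) + fun y => χ y * v y) := by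
  have hd := hχ.pd i
  refine ⟨locL2_of_memLp (h.left.memLp_mul_test hχ.1.continuous hχ.2.1 hχ.2.2),
    (locL2_of_memLp (h.left.memLp_mul_test hd.1.continuous hd.2.1 hd.2.2)).add
      (locL2_of_memLp (h.right.memLp_mul_test hχ.1.continuous hχ.2.1 hχ.2.2)), fun φ hφ => ?_⟩
  have t1 : IsTestFunction Ω (fun y => φ y * χ y) := hχ.mul_left hφ.1
  have t2 : IsTestFunction Ω (fun y => φ y * pd i χ y) := hd.mul_left hφ.1
  have t3 : IsTestFunction Ω (fun y => pd i φ y * χ y) := hχ.mul_left (hφ.pd i).1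
  have key := h.integral_eq _ t1
  have e : ∀ y, u y * pd i (fun y => φ y * χ y) y =
      u y * (φ y * pd i χ y) + u y * (pd i φ y * χ y) := fun y => by
    rw [pd_mul hφ.1 hχ.1]; ring
  simp only [e] at key
  have i2 := h.left.integrable_mul_test t2.1.continuous t2.2.1 t2.2.2
  have i3 := h.left.integrable_mul_test t3.1.continuous t3.2.1 t3.2.2
  have i1 := h.right.integrable_mul_test t1.1.continuous t1.2.1 t1.2.2
  rw [integral_add i2 i3] at key
  have e1 : ∀ y, χ y * u y * pd i φ y = u y * (pd i φ y * χ y) := fun y => by ring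
  have e2 : ∀ y, ((fun y => pd i χ y * u y) + fun y => χ y * v y) y * φ y =
      u y * (φ y * pd i χ y) + v y * (φ y * χ y) := fun y => by
    simp only [Pi.add_apply]; ring
  simp only [e1, e2]
  rw [integral_add i2 i1]
  linarith

theorem IterReg.shift {p : (EuclideanSpace ℝ (Fin n) → ℝ) → Prop} {k' : ℕ}
    (h : IterReg Ω (fun _ => p) k l u) : IterReg Ω (fun _ => p) k' l u := by
  induction l generalizing k k' u with
  | zero => exact h
  | succ l ih =>
    refine ⟨h.1, fun i => ?_⟩
    obtain ⟨v, hv, hv'⟩ := h.2 i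
    exact ⟨v, hv, ih hv'⟩

/-- The set `S` is kept independent of `χ` because the induction replaces `χ` by its derivatives. -/
theorem IterReg.mul_test (hu : IterReg Ω (fun _ => LocL2 Ω) k l u) (hχ : IsTestFunction Ω χ)
    {S : Set (EuclideanSpace ℝ (Fin n))} (hS : tsupport χ ⊆ S) :
    IterReg Set.univ (fun _ u => MemLp u 2 volume ∧ Function.support u ⊆ S) k l
      (fun y => χ y * u y) := by
  have key : ∀ {χ u : EuclideanSpace ℝ (Fin n) → ℝ}, LocL2 Ω u → IsTestFunction Ω χ →
      tsupport χ ⊆ S → MemLp (fun y => χ y * u y) 2 volume ∧ 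
        Function.support (fun y => χ y * u y) ⊆ S := fun hu hχ hS =>
    ⟨hu.memLp_mul_test hχ.1.continuous hχ.2.1 hχ.2.2,
      fun y hy => hS (subset_tsupport _ (left_ne_zero_of_mul hy))⟩
  induction l generalizing k u χ with
  | zero => exact key hu hχ hS
  | succ l ih =>
    refine ⟨key hu.1 hχ hS, fun i => ?_⟩
    obtain ⟨v, hv, hv'⟩ := hu.2 i
    refine ⟨_, hv.mul_test hχ, IterReg.add (ih (hu.pred.shift (k' := k + 1)) (hχ.pd i) 
      ((tsupport_pd_subset χ i).trans hS)) (ih hv' hχ hS) fun j a b ha hb =>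
        ⟨ha.1.add hb.1, (Function.support_add _ _).trans (Set.union_subset ha.2 hb.2)⟩⟩

theorem pd_eq_zero_of_eq_one {O : Set (EuclideanSpace ℝ (Fin n))} (hO : IsOpen O)
    (h : ∀ y ∈ O, χ y = 1) {y : EuclideanSpace ℝ (Fin n)} (hy : y ∈ O) : pd i χ y = 0 := by
  have : χ =ᶠ[𝓝 y] fun _ => 1 := Filter.eventually_of_mem (hO.mem_nhds hy) h
  simp [pd, this.fderiv_eq]

/-- Near the support of a test function `φ` the factor `v` is replaced by its cut-off `V`. The
mollifications of `V` times `φ` are admissible test functions for `u`, and the resulting identities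
pass to the limit because all integrals are pairings of two functions in `L²`. -/
theorem HasWeakPartial.mul (hΩ : IsOpen Ω) (hu : HasWeakPartial Ω i u u')
    (hv : HasWeakPartial Ω i v v') (h1 : LocL2 Ω (u * v)) (h2 : LocL2 Ω (u' * v + u * v')) :
    HasWeakPartial Ω i (u * v) (u' * v + u * v') := by
  refine ⟨h1, h2, fun φ hφ => ?_⟩
  obtain ⟨χ, hχ, -, O, hO, hKO, -, hχO⟩ := exists_cutoff hφ.2.1 hΩ hφ.2.2
  have hd := hφ.pd i
  have hχd := hχ.pd i
  have hV := hv.mul_test hχ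
  set V : EuclideanSpace ℝ (Fin n) → ℝ := fun y => χ y * v y
  set V' : EuclideanSpace ℝ (Fin n) → ℝ := (fun y => pd i χ y * v y) + fun y => χ y * v' y
  have mV : MemLp V 2 volume := hv.left.memLp_mul_test hχ.1.continuous hχ.2.1 hχ.2.2
  have mV' : MemLp V' 2 volume :=
    (hv.left.memLp_mul_test hχd.1.continuous hχd.2.1 hχd.2.2).add
      (hv.right.memLp_mul_test hχ.1.continuous hχ.2.1 hχ.2.2)
  have m1 := hu.left.memLp_mul_test hφ.1.continuous hφ.2.1 hφ.2.2
  have m2 := hu.left.memLp_mul_test hd.1.continuous hd.2.1 hd.2.2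
  have m3 := hu.right.memLp_mul_test hφ.1.continuous hφ.2.1 hφ.2.2
  have hVl := hV.left.locallyIntegrable
  have hV'l := hV.right.locallyIntegrable
  have step : ∀ k, (∫ y, φ y * u y * mollify k V' y) + ∫ y, pd i φ y * u y * mollify k V y =
      - ∫ y, φ y * u' y * mollify k V y := fun k => by
    have hs := contDiff_mollify k hVl
    have t := hφ.mul_left hs
    have key := hu.integral_eq _ t
    have e : ∀ y, u y * pd i (fun y => mollify k V y * φ y) y =
        φ y * u y * mollify k V' y + pd i φ y * u y * mollify k V y := fun y => by
      rw [pd_mul hs hφ.1, pd_mollify k hV]; ring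
    have e' : ∀ y, u' y * (mollify k V y * φ y) = φ y * u' y * mollify k V y := fun y => by ring
    have hm : ∀ {w : EuclideanSpace ℝ (Fin n) → ℝ}, MemLp w 2 volume →
        MemLp (mollify k w) 2 volume := fun hw =>
      ⟨(contDiff_mollify k (hw.locallyIntegrable (by norm_num))).continuous.aestronglyMeasurable,
        (eLpNorm_mollify_le k (hw.locallyIntegrable (by norm_num))).trans_lt hw.2⟩
    simp only [e, e'] at key
    have j1 : Integrable fun y => φ y * u y * mollify k V' y := m1.integrable_mul (hm mV')
    have j2 : Integrable fun y => pd i φ y * u y * mollify k V y := m2.integrable_mul (hm mV)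
    rwa [integral_add j1 j2] at key
  have lim := tendsto_nhds_unique
    (((tendsto_integral_mul_mollify m1 mV').add (tendsto_integral_mul_mollify m2 mV)).congr step)
    (tendsto_integral_mul_mollify m3 mV).neg
  -- The cutoff is one near the support of `φ`, so `V` and `V'` may be replaced by `v` and `v'`
  -- again.
  have hy : ∀ y, φ y * V y = φ y * v y ∧ φ y * V' y = φ y * v' y ∧
      pd i φ y * V y = pd i φ y * v y := fun y => by
    by_cases hyO : y ∈ O
    · simp [V, V', hχO y hyO, pd_eq_zero_of_eq_one hO hχO hyO]
    · have : φ y = 0 := image_eq_zero_of_notMem_tsupport fun h => hyO (hKO h)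
      have : pd i φ y = 0 :=
        image_eq_zero_of_notMem_tsupport fun h => hyO (hKO (tsupport_pd_subset φ i h))
      simp [*]
  have f1 : ∀ y, φ y * u y * V' y = u y * v' y * φ y := fun y => by
    linear_combination u y * (hy y).2.1
  have f2 : ∀ y, pd i φ y * u y * V y = (u * v) y * pd i φ y := fun y => by
    simp only [Pi.mul_apply]; linear_combination u y * (hy y).2.2
  have f3 : ∀ y, φ y * u' y * V y = u' y * v y * φ y := fun y => by
    linear_combination u' y * (hy y).1
  have j1 := m1.integrable_mul mV'
  have j3 := m3.integrable_mul mV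
  simp only [f1, f2, f3] at lim
  have g : ∀ y, (u' * v + u * v') y * φ y = u' y * v y * φ y + u y * v' y * φ y := fun y => by
    simp only [Pi.mul_apply, Pi.add_apply]; ring
  simp only [g]
  rw [integral_add (by simpa only [Pi.mul_def, f3] using! j3)
    (by simpa only [Pi.mul_def, f1] using! j1)]
  linarith

/-- Products of functions with weak derivatives. The index `c` of `R c` counts the terms of the
Leibniz formula. -/
theorem IterReg.mul (hΩ : IsOpen Ω) {P Q : ℕ → (EuclideanSpace ℝ (Fin n) → ℝ) → Prop}
    {R : ℕ → ℕ → (EuclideanSpace ℝ (Fin n) → ℝ) → Prop} {M k' : ℕ}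
    (hmul : ∀ j j' u v, j + j' ≤ M → P j u → Q j' v → R 0 (j + j') (u * v))
    (hadd : ∀ c j u v, R c j u → R c j v → R (c + 1) j (u + v))
    (hmono : ∀ c j u, R c j u → R (c + 1) j u)
    (hL2 : ∀ c j u, j ≤ M → R c j u → LocL2 Ω u)
    (hu : IterReg Ω P k l u) (hv : IterReg Ω Q k' l v) (hM : k + k' + l ≤ M) :
    IterReg Ω (R l) (k + k') l (u * v) := by
  have hmono' : ∀ c j u, R 0 j u → R c j u := fun c j u h => by
    induction c with
    | zero => exact h
    | succ c ih => exact hmono _ _ _ ih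
  induction l generalizing k k' u v with
  | zero => exact hmul _ _ _ _ (by omega) hu hv
  | succ l ih =>
    have h0 := hmul _ _ _ _ (by omega) hu.1 hv.1
    refine ⟨hmono' _ _ _ h0, fun i => ?_⟩
    obtain ⟨u', hu', hu''⟩ := hu.2 i
    obtain ⟨v', hv', hv''⟩ := hv.2 i
    have a := ih hu'' hv.pred (by omega)
    have b := ih hu.pred hv'' (by omega)
    rw [show k + 1 + k' = k + k' + 1 by omega] at a
    rw [show k + (k' + 1) = k + k' + 1 by omega] at b
    have ab := a.add b (hadd l)
    exact ⟨_, hu'.mul hΩ hv' (hL2 _ _ _ (by omega) h0) (hL2 _ _ _ (by omega) ab.self), ab⟩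

end

end

noncomputable section

section

variable {n : ℕ} {Ω : Set (EuclideanSpace ℝ (Fin n))} {u v f w φ χ : EuclideanSpace ℝ (Fin n) → ℝ}
  {i : Fin n} {k l m : ℕ}

/-! ### Families of iterated derivatives -/

/-- The iterated classical partial derivative, the derivative in the direction of the head of the
list being taken first. -/
def pdList : List (Fin n) → (EuclideanSpace ℝ (Fin n) → ℝ) → EuclideanSpace ℝ (Fin n) → ℝ
  | [], f => f
  | i :: L, f => pdList L (pd i f)

theorem pdList_concat (L : List (Fin n)) (i : Fin n) (f : EuclideanSpace ℝ (Fin n) → ℝ) :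
    pdList (L ++ [i]) f = pd i (pdList L f) := by
  induction L generalizing f with
  | nil => rfl
  | cons j L ih => exact ih (pd j f)

theorem contDiff_pdList (hf : ContDiff ℝ ∞ f) (L : List (Fin n)) : ContDiff ℝ ∞ (pdList L f) := by
  induction L generalizing f with
  | nil => exact hf
  | cons j L ih => exact ih (contDiff_pd hf j)

theorem HasCompactSupport.pdList (hf : HasCompactSupport f) (L : List (Fin n)) :
    HasCompactSupport (pdList L f) := by
  induction L generalizing f with
  | nil => exact hf
  | cons j L ih => exact ih (hf.pd j)

/-- All weak derivatives are chosen at once, indexed by words, so that they can be compared with the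
derivatives of one and the same mollification. -/
theorem IterReg.exists_family {P : ℕ → (EuclideanSpace ℝ (Fin n) → ℝ) → Prop}
    (h : IterReg Ω P k l u) : ∃ U : List (Fin n) → EuclideanSpace ℝ (Fin n) → ℝ, U [] = u ∧
      (∀ L, L.length ≤ l → P (k + L.length) (U L)) ∧
      ∀ L i, L.length < l → HasWeakPartial Ω i (U L) (U (L ++ [i])) := by
  induction l generalizing k u with
  | zero =>
    refine ⟨fun _ => u, rfl, fun L hL => ?_, fun L i hL => by omega⟩
    obtain rfl : L = [] := List.length_eq_zero_iff.1 (by omega)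
    exact h
  | succ l ih =>
    choose v hv hv' using h.2
    choose V h1 h2 h3 using fun i => ih (hv' i)
    refine ⟨fun L => match L with
      | [] => u
      | i :: L => V i L, rfl, fun L hL => ?_, fun L i hL => ?_⟩
    · cases L with
      | nil => exact h.1
      | cons j L =>
        have := h2 j L (by simpa using hL)
        rwa [show k + 1 + L.length = k + (j :: L).length by simp; omega] at this
    · cases L with
      | nil => simpa [h1] using hv i
      | cons j L => exact h3 j L i (by simpa using hL)

theorem IterReg.of_family {Q : ℕ → (EuclideanSpace ℝ (Fin n) → ℝ) → Prop}
    {U : List (Fin n) → EuclideanSpace ℝ (Fin n) → ℝ}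
    (h1 : ∀ L, L.length ≤ l → Q (k + L.length) (U L))
    (h2 : ∀ L i, L.length < l → HasWeakPartial Ω i (U L) (U (L ++ [i]))) :
    IterReg Ω Q k l (U []) := by
  induction l generalizing k U with
  | zero => exact h1 [] (by simp)
  | succ l ih =>
    refine ⟨h1 [] (by simp), fun i => ⟨U [i], h2 [] i (by simp), ?_⟩⟩
    refine ih (U := fun L => U (i :: L)) (fun L hL => ?_) fun L j hL => ?_
    · have := h1 (i :: L) (by simpa using hL)
      rwa [show k + (i :: L).length = k + 1 + L.length by simp; omega] at this
    · exact h2 (i :: L) j (by simpa using hL)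

theorem pdList_mollify {U : List (Fin n) → EuclideanSpace ℝ (Fin n) → ℝ}
    (h : ∀ L i, L.length < l → HasWeakPartial Set.univ i (U L) (U (L ++ [i]))) (k : ℕ)
    {L : List (Fin n)} (hL : L.length ≤ l) : pdList L (mollify k (U [])) = mollify k (U L) := by
  induction L using List.reverseRecOn with
  | nil => rfl
  | append_singleton L i ih =>
    simp only [List.length_append, List.length_cons, List.length_nil, zero_add] at hL
    rw [pdList_concat, ih (by omega), pd_mollify k (h L i (by omega))]

/-! ### The inequality of Gagliardo and Nirenberg -/

/-- Away from zero this is the power rule for `± |x| ^ (s + 1)`; at zero the difference quotient is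
`|y| ^ s`, which tends to zero as `s > 0`. -/
theorem hasDerivAt_abs_rpow_mul {s : ℝ} (hs : 0 < s) (x : ℝ) :
    HasDerivAt (fun x => |x| ^ s * x) ((s + 1) * |x| ^ s) x := by
  rcases lt_trichotomy x 0 with hx | rfl | hx
  · have h1 : HasDerivAt (fun x : ℝ => -(-x) ^ (s + 1)) ((s + 1) * |x| ^ s) x := by
      have := ((hasDerivAt_neg x).rpow_const (p := s + 1) (Or.inl (by simpa using hx.ne))).neg
      convert! this using 1
      rw [abs_of_neg hx, add_sub_cancel_right]; ring
    refine h1.congr_of_eventuallyEq ?_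
    filter_upwards [eventually_lt_nhds hx] with y hy
    rw [abs_of_neg hy, Real.rpow_add_one (by linarith)]; ring
  · rw [abs_zero, Real.zero_rpow hs.ne', mul_zero, hasDerivAt_iff_tendsto_slope]
    have h : Tendsto (fun y : ℝ => |y| ^ s) (𝓝[≠] 0) (𝓝 0) := by
      have : Continuous fun y : ℝ => |y| ^ s := continuous_abs.rpow_const fun _ => Or.inr hs.le
      have := (this.tendsto 0).mono_left (nhdsWithin_le_nhds (s := {0}ᶜ))
      simpa [Real.zero_rpow hs.ne'] using this
    refine h.congr' ?_
    filter_upwards [self_mem_nhdsWithin] with y hy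
    have hy : y ≠ 0 := hy
    simp [slope_def_field, hy]
  · have h1 : HasDerivAt (fun x : ℝ => x ^ (s + 1)) ((s + 1) * |x| ^ s) x := by
      have := Real.hasDerivAt_rpow_const (x := x) (p := s + 1) (Or.inl hx.ne')
      rw [abs_of_pos hx]
      convert! this using 2
      ring_nf
    refine h1.congr_of_eventuallyEq ?_
    filter_upwards [eventually_gt_nhds hx] with y hy
    rw [abs_of_pos hy, Real.rpow_add_one hy.ne']

/-- With `f = ∂ᵢ w`, write the left side as `∫ |f|^s f ∂ᵢ w` and integrate by parts; the derivative
of `|f|^s f` is `(s + 1) |f|^s ∂ᵢ f`. -/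
theorem integral_abs_pd_rpow_le (hw : ContDiff ℝ ∞ w) (hc : HasCompactSupport w) (i : Fin n)
    {s : ℝ} (hs : 0 < s) :
    ∫ y, |pd i w y| ^ (s + 2) ≤
      (s + 1) * ∫ y, |pd i w y| ^ s * (|pd i (pd i w) y| * |w y|) := by
  set f := pd i w with hf
  have hfs : ContDiff ℝ ∞ f := contDiff_pd hw i
  have hfc : HasCompactSupport f := hc.pd i
  have hfd := hfs.differentiable (by simp)
  have hG : ∀ y, HasFDerivAt (fun y => |f y| ^ s * f y) (((s + 1) * |f y| ^ s) • fderiv ℝ f y) y :=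
    fun y => (hasDerivAt_abs_rpow_mul hs (f y)).comp_hasFDerivAt y (hfd y).hasFDerivAt
  have hcs : Continuous fun y => |f y| ^ s :=
    hfs.continuous.abs.rpow_const fun _ => Or.inr hs.le
  have hpd : Continuous (pd i f) := (contDiff_pd hfs i).continuous
  have ibp := integral_mul_fderiv_eq_neg_fderiv_mul_of_integrable (μ := volume)
    (f := fun y => |f y| ^ s * f y) (g := w) (v := EuclideanSpace.single i (1 : ℝ))
    (by
      simp only [(hG _).fderiv]
      refine Continuous.integrable_of_hasCompactSupport ?_ hc.mul_left
      simp only [smul_apply, smul_eq_mul]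
      exact ((continuous_const.mul hcs).mul hpd).mul hw.continuous)
    (Continuous.integrable_of_hasCompactSupport ((hcs.mul hfs.continuous).mul hfs.continuous)
      hfc.mul_left)
    (Continuous.integrable_of_hasCompactSupport ((hcs.mul hfs.continuous).mul hw.continuous)
      hc.mul_left)
    (fun y _ => (hG y).differentiableAt) (fun y _ => hw.differentiable (by simp) y)
  simp only [(hG _).fderiv, smul_apply, smul_eq_mul] at ibp
  have e : ∀ y, |f y| ^ (s + 2) = |f y| ^ s * f y * fderiv ℝ w y (EuclideanSpace.single i 1) :=
    fun y => by
      change _ = |f y| ^ s * f y * f y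
      rw [Real.rpow_add_of_nonneg (abs_nonneg _) hs.le (by norm_num), mul_assoc,
        Real.rpow_two, sq_abs, sq]
  simp only [e]
  rw [ibp, ← integral_neg, ← integral_const_mul]
  refine integral_mono ?_ ?_ fun y => ?_
  · refine (Continuous.integrable_of_hasCompactSupport ?_ hc.mul_left).neg
    exact ((continuous_const.mul hcs).mul hpd).mul hw.continuous
  · refine Integrable.const_mul (Continuous.integrable_of_hasCompactSupport 
      (hcs.mul (hpd.abs.mul hw.continuous.abs)) ?_) _
    exact (hc.abs.mul_left).mul_left
  · have h0 : 0 ≤ (s + 1) * |f y| ^ s := by positivity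
    calc _ ≤ |(s + 1) * |f y| ^ s * pd i f y * w y| := neg_le_abs _
      _ = _ := by
        rw [abs_mul, abs_mul, abs_of_nonneg h0]; ring

/-- Hölder's inequality with the exponents `r / (r - 2)`, `q`, `p` in the integration by parts
bounds `N ^ r` by a multiple of `N ^ (r - 2)`, where `N` is the norm of `∂ᵢ w`; then divide. -/
theorem eLpNorm_pd_sq_le (hw : ContDiff ℝ ∞ w) (hc : HasCompactSupport w) (i : Fin n)
    {p q : ENNReal} {r : ℝ} (hr : 2 < r) (hpq : p⁻¹ + q⁻¹ = 2 / ENNReal.ofReal r) :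
    eLpNorm (pd i w) (ENNReal.ofReal r) volume ^ 2 ≤ ENNReal.ofReal (r - 1) *
      (eLpNorm w p volume * eLpNorm (pd i (pd i w)) q volume) := by
  set s := r - 2 with hs
  have hs0 : 0 < s := by linarith
  set f := pd i w with hf
  have hfs : ContDiff ℝ ∞ f := contDiff_pd hw i
  have hfc : HasCompactSupport f := hc.pd i
  have hr0 : ENNReal.ofReal r ≠ 0 := by simp; linarith
  set N := eLpNorm f (ENNReal.ofReal r) volume with hN
  have hNfin : N ≠ ⊤ := (hfs.continuous.memLp_of_hasCompactSupport hfc).2.ne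
  have hcs : Continuous fun y => ‖f y‖ ^ s := hfs.continuous.norm.rpow_const fun _ => Or.inr hs0.le
  have hpd : Continuous (pd i f) := (contDiff_pd hfs i).continuous
  set b : ENNReal := (p⁻¹ + q⁻¹)⁻¹ with hb
  have hbi : b⁻¹ = 2 / ENNReal.ofReal r := by rw [hb, inv_inv, hpq]
  set a : ENNReal := ENNReal.ofReal (r / s) with ha
  have hai : a⁻¹ = ENNReal.ofReal s / ENNReal.ofReal r := by
    rw [ha, ENNReal.ofReal_div_of_pos hs0, ENNReal.inv_div] <;> simp [hs0]
  have hab : ENNReal.HolderTriple a b 1 := ⟨by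
    rw [hai, hbi, ENNReal.div_add_div_same, inv_one,
      show (2 : ENNReal) = ENNReal.ofReal 2 by simp, ← ENNReal.ofReal_add hs0.le (by norm_num), hs,
      sub_add_cancel, ENNReal.div_self hr0 ENNReal.ofReal_ne_top]⟩
  have hqp : ENNReal.HolderTriple q p b := ⟨by rw [hb, inv_inv, add_comm]⟩
  have h1 : N ^ r ≤ ENNReal.ofReal (s + 1) * (N ^ s * (eLpNorm (pd i f) q volume *
      eLpNorm w p volume)) := by
    have hNr : N ^ r = ENNReal.ofReal (∫ y, |f y| ^ r) := by
      rw [hN, eLpNorm_eq_lintegral_rpow_enorm_toReal hr0 ENNReal.ofReal_ne_top,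
        ENNReal.toReal_ofReal (by linarith), ← ENNReal.rpow_mul, one_div_mul_cancel (by linarith),
        ENNReal.rpow_one, ofReal_integral_eq_lintegral_ofReal]
      · refine lintegral_congr fun y => ?_
        rw [← ENNReal.ofReal_rpow_of_nonneg (abs_nonneg _) (by linarith), ← Real.norm_eq_abs,
          ofReal_norm]
      · refine Continuous.integrable_of_hasCompactSupport
          (hfs.continuous.abs.rpow_const fun _ => Or.inr (by linarith)) ?_
        exact hfc.comp_left (g := fun x => |x| ^ r) (by
          simp only [abs_zero]; exact Real.zero_rpow (by linarith))
      · exact Eventually.of_forall fun y => by positivity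
    have h2 := integral_abs_pd_rpow_le hw hc i hs0
    rw [← hf, show s + 2 = r by rw [hs]; ring] at h2
    have hI : Integrable fun y => |f y| ^ s * (|pd i f y| * |w y|) :=
      Continuous.integrable_of_hasCompactSupport (hcs.mul (hpd.abs.mul hw.continuous.abs))
        (hc.abs.mul_left).mul_left
    have h3 : ENNReal.ofReal (∫ y, |f y| ^ s * (|pd i f y| * |w y|)) =
        eLpNorm ((fun y => ‖f y‖ ^ s) • (pd i f • w)) 1 volume := by
      rw [eLpNorm_one_eq_lintegral_enorm, ofReal_integral_eq_lintegral_ofReal hI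
        (Eventually.of_forall fun y => by positivity)]
      refine lintegral_congr fun y => ?_
      rw [← ofReal_norm]
      congr 1
      simp only [Pi.smul_apply', smul_eq_mul, norm_mul, Real.norm_eq_abs]
      rw [abs_of_nonneg (Real.rpow_nonneg (abs_nonneg _) _), ← abs_mul]
      rfl
    have h4 : eLpNorm (fun y => ‖f y‖ ^ s) a volume = N ^ s := by
      rw [eLpNorm_norm_rpow _ hs0, ha, ← ENNReal.ofReal_mul (by positivity),
        div_mul_cancel₀ _ hs0.ne']
    calc N ^ r ≤ ENNReal.ofReal ((s + 1) * ∫ y, |f y| ^ s * (|pd i f y| * |w y|)) := by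
          rw [hNr]; exact ENNReal.ofReal_le_ofReal h2
      _ = ENNReal.ofReal (s + 1) * eLpNorm ((fun y => ‖f y‖ ^ s) • (pd i f • w)) 1 volume := by
          rw [ENNReal.ofReal_mul (by positivity), h3]
      _ ≤ _ := by
          gcongr
          refine (eLpNorm_smul_le_mul_eLpNorm (p := a) (q := b) (r := 1)
            (hpd.smul hw.continuous).aestronglyMeasurable hcs.aestronglyMeasurable).trans ?_
          rw [h4]
          gcongr
          exact eLpNorm_smul_le_mul_eLpNorm hw.continuous.aestronglyMeasurable
            hpd.aestronglyMeasurable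
  -- Division by `N ^ s` needs `N` nonzero and finite; finiteness is due to compact support.
  rcases eq_or_ne N 0 with h0 | h0
  · rw [h0]; simp
  have hNs : N ^ s ≠ 0 := by simp [h0, hNfin]
  have hNs' : N ^ s ≠ ⊤ := ENNReal.rpow_ne_top_of_nonneg hs0.le hNfin
  rw [show r = s + 2 by rw [hs]; ring, ENNReal.rpow_add _ _ h0 hNfin, ENNReal.rpow_two,
    mul_left_comm, ENNReal.mul_le_mul_iff_right hNs hNs'] at h1
  rw [show r - 1 = s + 1 by rw [hs]; ring, mul_comm (eLpNorm w p volume)]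
  exact h1

end

end

/-! ### The exponents `2m / j` and interpolation of derivatives -/

noncomputable section

/-- The integrability exponent `2m / j` of derivatives of order `j`; it is `∞` for `j = 0`. -/
def sobExp (m j : ℕ) : ENNReal := ((j : ENNReal) / (2 * m))⁻¹

theorem sobExp_zero (m : ℕ) : sobExp m 0 = ⊤ := by simp [sobExp]

theorem sobExp_self {m : ℕ} (hm : m ≠ 0) : sobExp m m = 2 := by
  have h : (m : ENNReal) ≠ 0 := by exact_mod_cast hm
  rw [sobExp, ENNReal.inv_div (by simp) (Or.inr (by exact_mod_cast hm)),
    ENNReal.mul_div_cancel_right h (ENNReal.natCast_ne_top m)]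

theorem sobExp_eq_ofReal {m j : ℕ} (hj : j ≠ 0) : sobExp m j = ENNReal.ofReal (2 * m / j) := by
  have hj' : (0 : ℝ) < j := by positivity
  rw [sobExp, ENNReal.inv_div (by simp) (Or.inr (by exact_mod_cast hj)),
    ENNReal.ofReal_div_of_pos hj', ENNReal.ofReal_mul (by norm_num)]
  simp

/-- Reciprocal exponents are linear in the order of differentiation, which fits Hölder's inequality
both to the Leibniz formula and to interpolation. -/
theorem sobExp_inv_add (m j j' : ℕ) : (sobExp m j)⁻¹ + (sobExp m j')⁻¹ = (sobExp m (j + j'))⁻¹ := by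
  simp only [sobExp, inv_inv]
  rw [ENNReal.div_add_div_same]
  push_cast; rfl

theorem two_le_sobExp {m j : ℕ} (h : j ≤ m) : 2 ≤ sobExp m j := by
  rcases Nat.eq_zero_or_pos j with rfl | hj
  · simp [sobExp_zero]
  · rw [sobExp_eq_ofReal hj.ne', ENNReal.ofNat_le_ofReal, le_div_iff₀ (by positivity)]
    have : (j : ℝ) ≤ m := by exact_mod_cast h
    linarith

/-- A quantitative maximum principle for logarithmically convex sequences up to a constant. -/
theorem exists_le_mul_max_of_sq_le (m : ℕ) {C : ℝ} (hC : 1 ≤ C) : ∃ D : ℝ, 0 ≤ D ∧ ∀ a : ℕ → ℝ,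
    (∀ j, 0 ≤ a j) → (∀ j, 0 < j → j < m → a j ^ 2 ≤ C * (a (j - 1) * a (j + 1))) →
    ∀ j ≤ m, a j ≤ D * max (a 0) (a m) := by
  -- The weights `w j = E ^ (j * (m - j))` satisfy `w (j - 1) * w (j + 1) * E ^ 2 = w j ^ 2`. Since
  -- `E ^ 2 = 4 * C ^ 2` and `C ≤ C ^ 2`, the quotient `b = a / w` obeys the inequality with the
  -- constant `1 / 4`.
  set E := 2 * C with hE
  have hE1 : 1 ≤ E := by linarith
  have hE0 : 0 < E := by linarith
  set w : ℕ → ℝ := fun j => E ^ (j * (m - j)) with hw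
  have hw0 : ∀ j, 0 < w j := fun j => pow_pos hE0 _
  refine ⟨E ^ (m * m), by positivity, fun a ha h j hj => ?_⟩
  set b : ℕ → ℝ := fun j => a j / w j with hb
  have hab : ∀ j, a j = b j * w j := fun j => (div_mul_cancel₀ _ (hw0 j).ne').symm
  have hb0 : ∀ j, 0 ≤ b j := fun j => div_nonneg (ha j) (hw0 j).le
  have hstep : ∀ j, 0 < j → j < m → b j ^ 2 ≤ b (j - 1) * b (j + 1) / 4 := by
    intro j h1 h2
    obtain ⟨t, rfl⟩ : ∃ t, j = t + 1 := ⟨j - 1, by omega⟩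
    obtain ⟨s, rfl⟩ : ∃ s, m = t + 2 + s := ⟨m - (t + 2), by omega⟩
    have hww : w t * w (t + 2) * E ^ 2 = w (t + 1) ^ 2 := by
      simp only [hw, ← pow_add, ← pow_mul]
      congr 1
      rw [show t + 2 + s - t = s + 2 by omega, show t + 2 + s - (t + 2) = s by omega,
        show t + 2 + s - (t + 1) = s + 1 by omega]
      ring
    have hh := h (t + 1) h1 h2
    simp only [Nat.add_sub_cancel, show t + 1 + 1 = t + 2 from rfl] at hh ⊢
    rw [hab (t + 1), hab t, hab (t + 2), mul_pow, ← hww] at hh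
    have hpos : 0 < w t * w (t + 2) := mul_pos (hw0 _) (hw0 _)
    have h3 : b (t + 1) ^ 2 * E ^ 2 ≤ C * (b t * b (t + 2)) := by
      refine le_of_mul_le_mul_right ?_ hpos
      calc _ = b (t + 1) ^ 2 * (w t * w (t + 2) * E ^ 2) := by ring
        _ ≤ _ := hh
        _ = _ := by ring
    have h4 : 0 ≤ b t * b (t + 2) := mul_nonneg (hb0 _) (hb0 _)
    have h5 : C * (b t * b (t + 2)) ≤ C ^ 2 * (b t * b (t + 2)) := by
      gcongr; nlinarith
    have h6 : C ^ 2 * (4 * b (t + 1) ^ 2) ≤ C ^ 2 * (b t * b (t + 2)) := by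
      rw [hE] at h3; linarith
    have h7 := le_of_mul_le_mul_left h6 (by positivity)
    linarith
  obtain ⟨q, hq, hqmax⟩ := Finset.exists_max_image (Finset.range (m + 1)) b ⟨0, by simp⟩
  have hbmax : ∀ j ≤ m, b j ≤ max (a 0) (a m) := by
    intro j hj
    refine (hqmax j (by simp; omega)).trans ?_
    rcases Nat.eq_zero_or_pos q with rfl | hq0
    · simp [hb, hw]
    rcases (Nat.lt_succ_iff.1 (Finset.mem_range.1 hq)).eq_or_lt with rfl | hqm
    · simp [hb, hw]
    -- At an interior maximum of `b` the factor `1 / 4` forces `b q = 0`, so the maximum is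
    -- controlled by the end points in every case.
    · have h1 := hstep q hq0 hqm
      have h2 := hqmax (q - 1) (by simp; omega)
      have h3 := hqmax (q + 1) (by simp; omega)
      have h4 : b (q - 1) * b (q + 1) ≤ b q * b q := mul_le_mul h2 h3 (hb0 _) (hb0 _)
      have h5 : b q ^ 2 ≤ 0 := by nlinarith [hb0 q]
      have h6 : b q = 0 := by nlinarith [hb0 q, pow_eq_zero_iff (two_ne_zero) |>.1 (le_antisymm h5 (sq_nonneg _))]
      rw [h6]; exact le_max_of_le_left (ha 0)
  rw [hab j, mul_comm]
  refine mul_le_mul ?_ (hbmax j hj) (hb0 j) (by positivity)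
  exact pow_le_pow_right₀ hE1 (Nat.mul_le_mul hj (Nat.sub_le _ _))

section

variable {n : ℕ} {Ω : Set (EuclideanSpace ℝ (Fin n))} {u v f w φ χ : EuclideanSpace ℝ (Fin n) → ℝ}
  {i : Fin n} {k l m : ℕ}

/-- The largest `L^p` norm of the partial derivatives of order `j`. -/
def maxDerivNorm (f : EuclideanSpace ℝ (Fin n) → ℝ) (p : ENNReal) (j : ℕ) : ENNReal :=
  Finset.univ.sup fun ι : Fin j → Fin n => eLpNorm (pdList (List.ofFn ι) f) p volume

theorem eLpNorm_pdList_le_maxDerivNorm (f : EuclideanSpace ℝ (Fin n) → ℝ) (p : ENNReal)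
    (L : List (Fin n)) : eLpNorm (pdList L f) p volume ≤ maxDerivNorm f p L.length := by
  have := Finset.le_sup (f := fun ι : Fin L.length → Fin n =>
    eLpNorm (pdList (List.ofFn ι) f) p volume) (Finset.mem_univ L.get)
  unfold maxDerivNorm
  simpa using this

theorem maxDerivNorm_le {p : ENNReal} {j : ℕ} {B : ENNReal}
    (h : ∀ L : List (Fin n), L.length = j → eLpNorm (pdList L f) p volume ≤ B) :
    maxDerivNorm f p j ≤ B :=
  Finset.sup_le fun ι _ => h _ (by simp)

theorem maxDerivNorm_zero (p : ENNReal) : maxDerivNorm f p 0 = eLpNorm f p volume :=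
  le_antisymm (maxDerivNorm_le fun L hL => by
    rw [List.length_eq_zero_iff] at hL; subst hL; rfl)
    (eLpNorm_pdList_le_maxDerivNorm f p [])

theorem maxDerivNorm_lt_top (hf : ContDiff ℝ ∞ f) (hc : HasCompactSupport f) (p : ENNReal) (j : ℕ) :
    maxDerivNorm f p j < ⊤ := by
  refine (Finset.sup_lt_iff (by simp)).2 fun ι _ => ?_
  exact ((contDiff_pdList hf _).continuous.memLp_of_hasCompactSupport (hc.pdList _)).2

/-- The Gagliardo–Nirenberg inequality for derivatives of intermediate order. -/
theorem exists_maxDerivNorm_le (n m : ℕ) : ∃ D : ℝ, ∀ f : EuclideanSpace ℝ (Fin n) → ℝ,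
    ContDiff ℝ ∞ f → HasCompactSupport f → ∀ j ≤ m, maxDerivNorm f (sobExp m j) j ≤
      ENNReal.ofReal D * max (eLpNorm f ⊤ volume) (maxDerivNorm f (sobExp m m) m) := by
  -- The constant `2 * m + 1` is at least one and dominates the factor `r - 1` for all exponents `r
  -- = 2m / j` that occur.
  obtain ⟨D, hD0, hD⟩ := exists_le_mul_max_of_sq_le m (C := 2 * m + 1) (by
    have : (0 : ℝ) ≤ m := by positivity
    linarith)
  refine ⟨D, fun f hf hc j hj => ?_⟩
  set A : ℕ → ENNReal := fun j => maxDerivNorm f (sobExp m j) j with hA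
  have hAfin : ∀ j, A j ≠ ⊤ := fun j => (maxDerivNorm_lt_top hf hc _ _).ne
  have hstep : ∀ j, 0 < j → j < m →
      A j ^ 2 ≤ ENNReal.ofReal (2 * m + 1) * (A (j - 1) * A (j + 1)) := by
    intro j h1 h2
    obtain ⟨t, rfl⟩ : ∃ t, j = t + 1 := ⟨j - 1, by omega⟩
    have hle : A (t + 1) ≤ (ENNReal.ofReal (2 * m + 1) * (A t * A (t + 2))) ^ (1 / 2 : ℝ) := by
      refine maxDerivNorm_le fun L hL => ?_
      rw [one_div, ENNReal.le_rpow_inv_iff (by norm_num), ENNReal.rpow_two]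
      -- Split off the last differentiation: the second-order inequality compares `pdList L' f` with
      -- its first and second derivatives in the direction `i`.
      obtain ⟨L', i, rfl⟩ : ∃ L' i, L = L' ++ [i] := by
        rcases List.eq_nil_or_concat L with rfl | ⟨L', i, h⟩
        · simp at hL
        · exact ⟨L', i, by simpa using h⟩
      have hL' : L'.length = t := by simpa using hL
      have hm0 : (0 : ℝ) < m := by exact_mod_cast (by omega : 0 < m)
      have hlt : (t : ℝ) + 1 < m := by exact_mod_cast h2
      have hr : (2 : ℝ) < 2 * m / ((t + 1 : ℕ) : ℝ) := by
        rw [lt_div_iff₀ (by positivity)]; push_cast; linarith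
      have key := eLpNorm_pd_sq_le (p := sobExp m t) (q := sobExp m (t + 2))
        (contDiff_pdList hf L') (hc.pdList L') i hr (by
          rw [sobExp_inv_add, ← sobExp_eq_ofReal (by omega), sobExp, sobExp, inv_inv,
            ENNReal.div_eq_inv_mul, ENNReal.div_eq_inv_mul, ENNReal.div_eq_inv_mul, inv_inv]
          push_cast; ring)
      rw [← sobExp_eq_ofReal (by omega), ← pdList_concat, ← pdList_concat] at key
      refine key.trans ?_
      gcongr
      · have : 2 * (m : ℝ) / ((t + 1 : ℕ) : ℝ) ≤ 2 * m :=
          div_le_self (by positivity) (by push_cast; linarith [t.cast_nonneg (α := ℝ)])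
        linarith
      · have := eLpNorm_pdList_le_maxDerivNorm f (sobExp m t) L'
        rwa [hL'] at this
      · have := eLpNorm_pdList_le_maxDerivNorm f (sobExp m (t + 2)) (L' ++ [i] ++ [i])
        simpa [hL'] using this
    calc A (t + 1) ^ 2 ≤ ((ENNReal.ofReal (2 * m + 1) * (A t * A (t + 2))) ^ (1 / 2 : ℝ)) ^ 2 := by
          gcongr
      _ = _ := by
          rw [← ENNReal.rpow_two, ← ENNReal.rpow_mul, one_div_mul_cancel two_ne_zero,
            ENNReal.rpow_one]; rfl
  have key := hD (fun j => (A j).toReal) (fun _ => ENNReal.toReal_nonneg) (fun j h1 h2 => by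
    have := ENNReal.toReal_mono (by finiteness [hAfin (j - 1), hAfin (j + 1)]) (hstep j h1 h2)
    rwa [ENNReal.toReal_pow, ENNReal.toReal_mul, ENNReal.toReal_mul,
      ENNReal.toReal_ofReal (by positivity)] at this) j hj
  have hmax : max (A 0).toReal (A m).toReal = (max (A 0) (A m)).toReal :=
    (ENNReal.toReal_max (hAfin 0) (hAfin m)).symm
  have hmaxfin : max (A 0) (A m) ≠ ⊤ := (max_lt (hAfin 0).lt_top (hAfin m).lt_top).ne
  have h0 : A 0 = eLpNorm f ⊤ volume := by rw [hA]; simp only [sobExp_zero, maxDerivNorm_zero]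
  rw [← h0]
  change A j ≤ _ * max (A 0) (A m)
  rw [← ENNReal.ofReal_toReal (hAfin j), ← ENNReal.ofReal_toReal hmaxfin,
    ← ENNReal.ofReal_mul hD0, ← hmax]
  exact ENNReal.ofReal_le_ofReal key

/-- Bounded functions with `m` derivatives in `L²` have derivatives of order `j` in
`L^{2m/j}`. -/
theorem IterReg.memLp_sobExp {S : Set (EuclideanSpace ℝ (Fin n))} (hS : IsCompact S) {C : ℝ}
    (hu : IterReg Set.univ (fun _ u => MemLp u 2 volume ∧ Function.support u ⊆ S) 0 m u)
    (hC : ∀ᵐ y, |u y| ≤ C) :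
    IterReg Set.univ (fun j u => MemLp u (sobExp m j) volume) 0 m u := by
  obtain ⟨U, rfl, h2, h3⟩ := hu.exists_family
  have hloc : ∀ L : List (Fin n), L.length ≤ m → LocallyIntegrable (U L) := fun L hL =>
    (h2 L hL).1.locallyIntegrable (by norm_num)
  have hC0 := fun k => abs_mollify_le k (hloc [] (by simp)) hC
  obtain ⟨D, hD⟩ := exists_maxDerivNorm_le n m
  -- A bound for all mollifications at once: mollifying increases neither the supremum nor the `L²`
  -- norms of the derivatives of order `m`.
  set B : ENNReal := ENNReal.ofReal D * max (ENNReal.ofReal C)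
    (max (ENNReal.ofReal C) (Finset.univ.sup fun ι : Fin m → Fin n => eLpNorm (U (List.ofFn ι)) 2 volume)) with hB
  have hBfin : B < ⊤ := by
    refine ENNReal.mul_lt_top ENNReal.ofReal_lt_top (max_lt ENNReal.ofReal_lt_top
      (max_lt ENNReal.ofReal_lt_top ((Finset.sup_lt_iff (by simp)).2 fun ι _ => ?_)))
    exact (h2 _ (by simp)).1.2
  have htop : ∀ k, eLpNorm (mollify k (U [])) ⊤ volume ≤ ENNReal.ofReal C := fun k => by
    rw [eLpNorm_exponent_top]
    exact eLpNormEssSup_le_of_ae_bound (Eventually.of_forall (hC0 k))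
  have hbound : ∀ k, ∀ L : List (Fin n), L.length ≤ m →
      eLpNorm (mollify k (U L)) (sobExp m L.length) volume ≤ B := by
    intro k L hL
    rw [← pdList_mollify h3 k hL]
    have hcs : HasCompactSupport (U []) := HasCompactSupport.intro hS fun y hy => by
      by_contra h; exact hy ((h2 [] (by simp)).2 h)
    refine (eLpNorm_pdList_le_maxDerivNorm _ _ L).trans
      ((hD _ (contDiff_mollify k (hloc [] (by simp))) (hasCompactSupport_mollify k hcs) _ hL).trans ?_)
    rw [hB]
    gcongr
    · exact htop k
    -- For `m = 0` the exponent `sobExp m m` is `∞` instead of `2`, which is why `B` contains the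
    -- supremum bound a second time.
    · rcases eq_or_ne m 0 with rfl | hm
      · rw [sobExp_zero, maxDerivNorm_zero]
        exact (htop k).trans (le_max_left _ _)
      · rw [sobExp_self hm]
        refine (maxDerivNorm_le fun L hL => ?_).trans (le_max_right _ _)
        rw [pdList_mollify h3 k hL.le]
        refine (eLpNorm_mollify_le k (hloc L hL.le)).trans ?_
        subst hL
        have := Finset.le_sup (f := fun ι : Fin L.length → Fin n =>
          eLpNorm (U (List.ofFn ι)) 2 volume) (Finset.mem_univ L.get)
        simpa using this
  refine IterReg.of_family (fun L hL => ?_) h3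
  rw [zero_add]
  refine ⟨(h2 L hL).1.1, lt_of_le_of_lt ?_ hBfin⟩
  -- Fatou's lemma: the uniform bound passes to the almost everywhere limit.
  exact Lp.eLpNorm_le_of_ae_tendsto (Eventually.of_forall fun k => hbound k L hL)
    (fun k => (contDiff_mollify k (hloc L hL)).continuous.aestronglyMeasurable)
    (ae_tendsto_mollify (hloc L hL))

end

end

noncomputable section

open scoped FourierTransform SchwartzMap LineDeriv

section

variable {n : ℕ} {Ω : Set (EuclideanSpace ℝ (Fin n))} {u v f : EuclideanSpace ℝ (Fin n) → ℝ}
  {i : Fin n} {k m : ℕ}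

/-! ### The Sobolev embedding -/

theorem eLpNorm_fourier_eq (g : 𝓢(EuclideanSpace ℝ (Fin n), ℂ)) :
    eLpNorm (𝓕 g : 𝓢(EuclideanSpace ℝ (Fin n), ℂ)) 2 volume = eLpNorm g 2 volume := by
  have h := SchwartzMap.norm_fourier_toL2_eq g
  rw [SchwartzMap.norm_toLp, SchwartzMap.norm_toLp] at h
  exact (ENNReal.toReal_eq_toReal_iff' (SchwartzMap.memLp _ 2 volume).2.ne
    (SchwartzMap.memLp _ 2 volume).2.ne).1 h

/-- A real test function as a complex valued Schwartz function. -/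
def complexSchwartz (hf : ContDiff ℝ ∞ f) (hc : HasCompactSupport f) :
    𝓢(EuclideanSpace ℝ (Fin n), ℂ) :=
  HasCompactSupport.toSchwartzMap (f := fun y => (f y : ℂ)) (hc.comp_left Complex.ofReal_zero)
    (Complex.ofRealCLM.contDiff.comp hf)

theorem complexSchwartz_apply (hf : ContDiff ℝ ∞ f) (hc : HasCompactSupport f)
    (y : EuclideanSpace ℝ (Fin n)) : complexSchwartz hf hc y = f y := rfl

theorem eLpNorm_complexSchwartz (hf : ContDiff ℝ ∞ f) (hc : HasCompactSupport f) (p : ENNReal) :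
    eLpNorm (complexSchwartz hf hc) p volume = eLpNorm f p volume :=
  eLpNorm_congr_norm_ae (Eventually.of_forall fun y => by
    rw [complexSchwartz_apply, Complex.norm_real])

theorem lineDerivOp_complexSchwartz (hf : ContDiff ℝ ∞ f) (hc : HasCompactSupport f) (i : Fin n) :
    ∂_{(EuclideanSpace.single i (1 : ℝ))} (complexSchwartz hf hc) =
      complexSchwartz (contDiff_pd hf i) (hc.pd i) := by
  ext y
  rw [SchwartzMap.lineDerivOp_apply_eq_fderiv, complexSchwartz_apply]
  have h := (Complex.ofRealCLM.hasFDerivAt (x := f y)).comp y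
    (hf.differentiable (by simp) y).hasFDerivAt
  have h' : fderiv ℝ (complexSchwartz hf hc) y = _ := h.fderiv
  rw [h']
  rfl

/-- The Fourier transform turns `∂ᵢ` into multiplication by `2πi ξᵢ`; the factor `2π ≥ 1` is
dropped. -/
theorem norm_fourier_pd (hf : ContDiff ℝ ∞ f) (hc : HasCompactSupport f) (i : Fin n)
    (ξ : EuclideanSpace ℝ (Fin n)) :
    |ξ i| * ‖𝓕 (complexSchwartz hf hc) ξ‖ ≤
      ‖𝓕 (complexSchwartz (contDiff_pd hf i) (hc.pd i)) ξ‖ := by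
  rw [← lineDerivOp_complexSchwartz, SchwartzMap.fourier_lineDerivOp_eq]
  have : (inner ℝ · (EuclideanSpace.single i (1 : ℝ)) :
      EuclideanSpace ℝ (Fin n) → ℝ).HasTemperateGrowth := by fun_prop
  rw [smul_apply, SchwartzMap.smulLeftCLM_apply_apply this, norm_smul, norm_smul]
  have e : ‖(inner ℝ ξ (EuclideanSpace.single i (1 : ℝ)) : ℝ)‖ = |ξ i| := by
    simp [EuclideanSpace.inner_single_right]
  rw [e]
  refine le_mul_of_one_le_left (by positivity) ?_
  simp only [norm_mul, Complex.norm_I, mul_one, Complex.norm_ofNat, Complex.norm_real,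
    Real.norm_eq_abs, abs_of_pos Real.pi_pos]
  linarith [Real.pi_gt_three]

theorem norm_fourier_pdList_replicate (hf : ContDiff ℝ ∞ f) (hc : HasCompactSupport f) (i : Fin n)
    (k : ℕ) (ξ : EuclideanSpace ℝ (Fin n)) :
    |ξ i| ^ k * ‖𝓕 (complexSchwartz hf hc) ξ‖ ≤
      ‖𝓕 (complexSchwartz (contDiff_pdList hf (List.replicate k i)) (hc.pdList _)) ξ‖ := by
  induction k generalizing f with
  | zero => simp [pdList]
  | succ k ih =>
    calc |ξ i| ^ (k + 1) * ‖𝓕 (complexSchwartz hf hc) ξ‖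
        = |ξ i| ^ k * (|ξ i| * ‖𝓕 (complexSchwartz hf hc) ξ‖) := by ring
      _ ≤ |ξ i| ^ k * ‖𝓕 (complexSchwartz (contDiff_pd hf i) (hc.pd i)) ξ‖ := by
        gcongr; exact norm_fourier_pd hf hc i ξ
      _ ≤ _ := ih (contDiff_pd hf i) (hc.pd i)

/-- Compare both sides with the powers of `M`, the maximum of `1` and the `a i`. -/
theorem one_add_sum_pow_le (a : Fin n → ℝ) (ha : ∀ i, 0 ≤ a i) (m : ℕ) :
    (1 + ∑ i, a i) ^ m ≤ (n + 1) ^ m * (1 + ∑ i, a i ^ m) := by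
  obtain ⟨M, h1, h2, h3⟩ : ∃ M, 1 ≤ M ∧ (∀ i, a i ≤ M) ∧ M ^ m ≤ 1 + ∑ i, a i ^ m := by
    have hs : ∀ i, a i ^ m ≤ ∑ i, a i ^ m := fun i =>
      Finset.single_le_sum (f := fun i => a i ^ m) (fun j _ => pow_nonneg (ha j) m)
        (Finset.mem_univ i)
    by_cases h : ∀ i, a i ≤ 1
    · exact ⟨1, le_rfl, h, by
        have : 0 ≤ ∑ i, a i ^ m := Finset.sum_nonneg fun j _ => pow_nonneg (ha j) m
        simpa using this⟩
    · push Not at h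
      obtain ⟨i, hi⟩ := h
      obtain ⟨q, -, hq⟩ := Finset.exists_max_image Finset.univ a ⟨i, Finset.mem_univ i⟩
      exact ⟨a q, hi.le.trans (hq i (Finset.mem_univ i)), fun j => hq j (Finset.mem_univ j), by
        linarith [hs q]⟩
  have h4 : 1 + ∑ i, a i ≤ (n + 1) * M := by
    have : ∑ i, a i ≤ n * M := by
      simpa using Finset.sum_le_card_nsmul Finset.univ a M fun i _ => h2 i
    linarith
  calc (1 + ∑ i, a i) ^ m ≤ ((n + 1) * M) ^ m := by
        gcongr; have := Finset.sum_nonneg fun i (_ : i ∈ Finset.univ) => ha i; linarith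
    _ = (n + 1) ^ m * M ^ m := mul_pow _ _ _
    _ ≤ _ := by gcongr

/-- The place where `n < 2 * m` enters the Sobolev embedding. -/
theorem memLp_one_add_norm_rpow (h : n < 2 * m) :
    MemLp (fun ξ : EuclideanSpace ℝ (Fin n) => ((1 + ‖ξ‖) ^ m)⁻¹) 2 volume := by
  have hc : Continuous fun ξ : EuclideanSpace ℝ (Fin n) => ((1 + ‖ξ‖) ^ m)⁻¹ :=
    ((continuous_const.add continuous_norm).pow m).inv₀ fun ξ =>
      (pow_pos (add_pos_of_pos_of_nonneg one_pos (norm_nonneg ξ)) m).ne'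
  rw [memLp_two_iff_integrable_sq hc.aestronglyMeasurable]
  have := integrable_one_add_norm (E := EuclideanSpace ℝ (Fin n)) (μ := volume) (r := (2 * m : ℕ))
    (by rw [finrank_euclideanSpace_fin]; exact_mod_cast h)
  refine this.congr (Eventually.of_forall fun ξ => ?_)
  simp only
  rw [Real.rpow_neg (by positivity), Real.rpow_natCast, inv_pow, ← pow_mul, mul_comm m]

/-- Pure derivatives of order `m` in the coordinate directions, together with the function itself,
control the full weight. -/
theorem one_add_norm_pow_mul_norm_fourier_le (hf : ContDiff ℝ ∞ f) (hc : HasCompactSupport f)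
    (ξ : EuclideanSpace ℝ (Fin n)) :
    (1 + ‖ξ‖) ^ m * ‖𝓕 (complexSchwartz hf hc) ξ‖ ≤ (n + 1) ^ m *
      (‖𝓕 (complexSchwartz hf hc) ξ‖ + ∑ i, 
        ‖𝓕 (complexSchwartz (contDiff_pdList hf (List.replicate m i)) (hc.pdList _)) ξ‖) := by
  have h1 : ‖ξ‖ ≤ ∑ i, |ξ i| := by
    have e : ξ = ∑ i, EuclideanSpace.single i (ξ i) := by
      ext j; simp [Finset.sum_apply, Pi.single_apply]
    calc ‖ξ‖ = ‖∑ i, EuclideanSpace.single i (ξ i)‖ := by rw [← e]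
      _ ≤ ∑ i, ‖EuclideanSpace.single i (ξ i)‖ := norm_sum_le _ _
      _ = _ := by simp
  calc (1 + ‖ξ‖) ^ m * ‖𝓕 (complexSchwartz hf hc) ξ‖
      ≤ ((n + 1) ^ m * (1 + ∑ i, |ξ i| ^ m)) * ‖𝓕 (complexSchwartz hf hc) ξ‖ := by
        gcongr
        refine le_trans ?_ (one_add_sum_pow_le (fun i => |ξ i|) (fun i => abs_nonneg _) m)
        gcongr
    _ = (n + 1) ^ m * (‖𝓕 (complexSchwartz hf hc) ξ‖ +
          ∑ i, |ξ i| ^ m * ‖𝓕 (complexSchwartz hf hc) ξ‖) := by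
        rw [mul_assoc, add_mul, one_mul, Finset.sum_mul]
    _ ≤ _ := by
        gcongr with i
        exact norm_fourier_pdList_replicate hf hc i m ξ

theorem enorm_le_lintegral_fourier (g : 𝓢(EuclideanSpace ℝ (Fin n), ℂ))
    (x : EuclideanSpace ℝ (Fin n)) : ‖g x‖ₑ ≤ eLpNorm (𝓕 g : 𝓢(EuclideanSpace ℝ (Fin n), ℂ)) 1 volume := by
  have h : g x = 𝓕⁻ (𝓕 g) x := by rw [FourierTransform.fourierInv_fourier_eq]
  rw [h, SchwartzMap.fourierInv_coe, Real.fourierInv_eq, eLpNorm_one_eq_lintegral_enorm]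
  refine (enorm_integral_le_lintegral_enorm _).trans (le_of_eq (lintegral_congr fun ξ => ?_))
  rw [← ofReal_norm, Circle.norm_smul, ofReal_norm]

/-- Fourier inversion bounds `f` by the `L¹` norm of its transform. Cauchy–Schwarz splits off the
weight `(1 + ‖ξ‖) ^ (-m)`, which is in `L²`, and Plancherel's theorem evaluates the other factor. -/
theorem exists_enorm_le_sobolev (h : n < 2 * m) : ∃ C : ENNReal, C ≠ ⊤ ∧
    ∀ f : EuclideanSpace ℝ (Fin n) → ℝ, ContDiff ℝ ∞ f → HasCompactSupport f → ∀ x,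
      ‖f x‖ₑ ≤ C * (eLpNorm f 2 volume + ∑ i, eLpNorm (pdList (List.replicate m i) f) 2 volume) := by
  set W : EuclideanSpace ℝ (Fin n) → ℝ := fun ξ => ((1 + ‖ξ‖) ^ m)⁻¹ with hW
  refine ⟨eLpNorm W 2 volume * ENNReal.ofReal ((n + 1) ^ m),
    ENNReal.mul_ne_top (memLp_one_add_norm_rpow h).2.ne ENNReal.ofReal_ne_top, fun f hf hc x => ?_⟩
  set g := complexSchwartz hf hc with hg
  set G : Fin n → 𝓢(EuclideanSpace ℝ (Fin n), ℂ) := fun i =>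
    complexSchwartz (contDiff_pdList hf (List.replicate m i)) (hc.pdList _) with hG
  have h1 : ‖f x‖ₑ = ‖g x‖ₑ := by
    rw [← ofReal_norm, ← ofReal_norm, hg, complexSchwartz_apply, Complex.norm_real]
  have hcont : Continuous fun ξ : EuclideanSpace ℝ (Fin n) => (1 + ‖ξ‖) ^ m * ‖𝓕 g ξ‖ :=
    ((continuous_const.add continuous_norm).pow m).mul (𝓕 g).continuous.norm
  have h2 : eLpNorm (𝓕 g : 𝓢(EuclideanSpace ℝ (Fin n), ℂ)) 1 volume = 
      eLpNorm (W • fun ξ => (1 + ‖ξ‖) ^ m * ‖𝓕 g ξ‖) 1 volume := by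
    refine eLpNorm_congr_norm_ae (Eventually.of_forall fun ξ => ?_)
    have : (1 + ‖ξ‖) ^ m ≠ 0 := by positivity
    simp only [Pi.smul_apply', smul_eq_mul, hW]
    rw [inv_mul_cancel_left₀ this, norm_norm]
  have h3 : eLpNorm (fun ξ => (1 + ‖ξ‖) ^ m * ‖𝓕 g ξ‖) 2 volume ≤
      ENNReal.ofReal ((n + 1) ^ m) * (eLpNorm f 2 volume + 
        ∑ i, eLpNorm (pdList (List.replicate m i) f) 2 volume) := by
    calc _ ≤ eLpNorm (((n + 1 : ℝ) ^ m) • ((fun ξ => ‖𝓕 g ξ‖) + ∑ i, fun ξ => ‖𝓕 (G i) ξ‖)) 2 volume := by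
          refine eLpNorm_mono_real fun ξ => ?_
          rw [Real.norm_of_nonneg (by positivity)]
          have := one_add_norm_pow_mul_norm_fourier_le (m := m) hf hc ξ
          simpa [Finset.sum_apply] using this
      _ ≤ _ := by
          rw [eLpNorm_const_smul, Real.enorm_of_nonneg (by positivity)]
          gcongr
          have mg : ∀ g : 𝓢(EuclideanSpace ℝ (Fin n), ℂ),
              AEStronglyMeasurable (fun ξ => ‖𝓕 g ξ‖) volume := fun g =>
            (𝓕 g).continuous.norm.aestronglyMeasurable
          refine (eLpNorm_add_le (mg g) (Finset.aestronglyMeasurable_sum _ fun i _ => mg (G i))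
            (by norm_num)).trans ?_
          refine add_le_add (le_of_eq ?_) ((eLpNorm_sum_le (fun i _ => mg (G i))
            (by norm_num)).trans (Finset.sum_le_sum fun i _ => le_of_eq ?_))
          · rw [eLpNorm_norm, eLpNorm_fourier_eq, hg, eLpNorm_complexSchwartz]
          · rw [eLpNorm_norm, eLpNorm_fourier_eq, hG, eLpNorm_complexSchwartz]
  rw [h1]
  refine (enorm_le_lintegral_fourier g x).trans ?_
  rw [h2, mul_assoc]
  refine (eLpNorm_smul_le_mul_eLpNorm (p := 2) (q := 2) (r := 1) hcont.aestronglyMeasurable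
    (memLp_one_add_norm_rpow h).1).trans ?_
  gcongr

/-- The Sobolev inequality bounds all mollifications uniformly, and the bound survives the almost
everywhere limit. -/
theorem IterReg.exists_ae_le {S : Set (EuclideanSpace ℝ (Fin n))} (hS : IsCompact S) (h : n < 2 * m)
    (hu : IterReg Set.univ (fun _ u => MemLp u 2 volume ∧ Function.support u ⊆ S) 0 m u) :
    ∃ C : ℝ, ∀ᵐ y, |u y| ≤ C := by
  obtain ⟨U, rfl, h2, h3⟩ := hu.exists_family
  have hloc : ∀ L : List (Fin n), L.length ≤ m → LocallyIntegrable (U L) := fun L hL =>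
    (h2 L hL).1.locallyIntegrable (by norm_num)
  have hcs : HasCompactSupport (U []) := HasCompactSupport.intro hS fun y hy => by
    by_contra h; exact hy ((h2 [] (by simp)).2 h)
  obtain ⟨C, hC, hCb⟩ := exists_enorm_le_sobolev h
  set B := C * (eLpNorm (U []) 2 volume + ∑ i, eLpNorm (U (List.replicate m i)) 2 volume) with hB
  have hBfin : B ≠ ⊤ := by
    refine ENNReal.mul_ne_top hC (ENNReal.add_ne_top.2 ⟨(h2 [] (by simp)).1.2.ne,
      ENNReal.sum_ne_top.2 fun i _ => (h2 _ (by simp)).1.2.ne⟩)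
  refine ⟨B.toReal, ?_⟩
  filter_upwards [ae_tendsto_mollify (hloc [] (by simp))] with y hy
  refine le_of_tendsto hy.abs (Eventually.of_forall fun k => ?_)
  have h4 : ‖mollify k (U []) y‖ₑ ≤ B := by
    refine (hCb _ (contDiff_mollify k (hloc [] (by simp))) (hasCompactSupport_mollify k hcs) y).trans ?_
    rw [hB]
    gcongr with i
    · exact eLpNorm_mollify_le k (hloc [] (by simp))
    · rw [pdList_mollify h3 k (by simp)]
      exact eLpNorm_mollify_le k (hloc _ (by simp))
  have := ENNReal.toReal_mono hBfin h4
  simpa using this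

end

end

/-! ### The local Sobolev algebra -/

noncomputable section

section

variable {n : ℕ} {Ω K : Set (EuclideanSpace ℝ (Fin n))} {u v : EuclideanSpace ℝ (Fin n) → ℝ}
  {k l m : ℕ}

/-- Local integrability with the exponent that belongs to derivatives of order `j`. -/
def LocSobLp (m : ℕ) (Ω : Set (EuclideanSpace ℝ (Fin n))) (j : ℕ)
    (u : EuclideanSpace ℝ (Fin n) → ℝ) : Prop :=
  ∀ K : Set (EuclideanSpace ℝ (Fin n)), IsCompact K → K ⊆ Ω →
    MemLp u (sobExp m j) (volume.restrict K)

/-- The weak derivatives of `u` of order `j ≤ m` are locally in `L^{2m/j}(Ω)`, with norm at most `B`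
on `K`. -/
def IsSobBounded (m : ℕ) (Ω K : Set (EuclideanSpace ℝ (Fin n))) (B : NNReal)
    (u : EuclideanSpace ℝ (Fin n) → ℝ) : Prop :=
  IterReg Ω (fun j u => LocSobLp m Ω j u ∧ eLpNorm u (sobExp m j) (volume.restrict K) ≤ B) 0 m u

theorem LocSobLp.locL2 {j : ℕ} (h : LocSobLp m Ω j u) (hj : j ≤ m) : LocL2 Ω u := by
  intro K hK hKΩ
  have : IsFiniteMeasure (volume.restrict K) := ⟨by simpa using hK.measure_lt_top⟩
  exact (h K hK hKΩ).mono_exponent (two_le_sobExp hj)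

theorem LocSobLp.add {j : ℕ} (hu : LocSobLp m Ω j u) (hv : LocSobLp m Ω j v) :
    LocSobLp m Ω j (u + v) := fun K hK hKΩ => (hu K hK hKΩ).add (hv K hK hKΩ)

theorem LocSobLp.smul {j : ℕ} (hu : LocSobLp m Ω j u) (c : ℝ) :
    LocSobLp m Ω j (c • u) := fun K hK hKΩ => (hu K hK hKΩ).const_smul c

theorem LocSobLp.congr_ae {j : ℕ} (hu : LocSobLp m Ω j u) (h : u =ᵐ[volume.restrict Ω] v) :
    LocSobLp m Ω j v := fun K hK hKΩ =>
  (memLp_congr_ae (ae_restrict_of_ae_restrict_of_subset hKΩ h)).1 (hu K hK hKΩ)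

theorem holderTriple_sobExp (m j j' : ℕ) :
    ENNReal.HolderTriple (sobExp m j) (sobExp m j') (sobExp m (j + j')) := ⟨sobExp_inv_add m j j'⟩

theorem LocSobLp.mul {j j' : ℕ} (hu : LocSobLp m Ω j u) (hv : LocSobLp m Ω j' v) :
    LocSobLp m Ω (j + j') (u * v) := fun K hK hKΩ => by
  have := holderTriple_sobExp m j' j
  rw [add_comm] at this
  rw [mul_comm u v]
  exact (hu K hK hKΩ).mul (hv K hK hKΩ)

theorem eLpNorm_mul_sobExp_le {j j' : ℕ} (hK : IsCompact K) (hKΩ : K ⊆ Ω)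
    (hu : LocSobLp m Ω j u) (hv : LocSobLp m Ω j' v) :
    eLpNorm (u * v) (sobExp m (j + j')) (volume.restrict K) ≤
      eLpNorm u (sobExp m j) (volume.restrict K) * eLpNorm v (sobExp m j') (volume.restrict K) := by
  have := holderTriple_sobExp m j j'
  have e : u * v = u • v := by funext y; simp [Pi.smul_apply']
  rw [e]
  exact eLpNorm_smul_le_mul_eLpNorm (hv K hK hKΩ).1 (hu K hK hKΩ).1

/-- Functions of the Sobolev class have derivatives of order `j` in `L^{2m/j}_loc`. -/
theorem MemSobolevClass.iterReg (hΩ : IsOpen Ω) (hu : MemSobolevClass m Ω u) :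
    IterReg Ω (LocSobLp m Ω) 0 m u := by
  refine IterReg.of_local (P := fun j u => MemLp u (sobExp m j) volume) hu.1.iterReg
    (fun K hK hKΩ => ?_) fun j u _ h K hK hKΩ => ?_
  · obtain ⟨χ, hχ, hχ1, O, hO, hKO, hOΩ, hχO⟩ := exists_cutoff hK hΩ hKΩ
    refine ⟨O, hO, hKO, hOΩ, fun y => χ y * u y, ?_, ?_⟩
    · refine (ae_restrict_iff' hO.measurableSet).2 (Eventually.of_forall fun y hy => ?_)
      simp [hχO y hy]
    have hcut := hu.1.iterReg.mul_test hχ subset_rfl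
    -- Interpolation needs boundedness: it is part of the class if `2 * m ≤ n`, and the Sobolev
    -- embedding supplies it otherwise.
    obtain ⟨C, hC⟩ : ∃ C : ℝ, ∀ᵐ y, |χ y * u y| ≤ C := by
      by_cases hmn : 2 * m ≤ n
      · obtain ⟨C, hC⟩ := hu.2 hmn (tsupport χ) hχ.2.1 hχ.2.2
        rw [ae_restrict_iff' (isClosed_tsupport χ).measurableSet] at hC
        refine ⟨max C 0, ?_⟩
        filter_upwards [hC] with y hy
        by_cases hyχ : y ∈ tsupport χ
        · rw [abs_mul]
          exact (mul_le_of_le_one_left (abs_nonneg _) (hχ1 y)).trans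
            ((hy hyχ).trans (le_max_left _ _))
        · rw [image_eq_zero_of_notMem_tsupport hyχ]; simp
      · exact hcut.exists_ae_le hχ.2.1 (by omega)
    exact (hcut.memLp_sobExp hχ.2.1 hC).mono (Set.subset_univ _)
  · obtain ⟨u', h1, h2⟩ := h K hK hKΩ
    exact (memLp_congr_ae h1).2 (h2.restrict K)

theorem IterReg.exists_bound (hK : IsCompact K) (hKΩ : K ⊆ Ω)
    (hu : IterReg Ω (LocSobLp m Ω) k l u) : ∃ B : NNReal, IterReg Ω (fun j u => LocSobLp m Ω j u ∧
      eLpNorm u (sobExp m j) (volume.restrict K) ≤ B) k l u := by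
  induction l generalizing k u with
  | zero => exact ⟨(eLpNorm u (sobExp m k) (volume.restrict K)).toNNReal, hu,
      (ENNReal.coe_toNNReal (hu K hK hKΩ).2.ne).ge⟩
  | succ l ih =>
    choose v hv hv' using hu.2
    choose B hB using fun i => ih (hv' i)
    set B0 := (eLpNorm u (sobExp m k) (volume.restrict K)).toNNReal
    refine ⟨B0 + ∑ i, B i, ⟨hu.1, ?_⟩, fun i => ⟨v i, hv i, (hB i).imp fun j w _ _ h => ⟨h.1, ?_⟩⟩⟩
    · rw [← ENNReal.coe_toNNReal (hu.1 K hK hKΩ).2.ne]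
      exact_mod_cast le_self_add
    · refine h.2.trans ?_
      have : B i ≤ B0 + ∑ i, B i :=
        (Finset.single_le_sum (fun _ _ => zero_le) (Finset.mem_univ i)).trans le_add_self
      exact_mod_cast this

theorem MemSobolevClass.exists_isSobBounded (hΩ : IsOpen Ω) (hu : MemSobolevClass m Ω u)
    (hK : IsCompact K) (hKΩ : K ⊆ Ω) : ∃ B, IsSobBounded m Ω K B u :=
  (hu.iterReg hΩ).exists_bound hK hKΩ

/-- Local boundedness is the condition of order zero, whose exponent is `∞`; the other exponents are
at least `2`. -/
theorem IterReg.memSobolevClass (hu : IterReg Ω (LocSobLp m Ω) 0 m u) : MemSobolevClass m Ω u := by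
  have h : IterReg Ω (fun _ u => LocL2 Ω u) 0 m u := hu.imp fun j u _ hj h => h.locL2 (by omega)
  refine ⟨h.memSobolevLoc fun _ _ h => h, fun _ K hK hKΩ => ?_⟩
  have h0 := hu.self K hK hKΩ
  rw [sobExp_zero] at h0
  refine ⟨(eLpNorm u ⊤ (volume.restrict K)).toReal, ?_⟩
  rw [eLpNorm_exponent_top]
  filter_upwards [ae_le_eLpNormEssSup (f := u) (μ := volume.restrict K)] with y hy
  have := ENNReal.toReal_mono (by simpa [eLpNorm_exponent_top] using h0.2.ne) hy
  simpa using this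

theorem IsSobBounded.iterReg {B : NNReal} (hu : IsSobBounded m Ω K B u) :
    IterReg Ω (LocSobLp m Ω) 0 m u := IterReg.imp hu fun _ _ _ _ h => h.1

theorem IsSobBounded.mono {B B' : NNReal} (hu : IsSobBounded m Ω K B u) (h : B ≤ B') :
    IsSobBounded m Ω K B' u :=
  IterReg.imp hu fun _ _ _ _ hu => ⟨hu.1, hu.2.trans (by exact_mod_cast h)⟩

theorem IsSobBounded.add {B B' : NNReal} (hK : IsCompact K) (hKΩ : K ⊆ Ω)
    (hu : IsSobBounded m Ω K B u) (hv : IsSobBounded m Ω K B' v) :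
    IsSobBounded m Ω K (B + B') (u + v) := by
  have hu' : IterReg Ω (fun j u => j ≤ m ∧ LocSobLp m Ω j u ∧
      eLpNorm u (sobExp m j) (volume.restrict K) ≤ B) 0 m u :=
    IterReg.imp hu fun j u _ hj h => ⟨by omega, h⟩
  refine IterReg.add hu' hv fun j a b ha hb => ⟨ha.2.1.add hb.1, ?_⟩
  refine (eLpNorm_add_le (ha.2.1 K hK hKΩ).1 (hb.1 K hK hKΩ).1
    (one_le_two.trans (two_le_sobExp ha.1))).trans ?_
  push_cast
  exact add_le_add ha.2.2 hb.2

theorem IsSobBounded.smul {B : NNReal} (hu : IsSobBounded m Ω K B u) (c : ℝ) :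
    IsSobBounded m Ω K (‖c‖₊ * B) (c • u) :=
  IterReg.smul hu c fun j a ha => ⟨ha.1.smul c, by
    rw [eLpNorm_const_smul]; push_cast; gcongr; exacts [le_rfl, ha.2]⟩

theorem hasWeakPartial_zero (i : Fin n) : HasWeakPartial Ω i 0 0 :=
  ⟨LocL2.zero Ω, LocL2.zero Ω, by simp⟩

theorem isSobBounded_zero : IsSobBounded m Ω K 0 0 := by
  have : ∀ l k, IterReg Ω (fun j u => LocSobLp m Ω j u ∧
      eLpNorm u (sobExp m j) (volume.restrict K) ≤ (0 : NNReal)) k l 0 := fun l => by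
    induction l with
    | zero => exact fun k => ⟨fun _ _ _ => MemLp.zero, by simp⟩
    | succ l ih =>
      exact fun k => ⟨⟨fun _ _ _ => MemLp.zero, by simp⟩, fun i =>
        ⟨0, hasWeakPartial_zero i, ih (k + 1)⟩⟩
  exact this m 0

theorem IsSobBounded.sum {ι : Type*} (s : Finset ι) {B : ι → NNReal}
    {u : ι → EuclideanSpace ℝ (Fin n) → ℝ} (hK : IsCompact K) (hKΩ : K ⊆ Ω)
    (hu : ∀ i ∈ s, IsSobBounded m Ω K (B i) (u i)) :
    IsSobBounded m Ω K (∑ i ∈ s, B i) (∑ i ∈ s, u i) := by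
  classical
  induction s using Finset.induction_on with
  | empty => simpa using isSobBounded_zero
  | insert a s ha ih =>
    rw [Finset.sum_insert ha, Finset.sum_insert ha]
    exact (hu a (by simp)).add hK hKΩ (ih fun i hi => hu i (by simp [hi]))

theorem IsSobBounded.congr_ae {B : NNReal} (hΩ : IsOpen Ω) (hKΩ : K ⊆ Ω)
    (hu : IsSobBounded m Ω K B u) (h : u =ᵐ[volume.restrict Ω] v) : IsSobBounded m Ω K B v := by
  have h0 := IterReg.self hu
  refine IterReg.congr hΩ hu h ⟨h0.1.congr_ae h, ?_⟩
  rw [← eLpNorm_congr_ae (ae_restrict_of_ae_restrict_of_subset hKΩ h)]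
  exact h0.2

/-- Hölder's inequality with the exponents `2m / i` and `2m / (j - i)` bounds each term of the
Leibniz formula by `B * B'`; at most `m` differentiations leave at most `2 ^ m` terms. -/
theorem IsSobBounded.mul {B B' : NNReal} (hΩ : IsOpen Ω) (hK : IsCompact K) (hKΩ : K ⊆ Ω)
    (hu : IsSobBounded m Ω K B u) (hv : IsSobBounded m Ω K B' v) :
    IsSobBounded m Ω K (2 ^ m * (B * B')) (u * v) := by
  -- The guard `j ≤ m` keeps the exponents at least `2`, as the triangle inequality and membership
  -- in `L²_loc` require.
  have := IterReg.mul (M := m) hΩ (R := fun c j u => j ≤ m → LocSobLp m Ω j u ∧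
    eLpNorm u (sobExp m j) (volume.restrict K) ≤ (2 ^ c * (B * B') : NNReal))
    (fun j j' u v _ hu hv _ => ⟨hu.1.mul hv.1, by
      refine (eLpNorm_mul_sobExp_le hK hKΩ hu.1 hv.1).trans ?_
      push_cast
      rw [pow_zero, one_mul]
      exact mul_le_mul' hu.2 hv.2⟩)
    (fun c j u v hu hv hj => ⟨(hu hj).1.add (hv hj).1, by
      refine (eLpNorm_add_le ((hu hj).1 K hK hKΩ).1 ((hv hj).1 K hK hKΩ).1
        (one_le_two.trans (two_le_sobExp hj))).trans ?_
      refine (add_le_add (hu hj).2 (hv hj).2).trans (le_of_eq ?_)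
      push_cast; ring⟩)
    (fun c j u hu hj => ⟨(hu hj).1, (hu hj).2.trans (by
      have : 2 ^ c * (B * B') ≤ 2 ^ (c + 1) * (B * B') := by
        gcongr
        · norm_num
        · omega
      exact_mod_cast this)⟩)
    (fun c j u hj hu => (hu hj).1.locL2 hj) hu hv (by simp)
  exact IterReg.imp this fun j u _ hj h => h (by omega)

/-- On a compact set, of finite measure, the `L^{2m/k}` norm controls the `L²` norm; this leads back
to the seminorms that define boundedness of functionals. -/
theorem exists_sobolevSeminorm_le (m : ℕ) (hΩ : IsOpen Ω) (hK : IsCompact K) (hKΩ : K ⊆ Ω) :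
    ∃ C : ℝ, 0 ≤ C ∧ ∀ (B : NNReal) (u : EuclideanSpace ℝ (Fin n) → ℝ),
      IsSobBounded m Ω K B u → sobolevSeminorm m Ω K u ≤ C * B := by
  have : IsFiniteMeasure (volume.restrict K) := ⟨by simpa using hK.measure_lt_top⟩
  set c : ℕ → ENNReal := fun k =>
    (volume.restrict K) Set.univ ^ (1 / (2 : ENNReal).toReal - 1 / (sobExp m k).toReal) with hc
  refine ⟨∑ k ∈ Finset.range (m + 1), ∑ _ι : Fin k → Fin n, (c k).toReal,
    Finset.sum_nonneg fun _ _ => Finset.sum_nonneg fun _ _ => ENNReal.toReal_nonneg,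
    fun B u hu => ?_⟩
  rw [sobolevSeminorm, Finset.sum_mul]
  refine Finset.sum_le_sum fun k hk => ?_
  rw [Finset.sum_mul]
  refine Finset.sum_le_sum fun ι _ => ?_
  have hkm : k ≤ m := by simpa [Nat.lt_succ_iff] using hk
  have hu' : IterReg Ω (fun j u => j ≤ m ∧ LocSobLp m Ω j u ∧
      eLpNorm u (sobExp m j) (volume.restrict K) ≤ B) 0 m u :=
    IterReg.imp hu fun j u _ hj h => ⟨by omega, h⟩
  obtain ⟨v, hv, -, h1, h2⟩ := hu'.exists_isWeakDeriv (fun j u h => h.2.1.locL2 h.1) hkm ι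
  rw [zero_add] at h1 h2
  have hle : eLpNorm (weakDeriv Ω ι u) 2 (volume.restrict K) ≤ B * c k := by
    rw [eLpNorm_congr_ae (ae_restrict_of_ae_restrict_of_subset hKΩ (weakDeriv_spec hΩ hv))]
    refine (eLpNorm_le_eLpNorm_mul_rpow_measure_univ (two_le_sobExp hkm) (h1 K hK hKΩ).1).trans ?_
    gcongr
  have hcfin : c k ≠ ⊤ := by
    refine ENNReal.rpow_ne_top_of_nonneg ?_ (measure_ne_top _ _)
    rcases Nat.eq_zero_or_pos k with rfl | hk0
    · simp [sobExp_zero]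
    · rw [sobExp_eq_ofReal hk0.ne', ENNReal.toReal_ofReal (by positivity), sub_nonneg]
      have h0 : (0 : ℝ) < k := by exact_mod_cast hk0
      have h3 : (k : ℝ) ≤ m := by exact_mod_cast hkm
      rw [one_div_div, ENNReal.toReal_ofNat, div_le_div_iff₀ (by linarith) (by norm_num)]
      linarith
  have := ENNReal.toReal_mono (ENNReal.mul_ne_top ENNReal.coe_ne_top hcfin) hle
  rw [ENNReal.toReal_mul, ENNReal.coe_toReal] at this
  linarith

/-! ### Matrices of functions -/

/-- All entries of a matrix of functions satisfy `IsSobBounded`. -/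
def IsSobBoundedMat (m : ℕ) (Ω K : Set (EuclideanSpace ℝ (Fin n))) (B : NNReal)
    (X : EuclideanSpace ℝ (Fin n) → Matrix (Fin n) (Fin n) ℝ) : Prop :=
  ∀ i j, IsSobBounded m Ω K B fun y => X y i j

variable {X Y X₀ a : EuclideanSpace ℝ (Fin n) → Matrix (Fin n) (Fin n) ℝ} {B B' A : NNReal}

theorem IsSobBoundedMat.mono (hX : IsSobBoundedMat m Ω K B X) (h : B ≤ B') :
    IsSobBoundedMat m Ω K B' X := fun i j => (hX i j).mono h

theorem IsSobBoundedMat.congr_ae (hΩ : IsOpen Ω) (hKΩ : K ⊆ Ω) (hX : IsSobBoundedMat m Ω K B X)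
    (h : X =ᵐ[volume.restrict Ω] Y) : IsSobBoundedMat m Ω K B Y := fun i j =>
  (hX i j).congr_ae hΩ hKΩ (h.mono fun y hy => by simp only [hy])

theorem IsSobBoundedMat.add (hK : IsCompact K) (hKΩ : K ⊆ Ω) (hX : IsSobBoundedMat m Ω K B X)
    (hY : IsSobBoundedMat m Ω K B' Y) : IsSobBoundedMat m Ω K (B + B') fun y => X y + Y y :=
  fun i j => (hX i j).add hK hKΩ (hY i j)

theorem IsSobBoundedMat.smul (hX : IsSobBoundedMat m Ω K B X) (c : ℝ) :
    IsSobBoundedMat m Ω K (‖c‖₊ * B) fun y => c • X y := fun i j => (hX i j).smul c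

theorem IsSobBoundedMat.mul (hΩ : IsOpen Ω) (hK : IsCompact K) (hKΩ : K ⊆ Ω)
    (hX : IsSobBoundedMat m Ω K B X) (hY : IsSobBoundedMat m Ω K B' Y) :
    IsSobBoundedMat m Ω K (n * 2 ^ m * (B * B')) fun y => X y * Y y := fun i j => by
  have := IsSobBounded.sum Finset.univ hK hKΩ fun k _ => (hX i k).mul hΩ hK hKΩ (hY k j)
  simp only [Finset.sum_const, Finset.card_univ, Fintype.card_fin, nsmul_eq_mul, ← mul_assoc] at this
  refine (this.mono (le_of_eq (by ring))).congr_ae hΩ hKΩ (Eventually.of_forall fun y => ?_)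
  simp [Matrix.mul_apply, Finset.sum_apply]

/-- Solutions of a linear equation with small coefficients are bounded a priori. -/
theorem IsSobBoundedMat.of_eq_add_smul_mul (hΩ : IsOpen Ω) (hK : IsCompact K) (hKΩ : K ⊆ Ω) {t : ℝ}
    (hX : IsSobBoundedMat m Ω K B X) (hX₀ : IsSobBoundedMat m Ω K B' X₀)
    (ha : IsSobBoundedMat m Ω K A a) (ht : ‖t‖₊ * (n * 2 ^ m * A) ≤ 1 / 2)
    (h : X =ᵐ[volume.restrict Ω] fun y => X₀ y + t • (X y * a y)) :
    IsSobBoundedMat m Ω K (2 * B' + 1) X := by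
  -- One substitution into the equation halves the contribution of the old bound, by the smallness
  -- of `t`.
  have step : ∀ B, IsSobBoundedMat m Ω K B X → IsSobBoundedMat m Ω K (B' + B / 2) X := fun B hB => by
    have h1 := hX₀.add hK hKΩ ((hB.mul hΩ hK hKΩ ha).smul t)
    refine (h1.mono ?_).congr_ae hΩ hKΩ h.symm
    gcongr
    calc ‖t‖₊ * (n * 2 ^ m * (B * A)) = (‖t‖₊ * (n * 2 ^ m * A)) * B := by ring
      _ ≤ 1 / 2 * B := by gcongr
      _ = B / 2 := by ring
  have iter : ∀ r : ℕ, IsSobBoundedMat m Ω K (2 * B' + B / 2 ^ r) X := fun r => by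
    induction r with
    | zero => exact hX.mono (by simp)
    | succ r ih =>
      refine (step _ ih).mono (le_of_eq ?_)
      rw [pow_succ, add_div, mul_div_cancel_left₀ _ two_ne_zero, ← add_assoc, ← two_mul, div_div]
  -- The initial bound leaves no trace: after enough substitutions its contribution is at most one.
  obtain ⟨r, hr⟩ := pow_unbounded_of_one_lt B (one_lt_two)
  refine (iter r).mono ?_
  gcongr
  exact div_le_one_of_le₀ hr.le zero_le

end

end

noncomputable section

/-! ### Linear algebra of two-tensors in a basis -/

section LinearAlgebra

variable {n : ℕ} {V : Type*} [AddCommGroup V] [Module ℝ V] (b : Module.Basis (Fin n) ℝ V)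

/-- The matrix of a bilinear form. -/
def formMat (X : LinearMap.BilinForm ℝ V) : Matrix (Fin n) (Fin n) ℝ :=
  Matrix.of fun i j => X (b i) (b j)

/-- The matrix of a bilinear form on the dual space. -/
def dualFormMat (Y : LinearMap.BilinForm ℝ (Module.Dual ℝ V)) : Matrix (Fin n) (Fin n) ℝ :=
  Matrix.of fun i j => Y (b.coord i) (b.coord j)

theorem formMat_injective : Function.Injective (formMat b) := fun _ _ h =>
  LinearMap.BilinForm.ext_basis b fun i j => congrFun (congrFun h i) j

theorem apply_eq_sum_formMat (X : LinearMap.BilinForm ℝ V) (i : Fin n) :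
    X (b i) = ∑ k, formMat b X i k • b.coord k :=
  b.ext fun j => by simp [formMat]

theorem formMat_compl (P Q : LinearMap.BilinForm ℝ V)
    (Y : LinearMap.BilinForm ℝ (Module.Dual ℝ V)) :
    formMat b (Y.compl₁₂ P Q) = formMat b P * dualFormMat b Y * (formMat b Q).transpose := by
  ext i j
  change Y (P (b i)) (Q (b j)) = _
  rw [apply_eq_sum_formMat b P, apply_eq_sum_formMat b Q]
  simp only [map_sum, map_smul, LinearMap.sum_apply, LinearMap.smul_apply, smul_eq_mul,
    Matrix.mul_apply, Matrix.transpose_apply, Finset.sum_mul, Finset.mul_sum]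
  exact Finset.sum_congr rfl fun k _ => Finset.sum_congr rfl fun l _ => by
    rw [dualFormMat, Matrix.of_apply]; ring

theorem dualFormMat_compl (X : LinearMap.BilinForm ℝ V) (S T : Module.Dual ℝ V →ₗ[ℝ] V) :
    dualFormMat b (X.compl₁₂ S T) = (Matrix.of fun i k => b.coord k (S (b.coord i))) * formMat b X *
      (Matrix.of fun i k => b.coord k (T (b.coord i))).transpose := by
  ext i j
  change X (S (b.coord i)) (T (b.coord j)) = _
  rw [← b.sum_repr (S (b.coord i)), ← b.sum_repr (T (b.coord j))]
  simp only [map_sum, map_smul, LinearMap.sum_apply, LinearMap.smul_apply, smul_eq_mul,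
    Matrix.mul_apply, Matrix.transpose_apply, Finset.sum_mul, Finset.mul_sum]
  refine Finset.sum_congr rfl fun k _ => Finset.sum_congr rfl fun l _ => by
    simp [formMat]; ring

theorem inverse_iff_formMat_mul_eq_one (L : LinearMap.BilinForm ℝ V)
    (U : LinearMap.BilinForm ℝ (Module.Dual ℝ V)) :
    (∀ v β, U (L v) β = β v) ↔ formMat b L * dualFormMat b U = 1 := by
  have h1 : ∀ i j, (formMat b L * dualFormMat b U) i j = U (L (b i)) (b.coord j) := fun i j => by
    rw [apply_eq_sum_formMat b L]
    simp [Matrix.mul_apply, dualFormMat]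
  constructor
  · intro h
    ext i j
    rw [h1, h]
    simp [Matrix.one_apply, Finsupp.single_apply]
  · intro h
    have h2 : U.compl₁₂ L LinearMap.id = LinearMap.flip (LinearMap.id : Module.Dual ℝ V →ₗ[ℝ] _) := by
      refine b.ext fun i => b.dualBasis.ext fun j => ?_
      have := h1 i j
      rw [h] at this
      simp only [Module.Basis.coe_dualBasis]
      change U (L (b i)) (b.coord j) = b.coord j (b i)
      rw [← this]
      simp [Matrix.one_apply, Finsupp.single_apply]
    exact fun v β => LinearMap.congr_fun (LinearMap.congr_fun h2 v) β

end LinearAlgebra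

section Tensors

variable {n m : ℕ} {M : Type*} [TopologicalSpace M] [ChartedSpace (EuclideanSpace ℝ (Fin n)) M]

/-- The matrix of components of a covariant tensor field in a chart. -/
def CovField.mat (X : CovField n M) (e : OpenPartialHomeomorph M (EuclideanSpace ℝ (Fin n)))
    (y : EuclideanSpace ℝ (Fin n)) : Matrix (Fin n) (Fin n) ℝ :=
  Matrix.of fun i j => CovField.comp X e i j y

/-- The matrix of components of a contravariant tensor field in a chart. -/
def ContraField.mat (Y : ContraField n M) (e : OpenPartialHomeomorph M (EuclideanSpace ℝ (Fin n)))
    (y : EuclideanSpace ℝ (Fin n)) : Matrix (Fin n) (Fin n) ℝ :=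
  Matrix.of fun i j => ContraField.comp Y e i j y

/-- The tensor field `P_{ik} Q_{jl} Y^{kl}`. -/
def contractBoth (P Q : CovField n M) (Y : ContraField n M) : CovField n M :=
  fun x => (Y x).compl₁₂ (P x) (Q x)

theorem dual_apply_sharp (h : ContraField n M) (x : M)
    (α β : Module.Dual ℝ (TangentSpace (𝓡 n) x)) : β (sharp h x α) = h x α β := by
  have : FiniteDimensional ℝ (TangentSpace (𝓡 n) x) :=
    inferInstanceAs (FiniteDimensional ℝ (EuclideanSpace ℝ (Fin n)))
  exact LinearMap.congr_fun
    ((Module.evalEquiv ℝ (TangentSpace (𝓡 n) x)).apply_symm_apply (h x α)) β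

variable {e : OpenPartialHomeomorph M (EuclideanSpace ℝ (Fin n))} {y : EuclideanSpace ℝ (Fin n)}

/-! ### Regularity of tensor fields in charts -/

theorem exists_isSobBoundedMat {Ω K : Set (EuclideanSpace ℝ (Fin n))}
    {X : EuclideanSpace ℝ (Fin n) → Matrix (Fin n) (Fin n) ℝ} (hΩ : IsOpen Ω) (hK : IsCompact K)
    (hKΩ : K ⊆ Ω) (h : ∀ i j, MemSobolevClass m Ω fun y => X y i j) :
    ∃ B, IsSobBoundedMat m Ω K B X := by
  choose B hB using fun i j => (h i j).exists_isSobBounded hΩ hK hKΩ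
  refine ⟨∑ i, ∑ j, B i j, fun i j => (hB i j).mono ?_⟩
  exact (Finset.single_le_sum (f := B i) (fun _ _ => zero_le) (Finset.mem_univ j)).trans
    (Finset.single_le_sum (f := fun i => ∑ j, B i j) (fun _ _ => zero_le) (Finset.mem_univ i))

theorem SobolevCov.exists_bound (X : SobolevCov m n M)
    (he : e ∈ atlas (EuclideanSpace ℝ (Fin n)) M) {K : Set (EuclideanSpace ℝ (Fin n))}
    (hK : IsCompact K) (hKe : K ⊆ e.target) :
    ∃ B, IsSobBoundedMat m e.target K B (CovField.mat X.1 e) :=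
  exists_isSobBoundedMat e.open_target hK hKe (X.2 e he)

theorem SobolevContra.exists_bound (Y : SobolevContra m n M)
    (he : e ∈ atlas (EuclideanSpace ℝ (Fin n)) M) {K : Set (EuclideanSpace ℝ (Fin n))}
    (hK : IsCompact K) (hKe : K ⊆ e.target) :
    ∃ B, IsSobBoundedMat m e.target K B (ContraField.mat Y.1 e) :=
  exists_isSobBoundedMat e.open_target hK hKe (Y.2 e he)

/-- With `K = ∅` the norm bound is vacuous, and the hypothesis expresses regularity alone. -/
theorem mem_sobolevCov {X : CovField n M} (h : ∀ e ∈ atlas (EuclideanSpace ℝ (Fin n)) M,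
    ∃ B, IsSobBoundedMat m e.target ∅ B (X.mat e)) : X ∈ SobolevCov m n M := fun e he i j =>
  let ⟨_, hB⟩ := h e he
  (hB i j).iterReg.memSobolevClass

theorem mem_sobolevContra {Y : ContraField n M} (h : ∀ e ∈ atlas (EuclideanSpace ℝ (Fin n)) M,
    ∃ B, IsSobBoundedMat m e.target ∅ B (Y.mat e)) : Y ∈ SobolevContra m n M := fun e he i j =>
  let ⟨_, hB⟩ := h e he
  (hB i j).iterReg.memSobolevClass

theorem IsSobBoundedMat.transpose {Ω K : Set (EuclideanSpace ℝ (Fin n))} {B : NNReal}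
    {X : EuclideanSpace ℝ (Fin n) → Matrix (Fin n) (Fin n) ℝ} (hX : IsSobBoundedMat m Ω K B X) :
    IsSobBoundedMat m Ω K B fun y => (X y).transpose := fun i j => hX j i

theorem SobolevMetric.ae_transpose_eq (g : SobolevMetric m n M)
    (he : e ∈ atlas (EuclideanSpace ℝ (Fin n)) M) : ∀ᵐ y ∂(volume.restrict e.target),
      (CovField.mat g.lower.1 e y).transpose = CovField.mat g.lower.1 e y := by
  filter_upwards [g.symm e he] with y h1
  ext i j
  exact h1 _ _

/-! ### Functionals bounded by Sobolev seminorms -/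

theorem tendsto_zero_of_patch_bound {s : Finset (OpenPartialHomeomorph M (EuclideanSpace ℝ (Fin n)) ×
      Set (EuclideanSpace ℝ (Fin n)))} (hs : IsPatchFamily s) {C : ℝ} {a : ℝ → ℝ}
    {Z : ℝ → OpenPartialHomeomorph M (EuclideanSpace ℝ (Fin n)) → EuclideanSpace ℝ (Fin n) →
      Matrix (Fin n) (Fin n) ℝ}
    (ha : ∀ t, |a t| ≤ C * ∑ p ∈ s, ∑ i, ∑ j,
      sobolevSeminorm m p.1.target p.2 fun y => Z t p.1 y i j)
    (h : ∀ e ∈ atlas (EuclideanSpace ℝ (Fin n)) M, ∀ K, IsCompact K → K ⊆ e.target →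
      ∃ D : NNReal, ∀ᶠ t in 𝓝 0, IsSobBoundedMat m e.target K (D * ‖t‖₊) (Z t e)) :
    Tendsto a (𝓝 0) (𝓝 0) := by
  have hp : ∀ p ∈ s, ∃ D : ℝ, ∀ᶠ t : ℝ in 𝓝 0, ∀ i j,
      sobolevSeminorm m p.1.target p.2 (fun y => Z t p.1 y i j) ≤ D * |t| := fun p hp => by
    obtain ⟨he, hK, hKe⟩ := hs p hp
    obtain ⟨D, hD⟩ := h _ he _ hK hKe
    obtain ⟨c, -, hc⟩ := exists_sobolevSeminorm_le m p.1.open_target hK hKe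
    refine ⟨c * D, hD.mono fun t ht i j => (hc _ _ (ht i j)).trans (le_of_eq ?_)⟩
    push_cast
    rw [Real.norm_eq_abs]; ring
  choose! D hD using hp
  have hev := (Filter.eventually_all_finset s).2 hD
  have hsn : ∀ (Ω K : Set (EuclideanSpace ℝ (Fin n))) (u), 0 ≤ sobolevSeminorm m Ω K u :=
    fun Ω K u => Finset.sum_nonneg fun _ _ => Finset.sum_nonneg fun _ _ => ENNReal.toReal_nonneg
  have hlim : Tendsto (fun t : ℝ => |C| * ∑ p ∈ s, ∑ _i : Fin n, ∑ _j : Fin n, D p * |t|)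
      (𝓝 0) (𝓝 0) := by
    have hc : Continuous fun t : ℝ => |C| * ∑ p ∈ s, ∑ _i : Fin n, ∑ _j : Fin n, D p * |t| := by
      fun_prop
    simpa using hc.tendsto 0
  refine squeeze_zero_norm' ?_ hlim
  filter_upwards [hev] with t ht
  refine (ha t).trans ((mul_le_mul_of_nonneg_right (le_abs_self C) ?_).trans
    (mul_le_mul_of_nonneg_left ?_ (abs_nonneg C)))
  · exact Finset.sum_nonneg fun _ _ => Finset.sum_nonneg fun _ _ => Finset.sum_nonneg fun _ _ => hsn _ _ _
  · exact Finset.sum_le_sum fun p hp => Finset.sum_le_sum fun i _ => Finset.sum_le_sum fun j _ =>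
      ht p hp i j

theorem IsBoundedCov.tendsto {A : Module.Dual ℝ (SobolevCov m n M)} (hA : IsBoundedCov A)
    {X : ℝ → SobolevCov m n M} {X₀ : SobolevCov m n M}
    (h : ∀ e ∈ atlas (EuclideanSpace ℝ (Fin n)) M, ∀ K, IsCompact K → K ⊆ e.target →
      ∃ D : NNReal, ∀ᶠ t : ℝ in 𝓝 0, IsSobBoundedMat m e.target K (D * ‖t‖₊)
        fun y => CovField.mat (X t).1 e y - CovField.mat X₀.1 e y) :
    Tendsto (fun t => A (X t)) (𝓝 0) (𝓝 (A X₀)) := by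
  obtain ⟨s, hs, C, hC⟩ := hA
  rw [tendsto_iff_norm_sub_tendsto_zero]
  refine tendsto_zero_of_patch_bound hs (C := C)
    (Z := fun t e y => CovField.mat (X t).1 e y - CovField.mat X₀.1 e y) (fun t => ?_) h
  have h1 : A (X t) - A X₀ = A (X t + (-1 : ℝ) • X₀) := by
    rw [map_add, map_smul, neg_one_smul, sub_eq_add_neg]
  rw [h1, Real.norm_eq_abs, abs_abs]
  refine (hC _).trans (le_of_eq ?_)
  congr! 8 with p - i - j -
  rename_i y
  change CovField.comp (X t).1 p.1 i j y + (-1 : ℝ) * CovField.comp X₀.1 p.1 i j y = _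
  rw [neg_one_mul, ← sub_eq_add_neg]
  rfl

theorem IsBoundedContra.tendsto {A : Module.Dual ℝ (SobolevContra m n M)} (hA : IsBoundedContra A)
    {X : ℝ → SobolevContra m n M} {X₀ : SobolevContra m n M}
    (h : ∀ e ∈ atlas (EuclideanSpace ℝ (Fin n)) M, ∀ K, IsCompact K → K ⊆ e.target →
      ∃ D : NNReal, ∀ᶠ t : ℝ in 𝓝 0, IsSobBoundedMat m e.target K (D * ‖t‖₊)
        fun y => ContraField.mat (X t).1 e y - ContraField.mat X₀.1 e y) :
    Tendsto (fun t => A (X t)) (𝓝 0) (𝓝 (A X₀)) := by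
  obtain ⟨s, hs, C, hC⟩ := hA
  rw [tendsto_iff_norm_sub_tendsto_zero]
  refine tendsto_zero_of_patch_bound hs (C := C)
    (Z := fun t e y => ContraField.mat (X t).1 e y - ContraField.mat X₀.1 e y) (fun t => ?_) h
  have h1 : A (X t) - A X₀ = A (X t + (-1 : ℝ) • X₀) := by
    rw [map_add, map_smul, neg_one_smul, sub_eq_add_neg]
  rw [h1, Real.norm_eq_abs, abs_abs]
  refine (hC _).trans (le_of_eq ?_)
  congr! 8 with p - i - j -
  rename_i y
  change ContraField.comp (X t).1 p.1 i j y + (-1 : ℝ) * ContraField.comp X₀.1 p.1 i j y = _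
  rw [neg_one_mul, ← sub_eq_add_neg]
  rfl

theorem isSobBoundedMat_of_ae_eq_zero {Ω K : Set (EuclideanSpace ℝ (Fin n))} (hΩ : IsOpen Ω)
    (hKΩ : K ⊆ Ω) {X : EuclideanSpace ℝ (Fin n) → Matrix (Fin n) (Fin n) ℝ}
    (h : ∀ᵐ y ∂(volume.restrict Ω), X y = 0) (B : NNReal) : IsSobBoundedMat m Ω K B X :=
  fun i j => (isSobBounded_zero.mono zero_le).congr_ae hΩ hKΩ (h.mono fun y hy => by simp [hy])

/-- Apply the continuity statement to a constant family at distance zero: a functional bounded by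
the seminorms does not see null sets. -/
theorem IsBoundedCov.congr_ae {A : Module.Dual ℝ (SobolevCov m n M)} (hA : IsBoundedCov A)
    {X X' : SobolevCov m n M} (h : ∀ e ∈ atlas (EuclideanSpace ℝ (Fin n)) M,
      CovField.mat X.1 e =ᵐ[volume.restrict e.target] CovField.mat X'.1 e) : A X = A X' := by
  refine tendsto_nhds_unique tendsto_const_nhds (hA.tendsto (X := fun _ => X) (X₀ := X') fun e he K hK hKe =>
    ⟨0, Eventually.of_forall fun t => isSobBoundedMat_of_ae_eq_zero e.open_target hKe ?_ _⟩)
  filter_upwards [h e he] with y hy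
  rw [hy, sub_self]

/-! ### Components of tensor fields in a chart -/

variable [IsManifold (𝓡 n) ∞ M]

/-- The coordinate vectors of a chart form a basis of the tangent space. -/
def coordBasis (he : e ∈ atlas (EuclideanSpace ℝ (Fin n)) M) (hy : y ∈ e.target) :
    Module.Basis (Fin n) ℝ (TangentSpace (𝓡 n) (e.symm y)) :=
  haveI : IsManifold (𝓡 n) 1 M := IsManifold.of_le (n := ∞) (by simp)
  (EuclideanSpace.basisFun (Fin n) ℝ).toBasis.map
    ((mdifferentiable_of_mem_atlas (I := 𝓡 n) he).symm.mfderiv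
      (show y ∈ e.symm.source from hy)).toLinearEquiv

theorem coordBasis_apply (he : e ∈ atlas (EuclideanSpace ℝ (Fin n)) M) (hy : y ∈ e.target)
    (i : Fin n) : coordBasis he hy i = coordVec e y i := by
  refine (Module.Basis.map_apply _ _ _).trans ?_
  rw [OrthonormalBasis.coe_toBasis, EuclideanSpace.basisFun_apply]
  rfl

/-- Differentiate `e ∘ e.symm = id` and take the coordinate `i`. -/
theorem coordCovec_coordVec (he : e ∈ atlas (EuclideanSpace ℝ (Fin n)) M) (hy : y ∈ e.target)
    (i j : Fin n) : coordCovec e y i (coordVec e y j) = if j = i then 1 else 0 := by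
  have : IsManifold (𝓡 n) 1 M := IsManifold.of_le (n := ∞) (by simp)
  have hd := mdifferentiable_of_mem_atlas (I := 𝓡 n) he
  have h1 := hd.comp_symm_deriv hy
  have h2 : MDifferentiableAt (𝓡 n) (𝓡 n) e (e.symm y) := hd.mdifferentiableAt (e.map_target hy)
  set p : EuclideanSpace ℝ (Fin n) →L[ℝ] ℝ := EuclideanSpace.proj i
  have h3 : HasMFDerivAt (𝓡 n) 𝓘(ℝ, ℝ) (fun x : M => e x i) (e.symm y)
      (p.comp (mfderiv (𝓡 n) (𝓡 n) e (e.symm y))) :=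
    HasMFDerivAt.comp (g := p) (e.symm y) p.hasMFDerivAt h2.hasMFDerivAt
  have h4 := congrArg (fun A => A (EuclideanSpace.single j (1 : ℝ))) h1
  rw [coordCovec, coordVec, h3.mfderiv]
  change p ((mfderiv (𝓡 n) (𝓡 n) e (e.symm y)) ((mfderiv (𝓡 n) (𝓡 n) e.symm y) _)) = _
  refine (congrArg p h4).trans ?_
  change p (EuclideanSpace.single j (1 : ℝ)) = _
  simp [p, eq_comm]

theorem coordBasis_coord (he : e ∈ atlas (EuclideanSpace ℝ (Fin n)) M) (hy : y ∈ e.target)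
    (i : Fin n) : (coordBasis he hy).coord i = coordCovec e y i :=
  (coordBasis he hy).ext fun j => by
    rw [Module.Basis.coord_apply, Module.Basis.repr_self, coordBasis_apply, coordCovec_coordVec he hy,
      Finsupp.single_apply]

theorem CovField.mat_eq (he : e ∈ atlas (EuclideanSpace ℝ (Fin n)) M) (hy : y ∈ e.target)
    (X : CovField n M) : X.mat e y = formMat (coordBasis he hy) (X (e.symm y)) := by
  ext i j
  simp only [CovField.mat, formMat, Matrix.of_apply, coordBasis_apply]
  rfl

theorem ContraField.mat_eq (he : e ∈ atlas (EuclideanSpace ℝ (Fin n)) M) (hy : y ∈ e.target)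
    (Y : ContraField n M) : Y.mat e y = dualFormMat (coordBasis he hy) (Y (e.symm y)) := by
  ext i j
  simp only [ContraField.mat, dualFormMat, Matrix.of_apply, coordBasis_coord]
  rfl

theorem mat_contractBoth (he : e ∈ atlas (EuclideanSpace ℝ (Fin n)) M) (hy : y ∈ e.target)
    (P Q : CovField n M) (Y : ContraField n M) :
    (contractBoth P Q Y).mat e y = P.mat e y * Y.mat e y * (Q.mat e y).transpose := by
  rw [CovField.mat_eq he hy, CovField.mat_eq he hy, CovField.mat_eq he hy, ContraField.mat_eq he hy]
  exact formMat_compl _ _ _ _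

theorem mat_raiseIndices (he : e ∈ atlas (EuclideanSpace ℝ (Fin n)) M) (hy : y ∈ e.target)
    (h : ContraField n M) (X : CovField n M) :
    (raiseIndices h X).mat e y = h.mat e y * X.mat e y * (h.mat e y).transpose := by
  rw [ContraField.mat_eq he hy, ContraField.mat_eq he hy, CovField.mat_eq he hy]
  refine (dualFormMat_compl (coordBasis he hy) _ _ _).trans ?_
  simp only [dual_apply_sharp]
  rfl

theorem contractBoth_mem (P Q : SobolevCov m n M) (Y : SobolevContra m n M) :
    contractBoth P.1 Q.1 Y.1 ∈ SobolevCov m n M := mem_sobolevCov fun e he => by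
  obtain ⟨B1, h1⟩ := SobolevCov.exists_bound P he isCompact_empty (Set.empty_subset _)
  obtain ⟨B2, h2⟩ := SobolevCov.exists_bound Q he isCompact_empty (Set.empty_subset _)
  obtain ⟨B3, h3⟩ := SobolevContra.exists_bound Y he isCompact_empty (Set.empty_subset _)
  have := (h1.mul e.open_target isCompact_empty (Set.empty_subset _) h3).mul e.open_target
    isCompact_empty (Set.empty_subset _) h2.transpose
  exact ⟨_, this.congr_ae e.open_target (Set.empty_subset _)
    (ae_restrict_of_forall_mem e.open_target.measurableSet fun y hy => (mat_contractBoth he hy _ _ _).symm)⟩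

theorem raiseIndices_mem (h : SobolevContra m n M) (X : SobolevCov m n M) :
    raiseIndices h.1 X.1 ∈ SobolevContra m n M := mem_sobolevContra fun e he => by
  obtain ⟨B1, h1⟩ := SobolevContra.exists_bound h he isCompact_empty (Set.empty_subset _)
  obtain ⟨B2, h2⟩ := SobolevCov.exists_bound X he isCompact_empty (Set.empty_subset _)
  have := (h1.mul e.open_target isCompact_empty (Set.empty_subset _) h2).mul e.open_target
    isCompact_empty (Set.empty_subset _) h1.transpose
  exact ⟨_, this.congr_ae e.open_target (Set.empty_subset _)
    (ae_restrict_of_forall_mem e.open_target.measurableSet fun y hy => (mat_raiseIndices he hy _ _).symm)⟩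

/-! ### Pointwise conditions in terms of matrices -/

theorem aeOnManifold_cov_eq_iff {X X' : CovField n M} : AEOnManifold n (fun x : M => X x = X' x) ↔
    ∀ e ∈ atlas (EuclideanSpace ℝ (Fin n)) M, X.mat e =ᵐ[volume.restrict e.target] X'.mat e := by
  refine forall₂_congr fun e he => ?_
  have h : ∀ᵐ y ∂(volume.restrict e.target), X (e.symm y) = X' (e.symm y) ↔ X.mat e y = X'.mat e y :=
    ae_restrict_of_forall_mem e.open_target.measurableSet fun y hy => by
      rw [CovField.mat_eq he hy, CovField.mat_eq he hy, (formMat_injective _).eq_iff]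
  exact ⟨fun h' => by filter_upwards [h, h'] with y h1 h2 using h1.1 h2,
    fun h' => by filter_upwards [h, h'] with y h1 h2 using h1.2 h2⟩

theorem SobolevMetric.ae_mul_eq_one (g : SobolevMetric m n M)
    (he : e ∈ atlas (EuclideanSpace ℝ (Fin n)) M) : ∀ᵐ y ∂(volume.restrict e.target),
      CovField.mat g.lower.1 e y * ContraField.mat g.upper.1 e y = 1 := by
  filter_upwards [g.inverse e he, ae_restrict_mem e.open_target.measurableSet] with y h1 hy
  rw [CovField.mat_eq he hy, ContraField.mat_eq he hy]
  exact (inverse_iff_formMat_mul_eq_one _ _ _).1 h1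

end Tensors

end

noncomputable section

/-! ### A uniformity argument for families of differentiable functions -/

/-- Let `S k` consist of the `μ` for which `p μ t` holds whenever `|t| < 1 / (k + 1)`. Countably
many `S k` cover an uncountable interval, so one of them is infinite and accumulates; two of its
points close enough to each other are as required. -/
theorem exists_pair_of_forall_eventually {η : ℝ} (hη : 0 < η) {p : ℝ → ℝ → Prop}
    (h : ∀ μ, ∀ᶠ t in 𝓝 0, p μ t) :
    ∃ μ₁ μ₂, |μ₁| < η ∧ |μ₂| < η ∧ μ₁ ≠ μ₂ ∧ p μ₁ (μ₂ - μ₁) ∧ p μ₂ (μ₁ - μ₂) := by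
  let S : ℕ → Set ℝ := fun k => {μ ∈ Set.Ioo (-η) η | ∀ t, |t| < 1 / ((k : ℝ) + 1) → p μ t}
  have hS : Set.Ioo (-η) η ⊆ ⋃ k, S k := fun μ hμ => by
    obtain ⟨ε, hε, hp⟩ := Metric.eventually_nhds_iff.1 (h μ)
    obtain ⟨k, hk⟩ := exists_nat_one_div_lt hε
    exact Set.mem_iUnion.2 ⟨k, hμ, fun t ht => hp (by simpa using ht.trans hk)⟩
  obtain ⟨k, hk⟩ : ∃ k, (S k).Infinite := by
    by_contra! hfin
    have h1 := (Set.countable_iUnion fun k => (hfin k).countable).mono hS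
    rw [Cardinal.Real.Ioo_countable_iff] at h1
    linarith
  obtain ⟨a, -, ha⟩ := hk.exists_accPt_of_subset_isCompact isCompact_Icc
    ((Set.sep_subset _ _).trans Set.Ioo_subset_Icc_self)
  have hd : (0 : ℝ) < 1 / ((k : ℝ) + 1) / 2 := by positivity
  rw [accPt_iff_nhds] at ha
  obtain ⟨μ₁, ⟨h1a, h1⟩, hne1⟩ := ha _ (Metric.ball_mem_nhds a hd)
  -- The second radius does not exceed the distance from `μ₁` to `a`, hence `μ₂ ≠ μ₁`.
  have hr : 0 < min (1 / ((k : ℝ) + 1) / 2) |μ₁ - a| := lt_min hd (abs_pos.2 (sub_ne_zero.2 hne1))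
  obtain ⟨μ₂, ⟨h2a, h2⟩, hne2⟩ := ha _ (Metric.ball_mem_nhds a hr)
  rw [Metric.mem_ball, Real.dist_eq] at h1a h2a
  have h12 : |μ₁ - μ₂| < 1 / ((k : ℝ) + 1) := by
    have := abs_sub_le μ₁ a μ₂
    rw [abs_sub_comm a μ₂] at this
    linarith [h2a.trans_le (min_le_left _ _)]
  refine ⟨μ₁, μ₂, abs_lt.2 h1.1, abs_lt.2 h2.1, ?_, h1.2 _ (by rwa [abs_sub_comm]), h2.2 _ h12⟩
  rintro rfl
  exact absurd (h2a.trans_le (min_le_right _ _)) (lt_irrefl _)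

/-- If the curves `φ μ₁` and `ψ μ₂` through `c` meet at the parameters `±(μ₂ - μ₁)`, then their
velocities cancel in the limit; no uniformity in `μ` of the differentiability is needed. -/
theorem add_eq_zero_of_hasDerivAt_of_crossing {φ ψ : ℝ → ℝ → ℝ} {α β : ℝ → ℝ} {α₀ β₀ c δ : ℝ}
    (hδ : 0 < δ) (hφ : ∀ μ, HasDerivAt (φ μ) (α μ) 0) (hψ : ∀ μ, HasDerivAt (ψ μ) (β μ) 0)
    (hφ0 : ∀ μ, φ μ 0 = c) (hψ0 : ∀ μ, ψ μ 0 = c) (hα : Tendsto α (𝓝 0) (𝓝 α₀))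
    (hβ : Tendsto β (𝓝 0) (𝓝 β₀)) {p : ℝ → ℝ → Prop} (hp : ∀ μ, ∀ᶠ t in 𝓝 0, p μ t)
    (h : ∀ μ₁ μ₂, |μ₁| < δ → |μ₂| < δ → p μ₁ (μ₂ - μ₁) → p μ₂ (μ₁ - μ₂) →
      φ μ₁ (μ₂ - μ₁) = ψ μ₂ (μ₁ - μ₂)) : α₀ + β₀ = 0 := by
  have key : ∀ ε > 0, |α₀ + β₀| ≤ 4 * ε := fun ε hε => by
    obtain ⟨η₁, hη₁, h1⟩ := Metric.eventually_nhds_iff.1 (hα.eventually (Metric.ball_mem_nhds α₀ hε))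
    obtain ⟨η₂, hη₂, h2⟩ := Metric.eventually_nhds_iff.1 (hβ.eventually (Metric.ball_mem_nhds β₀ hε))
    have hest : ∀ {f : ℝ → ℝ} {a : ℝ}, f 0 = c → HasDerivAt f a 0 →
        ∀ᶠ t in 𝓝 (0 : ℝ), |f t - c - t * a| ≤ ε * |t| := fun {f a} hf0 hf => by
      have := (hasDerivAt_iff_isLittleO.1 hf).bound hε
      simpa [hf0] using this
    -- The selected pair satisfies the expansion of `φ μ₁` at `μ₂ - μ₁` and that of `ψ μ₂` at `μ₁ -
    -- μ₂`, both with the same `ε`.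
    obtain ⟨μ₁, μ₂, hμ₁, hμ₂, hne, ⟨hp₁, h3, -⟩, hp₂, -, h4⟩ :=
      exists_pair_of_forall_eventually (lt_min hδ (lt_min hη₁ hη₂)) fun μ =>
        (hp μ).and ((hest (hφ0 μ) (hφ μ)).and (hest (hψ0 μ) (hψ μ)))
    simp only [lt_min_iff] at hμ₁ hμ₂
    have h5 := h μ₁ μ₂ hμ₁.1 hμ₂.1 hp₁ hp₂
    have h6 : |α μ₁ - α₀| < ε := h1 (by simpa using hμ₁.2.1)
    have h7 : |β μ₂ - β₀| < ε := h2 (by simpa using hμ₂.2.2)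
    rw [abs_sub_comm μ₁ μ₂] at h4
    -- The curves start at the same value and meet, so in the difference of the expansions only the
    -- linear terms remain.
    have h8 : |(μ₂ - μ₁) * (α μ₁ + β μ₂)| ≤ 2 * ε * |μ₂ - μ₁| := by
      have e : (μ₂ - μ₁) * (α μ₁ + β μ₂) = (ψ μ₂ (μ₁ - μ₂) - c - (μ₁ - μ₂) * β μ₂) -
          (φ μ₁ (μ₂ - μ₁) - c - (μ₂ - μ₁) * α μ₁) := by rw [h5]; ring
      rw [e]
      exact (abs_sub _ _).trans (by linarith)
    have h9 : |α μ₁ + β μ₂| ≤ 2 * ε := by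
      rw [abs_mul, mul_comm] at h8
      exact le_of_mul_le_mul_right h8 (abs_pos.2 (sub_ne_zero.2 hne.symm))
    rw [abs_le] at *
    rw [abs_lt] at h6 h7
    constructor <;> linarith
  by_contra hne
  have := key (|α₀ + β₀| / 8) (by positivity)
  linarith [abs_pos.2 hne]

/-! ### Identities between matrices -/

section Matrices

variable {n : ℕ} {t t' : ℝ} {G H L L' P Q U U' Y : Matrix (Fin n) (Fin n) ℝ}

/-- The resolvent identity: multiply `L * (H + t • Y) = 1` by `G` on the right. -/
theorem lower_eq_add_smul (hGH : G * H = 1) (hLU : L * (H + t • Y) = 1) :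
    G = L + t • (L * Y * G) := by
  have h := congrArg (· * G) hLU
  simp only [mul_add, add_mul, one_mul, mul_assoc, mul_eq_one_comm.1 hGH, mul_one, mul_smul_comm,
    smul_mul_assoc] at h
  rw [mul_assoc, h]

/-- The resolvent identity as a linear equation for `L * Y * G` with the small coefficient `-t`; it
is the source of the a priori bound. -/
theorem mul_mul_eq_add_smul (hGH : G * H = 1) (hLU : L * (H + t • Y) = 1) :
    L * Y * G = G * Y * G + (-t) • (L * Y * G * (Y * G)) := by
  have h := congrArg (· * (Y * G)) (lower_eq_add_smul hGH hLU)
  simp only [add_mul, smul_mul_assoc, mul_assoc] at h ⊢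
  rw [neg_smul, ← sub_eq_add_neg, eq_sub_iff_add_eq, ← h]

/-- This rests on `Y * G * (H + t • Y) = (H + t • Y) * G * Y`. For symmetric `G`, `L`, `Y` it says
that `L * Y * G` is symmetric, hence an admissible direction. -/
theorem mul_mul_comm_of_inverse (hGH : G * H = 1) (hLU : L * (H + t • Y) = 1) :
    L * Y * G = G * Y * L := by
  have h1 := mul_mul_eq_add_smul hGH hLU
  have hHG := mul_eq_one_comm.1 hGH
  have hUL := mul_eq_one_comm.1 hLU
  have h2 : Y * G * (H + t • Y) = (H + t • Y) * G * Y := by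
    simp only [mul_add, add_mul, mul_assoc, hGH, mul_one, mul_smul_comm, smul_mul_assoc]
    rw [← mul_assoc H G Y, hHG, one_mul]
  calc L * Y * G = L * (Y * G * (H + t • Y)) * L := by
        simp only [mul_assoc, hUL, mul_one]
    _ = L * (H + t • Y) * (G * Y * L) := by rw [h2]; simp only [mul_assoc]
    _ = G * Y * L := by rw [hLU, one_mul]

/-- By the resolvent identity the point on the lower line is `L * (H + t' • Y) * G`, and the point
on the upper line is `H * L' * (H + t • Y)`; these two matrices are inverse to each other. -/
theorem eq_of_crossing (hGH : G * H = 1) (hLU : L * (H + t • Y) = 1)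
    (hLU' : L' * (H + t' • Y) = 1) (hP : P = G + (t' - t) • (L * Y * G))
    (hQ : Q * (H + (t - t') • (H * (L' * Y * G) * H)) = 1) : P = Q := by
  have hHG := mul_eq_one_comm.1 hGH
  have h1 : P = L * (H + t' • Y) * G := by
    rw [hP]
    nth_rewrite 1 [lower_eq_add_smul hGH hLU]
    simp only [mul_add, add_mul, mul_assoc, hHG, mul_one, mul_smul_comm, smul_mul_assoc]
    module
  have h2 : H + (t - t') • (H * (L' * Y * G) * H) = H * L' * (H + t • Y) := by
    have h3 : H * L' * (H + t' • Y) = H := by rw [mul_assoc, hLU', mul_one]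
    nth_rewrite 1 [← h3]
    simp only [mul_add, mul_assoc, hGH, mul_one, mul_smul_comm]
    module
  have h3 : P * (H + (t - t') • (H * (L' * Y * G) * H)) = 1 := by
    rw [h1, h2]
    calc L * (H + t' • Y) * G * (H * L' * (H + t • Y))
        = L * (H + t' • Y) * (G * H) * L' * (H + t • Y) := by simp only [mul_assoc]
      _ = L * ((H + t' • Y) * L') * (H + t • Y) := by rw [hGH]; simp only [mul_assoc, one_mul]
      _ = 1 := by rw [mul_eq_one_comm.1 hLU', mul_one, hLU]
  exact left_inv_eq_right_inv h3 (mul_eq_one_comm.1 hQ) ▸ rfl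

end Matrices

/-! ### Symmetrization -/

section Tensors

variable {n m : ℕ} {M : Type*} [TopologicalSpace M] [ChartedSpace (EuclideanSpace ℝ (Fin n)) M]
  {e : OpenPartialHomeomorph M (EuclideanSpace ℝ (Fin n))} {y : EuclideanSpace ℝ (Fin n)}

/-- The tensor field `X_{ji}`. -/
def SobolevCov.flip : SobolevCov m n M →ₗ[ℝ] SobolevCov m n M where
  toFun X := ⟨fun x => (X.1 x).flip, fun e he i j => X.2 e he j i⟩
  map_add' _ _ := rfl
  map_smul' _ _ := rfl

/-- The tensor field `Y^{ji}`. -/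
def SobolevContra.flip : SobolevContra m n M →ₗ[ℝ] SobolevContra m n M where
  toFun Y := ⟨fun x => (Y.1 x).flip, fun e he i j => Y.2 e he j i⟩
  map_add' _ _ := rfl
  map_smul' _ _ := rfl

/-- The symmetric part of a covariant tensor field. -/
def SobolevCov.symmPart : SobolevCov m n M →ₗ[ℝ] SobolevCov m n M :=
  (1 / 2 : ℝ) • (LinearMap.id + SobolevCov.flip)

/-- The symmetric part of a contravariant tensor field. -/
def SobolevContra.symmPart : SobolevContra m n M →ₗ[ℝ] SobolevContra m n M :=
  (1 / 2 : ℝ) • (LinearMap.id + SobolevContra.flip)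

theorem SobolevCov.symmPart_symm (X : SobolevCov m n M) (x : M) (v w) :
    (SobolevCov.symmPart X).1 x v w = (SobolevCov.symmPart X).1 x w v := by
  change (1 / 2 : ℝ) * (X.1 x v w + X.1 x w v) = (1 / 2 : ℝ) * (X.1 x w v + X.1 x v w)
  ring

theorem SobolevContra.symmPart_symm (Y : SobolevContra m n M) (x : M) (α β) :
    (SobolevContra.symmPart Y).1 x α β = (SobolevContra.symmPart Y).1 x β α := by
  change (1 / 2 : ℝ) * (Y.1 x α β + Y.1 x β α) = (1 / 2 : ℝ) * (Y.1 x β α + Y.1 x α β)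
  ring

theorem SobolevCov.symmPart_eq_self {X : SobolevCov m n M} (h : ∀ x v w, X.1 x v w = X.1 x w v) :
    SobolevCov.symmPart X = X := by
  refine Subtype.ext (funext fun x => LinearMap.ext₂ fun v w => ?_)
  change (1 / 2 : ℝ) * (X.1 x v w + X.1 x w v) = _
  rw [h x w v]; ring

theorem SobolevContra.symmPart_eq_self {Y : SobolevContra m n M}
    (h : ∀ x α β, Y.1 x α β = Y.1 x β α) : SobolevContra.symmPart Y = Y := by
  refine Subtype.ext (funext fun x => LinearMap.ext₂ fun α β => ?_)
  change (1 / 2 : ℝ) * (Y.1 x α β + Y.1 x β α) = _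
  rw [h x β α]; ring

theorem SobolevCov.mat_symmPart (X : SobolevCov m n M) :
    CovField.mat (SobolevCov.symmPart X).1 e y =
      (1 / 2 : ℝ) • (CovField.mat X.1 e y + (CovField.mat X.1 e y).transpose) := rfl

theorem IsSymmCovDual.apply_symmPart {A : Module.Dual ℝ (SobolevCov m n M)} (hA : IsSymmCovDual A)
    (X : SobolevCov m n M) : A (SobolevCov.symmPart X) = A X := by
  have h : A (SobolevCov.flip X) = A X := hA X _ fun _ _ _ => rfl
  change A ((1 / 2 : ℝ) • (X + SobolevCov.flip X)) = _
  rw [map_smul, map_add, h, smul_eq_mul]; ring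

theorem IsSymmContraDual.apply_symmPart {B : Module.Dual ℝ (SobolevContra m n M)}
    (hB : IsSymmContraDual B) (Y : SobolevContra m n M) : B (SobolevContra.symmPart Y) = B Y := by
  have h : B (SobolevContra.flip Y) = B Y := hB Y _ fun _ _ _ => rfl
  change B ((1 / 2 : ℝ) • (Y + SobolevContra.flip Y)) = _
  rw [map_smul, map_add, h, smul_eq_mul]; ring

/-- Composition with the symmetrization leaves the values on symmetric fields unchanged, so it
provides a symmetric Euler–Lagrange operator. -/
theorem isSymmCovDual_comp_symmPart (A : Module.Dual ℝ (SobolevCov m n M)) :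
    IsSymmCovDual (A ∘ₗ SobolevCov.symmPart) := fun X X' h => by
  have : SobolevCov.symmPart X' = SobolevCov.symmPart X := by
    refine Subtype.ext (funext fun x => LinearMap.ext₂ fun v w => ?_)
    change (1 / 2 : ℝ) * (X'.1 x v w + X'.1 x w v) = (1 / 2 : ℝ) * (X.1 x v w + X.1 x w v)
    rw [h, h]; ring
  simp only [LinearMap.comp_apply, this]

theorem isSymmContraDual_comp_symmPart (B : Module.Dual ℝ (SobolevContra m n M)) :
    IsSymmContraDual (B ∘ₗ SobolevContra.symmPart) := fun Y Y' h => by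
  have : SobolevContra.symmPart Y' = SobolevContra.symmPart Y := by
    refine Subtype.ext (funext fun x => LinearMap.ext₂ fun v w => ?_)
    change (1 / 2 : ℝ) * (Y'.1 x v w + Y'.1 x w v) = (1 / 2 : ℝ) * (Y.1 x v w + Y.1 x w v)
    rw [h, h]; ring
  simp only [LinearMap.comp_apply, this]

/-- The sum of the seminorms over all `i`, `j` is invariant under transposition. -/
theorem IsBoundedCov.comp_symmPart {A : Module.Dual ℝ (SobolevCov m n M)} (hA : IsBoundedCov A) :
    IsBoundedCov (A ∘ₗ SobolevCov.symmPart) := by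
  obtain ⟨s, hs, C, hC⟩ := hA
  refine ⟨s, hs, C, fun X => ?_⟩
  have h1 := hC X
  have h2 := hC (SobolevCov.flip X)
  have h3 : ∀ p ∈ s, ∑ i, ∑ j,
      sobolevSeminorm m p.1.target p.2 (CovField.comp (SobolevCov.flip X).1 p.1 i j) =
      ∑ i, ∑ j, sobolevSeminorm m p.1.target p.2 (CovField.comp X.1 p.1 i j) :=
    fun p _ => Finset.sum_comm
  rw [Finset.sum_congr rfl h3] at h2
  change |A ((1 / 2 : ℝ) • (X + SobolevCov.flip X))| ≤ _
  rw [map_smul, map_add, smul_eq_mul, abs_mul, abs_of_pos (by norm_num : (0 : ℝ) < 1 / 2)]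
  linarith [abs_add_le (A X) (A (SobolevCov.flip X))]

theorem IsBoundedContra.comp_symmPart {B : Module.Dual ℝ (SobolevContra m n M)}
    (hB : IsBoundedContra B) : IsBoundedContra (B ∘ₗ SobolevContra.symmPart) := by
  obtain ⟨s, hs, C, hC⟩ := hB
  refine ⟨s, hs, C, fun Y => ?_⟩
  have h1 := hC Y
  have h2 := hC (SobolevContra.flip Y)
  have h3 : ∀ p ∈ s, ∑ i, ∑ j,
      sobolevSeminorm m p.1.target p.2 (ContraField.comp (SobolevContra.flip Y).1 p.1 i j) =
      ∑ i, ∑ j, sobolevSeminorm m p.1.target p.2 (ContraField.comp Y.1 p.1 i j) :=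
    fun p _ => Finset.sum_comm
  rw [Finset.sum_congr rfl h3] at h2
  change |B ((1 / 2 : ℝ) • (Y + SobolevContra.flip Y))| ≤ _
  rw [map_smul, map_add, smul_eq_mul, abs_mul, abs_of_pos (by norm_num : (0 : ℝ) < 1 / 2)]
  linarith [abs_add_le (B Y) (B (SobolevContra.flip Y))]

theorem IsBoundedCov.neg {A : Module.Dual ℝ (SobolevCov m n M)} (hA : IsBoundedCov A) :
    IsBoundedCov (-A) := by
  obtain ⟨s, hs, C, hC⟩ := hA
  exact ⟨s, hs, C, fun X => by simpa using hC X⟩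

theorem IsBoundedContra.neg {B : Module.Dual ℝ (SobolevContra m n M)} (hB : IsBoundedContra B) :
    IsBoundedContra (-B) := by
  obtain ⟨s, hs, C, hC⟩ := hB
  exact ⟨s, hs, C, fun X => by simpa using hC X⟩

/-! ### Uniqueness of the Euler–Lagrange operators -/

variable {F : SobolevMetric m n M → ℝ} {g : SobolevMetric m n M}

/-- The curves in `HasLowerVariation` prescribe only `lower`; this makes the derivative independent
of the chosen curve. -/
theorem RespectsAE.congr_lower (hF : RespectsAE F) {g g' : SobolevMetric m n M}
    (h : g.lower = g'.lower) : F g = F g' :=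
  hF _ _ fun _ _ => Eventually.of_forall fun _ => by rw [h]

theorem HasLowerVariation.unique (hF : RespectsAE F) {X : SobolevCov m n M} {a a' : ℝ}
    (h : HasLowerVariation F g X a) (h' : HasLowerVariation F g X a') : a = a' := by
  obtain ⟨γ, hγ, hd⟩ := h
  obtain ⟨γ', hγ', hd'⟩ := h'
  refine hd.unique (hd'.congr_of_eventuallyEq ?_)
  filter_upwards [hγ, hγ'] with t h1 h2 using hF.congr_lower (h1.trans h2.symm)

theorem RepresentsLowerVariation.comp_symmPart {A : Module.Dual ℝ (SobolevCov m n M)}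
    (hA : RepresentsLowerVariation F g A) :
    RepresentsLowerVariation F g (A ∘ₗ SobolevCov.symmPart) :=
  ⟨hA.1.comp_symmPart, fun X hX => by
    rw [LinearMap.comp_apply, SobolevCov.symmPart_eq_self hX]
    exact hA.2 X hX⟩

theorem RepresentsUpperVariation.comp_symmPart {B : Module.Dual ℝ (SobolevContra m n M)}
    (hB : RepresentsUpperVariation F g B) :
    RepresentsUpperVariation F g (B ∘ₗ SobolevContra.symmPart) :=
  ⟨hB.1.comp_symmPart, fun Y hY => by
    rw [LinearMap.comp_apply, SobolevContra.symmPart_eq_self hY]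
    exact hB.2 Y hY⟩

theorem RepresentsLowerVariation.unique (hF : RespectsAE F)
    {A A' : Module.Dual ℝ (SobolevCov m n M)} (hA : RepresentsLowerVariation F g A)
    (hs : IsSymmCovDual A) (hA' : RepresentsLowerVariation F g A') (hs' : IsSymmCovDual A') :
    A = A' := LinearMap.ext fun X => by
  rw [← hs.apply_symmPart, ← hs'.apply_symmPart]
  exact (hA.2 _ (SobolevCov.symmPart_symm X)).unique hF (hA'.2 _ (SobolevCov.symmPart_symm X))

variable [IsManifold (𝓡 n) ∞ M]

/-- At almost every point both metrics are left inverses of the same matrix. -/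
theorem RespectsAE.congr_upper (hF : RespectsAE F) {g g' : SobolevMetric m n M}
    (h : g.upper = g'.upper) : F g = F g' := by
  refine hF _ _ (aeOnManifold_cov_eq_iff.2 fun e he => ?_)
  filter_upwards [g.ae_mul_eq_one he, g'.ae_mul_eq_one he] with y h1 h2
  rw [h] at h1
  exact left_inv_eq_right_inv h1 (mul_eq_one_comm.1 h2)

theorem HasUpperVariation.unique (hF : RespectsAE F) {Y : SobolevContra m n M} {a a' : ℝ}
    (h : HasUpperVariation F g Y a) (h' : HasUpperVariation F g Y a') : a = a' := by
  obtain ⟨γ, hγ, hd⟩ := h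
  obtain ⟨γ', hγ', hd'⟩ := h'
  refine hd.unique (hd'.congr_of_eventuallyEq ?_)
  filter_upwards [hγ, hγ'] with t h1 h2 using hF.congr_upper (h1.trans h2.symm)

theorem RepresentsUpperVariation.unique (hF : RespectsAE F)
    {B B' : Module.Dual ℝ (SobolevContra m n M)} (hB : RepresentsUpperVariation F g B)
    (hs : IsSymmContraDual B) (hB' : RepresentsUpperVariation F g B') (hs' : IsSymmContraDual B') :
    B = B' := LinearMap.ext fun Y => by
  rw [← hs.apply_symmPart, ← hs'.apply_symmPart]
  exact (hB.2 _ (SobolevContra.symmPart_symm Y)).unique hF (hB'.2 _ (SobolevContra.symmPart_symm Y))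

/-! ### Variations of the inverse metric along its orbit -/

theorem SobolevMetric.ae_mul_add_smul_eq_one {γ : SobolevMetric m n M} {Y : SobolevContra m n M}
    {t : ℝ} (hγ : γ.upper = g.upper + t • Y) (he : e ∈ atlas (EuclideanSpace ℝ (Fin n)) M) :
    ∀ᵐ y ∂(volume.restrict e.target),
      CovField.mat γ.lower.1 e y * (ContraField.mat g.upper.1 e y + t • ContraField.mat Y.1 e y) =
        1 := by
  filter_upwards [γ.ae_mul_eq_one he] with y h1
  rw [hγ] at h1
  exact h1

/-- The symmetric part of `γ_{ik} g_{jl} Y^{kl}`. -/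
def mixedLower (g γ : SobolevMetric m n M) (Y : SobolevContra m n M) : SobolevCov m n M :=
  SobolevCov.symmPart ⟨_, contractBoth_mem γ.lower g.lower Y⟩

/-- The tensor field `mixedLower g γ Y` with indices raised by `g`. -/
def mixedUpper (g γ : SobolevMetric m n M) (Y : SobolevContra m n M) : SobolevContra m n M :=
  ⟨_, raiseIndices_mem g.upper (mixedLower g γ Y)⟩

theorem mixedUpper_symm (g γ : SobolevMetric m n M) (Y : SobolevContra m n M) (x : M) (α β) :
    (mixedUpper g γ Y).1 x α β = (mixedUpper g γ Y).1 x β α :=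
  SobolevCov.symmPart_symm _ _ _ _

theorem SobolevMetric.ae_transpose_upper_eq (g : SobolevMetric m n M)
    (he : e ∈ atlas (EuclideanSpace ℝ (Fin n)) M) : ∀ᵐ y ∂(volume.restrict e.target),
      (ContraField.mat g.upper.1 e y).transpose = ContraField.mat g.upper.1 e y := by
  filter_upwards [g.ae_mul_eq_one he, g.ae_transpose_eq he] with y h1 h2
  refine left_inv_eq_right_inv (a := CovField.mat g.lower.1 e y) ?_ h1
  rw [← h2, ← Matrix.transpose_mul, h1, Matrix.transpose_one]

section Orbit

variable {γ : SobolevMetric m n M} {Y : SobolevContra m n M} {t : ℝ}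

/-- The product is symmetric almost everywhere by `mul_mul_comm_of_inverse`, so the symmetrization
in `mixedLower` changes it only on a null set. It is there because the Euler–Lagrange operator is
tested with fields symmetric at every point. -/
theorem ae_mat_mixedLower (hY : ∀ x α β, Y.1 x α β = Y.1 x β α)
    (hγ : γ.upper = g.upper + t • Y) (he : e ∈ atlas (EuclideanSpace ℝ (Fin n)) M) :
    ∀ᵐ y ∂(volume.restrict e.target), CovField.mat (mixedLower g γ Y).1 e y =
      CovField.mat γ.lower.1 e y * ContraField.mat Y.1 e y * CovField.mat g.lower.1 e y := by
  filter_upwards [g.ae_mul_eq_one he, g.ae_transpose_eq he, γ.ae_transpose_eq he,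
    SobolevMetric.ae_mul_add_smul_eq_one hγ he, ae_restrict_mem e.open_target.measurableSet]
    with y h1 h2 h3 h4 hy
  have hYt : (ContraField.mat Y.1 e y).transpose = ContraField.mat Y.1 e y :=
    Matrix.ext fun _ _ => hY _ _ _
  rw [mixedLower, SobolevCov.mat_symmPart, mat_contractBoth he hy, h2, Matrix.transpose_mul,
    Matrix.transpose_mul, h2, h3, hYt, ← mul_assoc, ← mul_mul_comm_of_inverse h1 h4,
    ← two_smul ℝ, smul_smul]
  norm_num

theorem ae_mat_mixedUpper (hY : ∀ x α β, Y.1 x α β = Y.1 x β α)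
    (hγ : γ.upper = g.upper + t • Y) (he : e ∈ atlas (EuclideanSpace ℝ (Fin n)) M) :
    ∀ᵐ y ∂(volume.restrict e.target), ContraField.mat (mixedUpper g γ Y).1 e y =
      ContraField.mat g.upper.1 e y * (CovField.mat γ.lower.1 e y * ContraField.mat Y.1 e y *
        CovField.mat g.lower.1 e y) * ContraField.mat g.upper.1 e y := by
  filter_upwards [ae_mat_mixedLower hY hγ he, g.ae_transpose_upper_eq he,
    ae_restrict_mem e.open_target.measurableSet] with y h1 h2 hy
  rw [mixedUpper, mat_raiseIndices he hy, h1, h2]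

/-- The crossing of matrices, applied at almost every point of each chart. -/
theorem RespectsAE.eq_of_crossing (hF : RespectsAE F) {γ' P Q : SobolevMetric m n M} {t' : ℝ}
    (hY : ∀ x α β, Y.1 x α β = Y.1 x β α) (hγ : γ.upper = g.upper + t • Y)
    (hγ' : γ'.upper = g.upper + t' • Y) (hP : P.lower = g.lower + (t' - t) • mixedLower g γ Y)
    (hQ : Q.upper = g.upper + (t - t') • mixedUpper g γ' Y) : F P = F Q := by
  refine hF _ _ (aeOnManifold_cov_eq_iff.2 fun e he => ?_)
  filter_upwards [g.ae_mul_eq_one he, SobolevMetric.ae_mul_add_smul_eq_one hγ he,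
    SobolevMetric.ae_mul_add_smul_eq_one hγ' he, SobolevMetric.ae_mul_add_smul_eq_one hQ he,
    ae_mat_mixedLower hY hγ he, ae_mat_mixedUpper hY hγ' he] with y h1 h2 h3 h4 h5 h6
  rw [h6] at h4
  refine _root_.eq_of_crossing h1 h2 h3 ?_ h4
  rw [hP, ← h5]
  rfl

/-- Convergence of `mixedLower` along a segment of inverse metrics, in the charts. -/
theorem exists_isSobBoundedMat_mixedLower_sub {γ : ℝ → SobolevMetric m n M}
    (hY : ∀ x α β, Y.1 x α β = Y.1 x β α)
    (hγ : ∀ᶠ t in 𝓝 (0 : ℝ), (γ t).upper = g.upper + t • Y)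
    (he : e ∈ atlas (EuclideanSpace ℝ (Fin n)) M) {K : Set (EuclideanSpace ℝ (Fin n))}
    (hK : IsCompact K) (hKe : K ⊆ e.target) :
    ∃ D : NNReal, ∀ᶠ t : ℝ in 𝓝 0, IsSobBoundedMat m e.target K (D * ‖t‖₊)
      fun y => CovField.mat (mixedLower g (γ t) Y).1 e y -
        CovField.mat (contractBoth g.lower.1 g.lower.1 Y.1) e y := by
  obtain ⟨B, hB⟩ := SobolevCov.exists_bound ⟨_, contractBoth_mem g.lower g.lower Y⟩ he hK hKe
  obtain ⟨C, hC⟩ := SobolevCov.exists_bound g.lower he hK hKe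
  obtain ⟨C', hC'⟩ := SobolevContra.exists_bound Y he hK hKe
  have ha := hC'.mul e.open_target hK hKe hC
  set A : NNReal := n * 2 ^ m * (C' * C)
  have hsmall : ∀ᶠ t : ℝ in 𝓝 0, ‖-t‖₊ * (n * 2 ^ m * A) ≤ 1 / 2 := by
    have hc : Continuous fun t : ℝ => ‖-t‖₊ * (n * 2 ^ m * A) := by fun_prop
    refine (hc.tendsto 0).eventually_le_const ?_
    simp
  refine ⟨n * 2 ^ m * ((2 * B + 1) * A), ?_⟩
  filter_upwards [hγ, hsmall] with t hγt ht
  have hmat : CovField.mat (mixedLower g (γ t) Y).1 e =ᵐ[volume.restrict e.target] fun y =>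
      CovField.mat (contractBoth g.lower.1 g.lower.1 Y.1) e y + (-t) •
        (CovField.mat (mixedLower g (γ t) Y).1 e y *
          (ContraField.mat Y.1 e y * CovField.mat g.lower.1 e y)) := by
    filter_upwards [ae_mat_mixedLower hY hγt he, g.ae_mul_eq_one he, g.ae_transpose_eq he,
      SobolevMetric.ae_mul_add_smul_eq_one hγt he, ae_restrict_mem e.open_target.measurableSet]
      with y h1 h2 h3 h4 hy
    rw [h1, mat_contractBoth he hy, h3]
    exact mul_mul_eq_add_smul h2 h4
  -- The bound `B'` depends on `t`; the a priori estimate replaces it by `2 * B + 1`, which does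
  -- not.
  obtain ⟨B', hB'⟩ := SobolevCov.exists_bound (mixedLower g (γ t) Y) he hK hKe
  have hX := IsSobBoundedMat.of_eq_add_smul_mul e.open_target hK hKe hB' hB ha ht hmat
  refine (((hX.mul e.open_target hK hKe ha).smul (-t)).mono (le_of_eq ?_)).congr_ae
    e.open_target hKe ?_
  · rw [nnnorm_neg, mul_comm]
  · filter_upwards [hmat] with y h1
    rw [eq_sub_iff_add_eq, add_comm]
    exact h1.symm

/-- Raising the indices of `g_{ik} g_{jl} Y^{kl}` returns `Y`, so the difference is the previous one
multiplied by the inverse metric on both sides. -/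
theorem exists_isSobBoundedMat_mixedUpper_sub {γ : ℝ → SobolevMetric m n M}
    (hY : ∀ x α β, Y.1 x α β = Y.1 x β α)
    (hγ : ∀ᶠ t in 𝓝 (0 : ℝ), (γ t).upper = g.upper + t • Y)
    (he : e ∈ atlas (EuclideanSpace ℝ (Fin n)) M) {K : Set (EuclideanSpace ℝ (Fin n))}
    (hK : IsCompact K) (hKe : K ⊆ e.target) :
    ∃ D : NNReal, ∀ᶠ t : ℝ in 𝓝 0, IsSobBoundedMat m e.target K (D * ‖t‖₊)
      fun y => ContraField.mat (mixedUpper g (γ t) Y).1 e y - ContraField.mat Y.1 e y := by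
  obtain ⟨D, hD⟩ := exists_isSobBoundedMat_mixedLower_sub hY hγ he hK hKe
  obtain ⟨C, hC⟩ := SobolevContra.exists_bound g.upper he hK hKe
  refine ⟨n * 2 ^ m * (n * 2 ^ m * (C * D) * C), ?_⟩
  filter_upwards [hγ, hD] with t hγt hDt
  have h1 := (hC.mul e.open_target hK hKe hDt).mul e.open_target hK hKe hC
  refine (h1.mono (le_of_eq (by ring))).congr_ae e.open_target hKe ?_
  filter_upwards [ae_mat_mixedLower hY hγt he, ae_mat_mixedUpper hY hγt he, g.ae_mul_eq_one he,
    g.ae_transpose_eq he, ae_restrict_mem e.open_target.measurableSet] with y h2 h3 h4 h5 hy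
  rw [h3, ← h2, mat_contractBoth he hy, h5, mul_sub, sub_mul]
  congr 1
  have h6 := mul_eq_one_comm.1 h4
  simp only [mul_assoc, h4, mul_one]
  rw [← mul_assoc, h6, one_mul]

/-- The chain rule for the inversion of metrics, although `F` is only assumed to have directional
derivatives. -/
theorem RepresentsUpperVariation.apply_eq_neg (hF : RespectsAE F)
    {A : Module.Dual ℝ (SobolevCov m n M)} {B : Module.Dual ℝ (SobolevContra m n M)}
    (hA : RepresentsLowerVariation F g A) (hB : RepresentsUpperVariation F g B)
    (hY : ∀ x α β, Y.1 x α β = Y.1 x β α) :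
    B Y = -A ⟨_, contractBoth_mem g.lower g.lower Y⟩ := by
  obtain ⟨γ, hγ, -⟩ := hB.2 Y hY
  -- All these lines start at `g`; only their directions depend on the parameter, so no derivative
  -- of `F` at another metric is needed.
  choose P hP hP' using fun t => hA.2 (mixedLower g (γ t) Y) (SobolevCov.symmPart_symm _)
  choose Q hQ hQ' using fun t => hB.2 (mixedUpper g (γ t) Y) (mixedUpper_symm _ _ _)
  obtain ⟨δ, hδ, hγδ⟩ := Metric.eventually_nhds_iff.1 hγ
  have hγδ' : ∀ t : ℝ, |t| < δ → (γ t).upper = g.upper + t • Y := fun t ht =>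
    hγδ (by simpa using ht)
  have hlim := hA.1.tendsto (X := fun t => mixedLower g (γ t) Y)
    (X₀ := ⟨_, contractBoth_mem g.lower g.lower Y⟩) fun e he K hK hKe =>
      exists_isSobBoundedMat_mixedLower_sub hY hγ he hK hKe
  have hlim' := hB.1.tendsto (X := fun t => mixedUpper g (γ t) Y) (X₀ := Y) fun e he K hK hKe =>
    exists_isSobBoundedMat_mixedUpper_sub hY hγ he hK hKe
  refine eq_neg_of_add_eq_zero_right (add_eq_zero_of_hasDerivAt_of_crossing hδ hP' hQ' (c := F g)
    (fun μ => hF.congr_lower ?_) (fun μ => hF.congr_upper ?_) hlim hlim'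
    (fun μ => (hP μ).and (hQ μ)) fun μ₁ μ₂ h1 h2 h3 h4 =>
      hF.eq_of_crossing hY (hγδ' _ h1) (hγδ' _ h2) h3.1 h4.2)
  · simpa using (hP μ).self_of_nhds
  · simpa using (hQ μ).self_of_nhds

end Orbit

/-! ### Lowering and raising the indices of the Euler–Lagrange operators -/

theorem SobolevMetric.ae_mat_lower_raise (g : SobolevMetric m n M) (X : SobolevCov m n M)
    (he : e ∈ atlas (EuclideanSpace ℝ (Fin n)) M) : ∀ᵐ y ∂(volume.restrict e.target),
      CovField.mat (lowerIndices g.lower.1 (raiseIndices g.upper.1 X.1)) e y =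
        CovField.mat X.1 e y := by
  filter_upwards [g.ae_mul_eq_one he, g.ae_transpose_eq he, g.ae_transpose_upper_eq he,
    ae_restrict_mem e.open_target.measurableSet] with y h1 h2 h3 hy
  refine (mat_contractBoth he hy _ _ _).trans ?_
  rw [mat_raiseIndices he hy, h2, h3]
  simp only [mul_assoc, mul_eq_one_comm.1 h1, mul_one]
  rw [← mul_assoc, h1, one_mul]

section Identity

variable {A : Module.Dual ℝ (SobolevCov m n M)} {B : Module.Dual ℝ (SobolevContra m n M)}

/-- Lowering both indices with the same tensor commutes with symmetrization, so the case of
symmetric `Y` suffices. -/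
theorem upper_apply_eq_neg_lower_apply (hF : RespectsAE F) (hA : RepresentsLowerVariation F g A)
    (hAs : IsSymmCovDual A) (hB : RepresentsUpperVariation F g B) (hBs : IsSymmContraDual B)
    (Y : SobolevContra m n M) : B Y = -A ⟨_, contractBoth_mem g.lower g.lower Y⟩ := by
  rw [← hBs.apply_symmPart, hB.apply_eq_neg hF hA (SobolevContra.symmPart_symm Y),
    ← hAs.apply_symmPart ⟨_, contractBoth_mem g.lower g.lower Y⟩]
  congr 2

/-- Take for `Y` the field `X` with raised indices. Lowering them again returns `X` only almost
everywhere, which is enough because `A` is bounded. -/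
theorem lower_apply_eq_neg_upper_apply (hF : RespectsAE F) (hA : RepresentsLowerVariation F g A)
    (hAs : IsSymmCovDual A) (hB : RepresentsUpperVariation F g B) (hBs : IsSymmContraDual B)
    (X : SobolevCov m n M) : A X = -B ⟨_, raiseIndices_mem g.upper X⟩ := by
  rw [upper_apply_eq_neg_lower_apply hF hA hAs hB hBs, neg_neg]
  symm
  exact IsBoundedCov.congr_ae hA.1 (X' := X) fun e he => g.ae_mat_lower_raise X he

end Identity

end Tensors

end

/-! ### The theorem -/

theorem theorem4p1 (m n : ℕ) {M : Type*} [TopologicalSpace M] [T2Space M] [CompactSpace M]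
    [ChartedSpace (EuclideanSpace ℝ (Fin n)) M] [IsManifold (𝓡 n) ∞ M]
    (F : SobolevMetric m n M → ℝ) (hF : RespectsAE F) (g : SobolevMetric m n M)
    (hlow : ∃ A, RepresentsLowerVariation F g A) (hupp : ∃ B, RepresentsUpperVariation F g B) :
    (∃! A, RepresentsLowerVariation F g A ∧ IsSymmCovDual A) ∧
    (∃! B, RepresentsUpperVariation F g B ∧ IsSymmContraDual B) ∧
    ∀ A B, RepresentsLowerVariation F g A → IsSymmCovDual A →
      RepresentsUpperVariation F g B → IsSymmContraDual B →
      (A = 0 ↔ B = 0) ∧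
      ∃ A' B', IsLowered g A A' ∧ IsRaised g B B' ∧ IsRaised g A' (-B') := by
  obtain ⟨A₀, hA₀⟩ := hlow
  obtain ⟨B₀, hB₀⟩ := hupp
  refine ⟨⟨_, ⟨hA₀.comp_symmPart, isSymmCovDual_comp_symmPart A₀⟩, fun A hA =>
      hA.1.unique hF hA.2 hA₀.comp_symmPart (isSymmCovDual_comp_symmPart A₀)⟩,
    ⟨_, ⟨hB₀.comp_symmPart, isSymmContraDual_comp_symmPart B₀⟩, fun B hB =>
      hB.1.unique hF hB.2 hB₀.comp_symmPart (isSymmContraDual_comp_symmPart B₀)⟩,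
    fun A B hA hAs hB hBs => ?_⟩
  have hBA := upper_apply_eq_neg_lower_apply hF hA hAs hB hBs
  have hAB := lower_apply_eq_neg_upper_apply hF hA hAs hB hBs
  -- The lowered operator is `-B` and the raised one is `-A`, so their continuity is inherited and
  -- the last claim reads `A X = -B (raised X)`.
  refine ⟨⟨fun h => LinearMap.ext fun Y => by rw [hBA, h]; simp,
    fun h => LinearMap.ext fun X => by rw [hAB, h]; simp⟩, -B, -A, ?_, ?_, ?_⟩
  · exact ⟨hB.1.neg, fun Y => ⟨_, rfl, by rw [LinearMap.neg_apply, hBA, neg_neg]⟩⟩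
  · exact ⟨hA.1.neg, fun X => ⟨_, rfl, by rw [LinearMap.neg_apply, hAB, neg_neg]⟩⟩
  · rw [neg_neg]
    exact ⟨hA.1, fun X => ⟨_, rfl, by rw [LinearMap.neg_apply, hAB]⟩⟩
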